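/- **Setting.** Let $\boldsymbol l=(l_k)_{k\ge1}$ be a sequence of odd integers $l_k\ge3$. Put $q_0=0$, $q_j=e^{(2j-1)\pi i/4}$ $(1\le j\le4)$, let $K_0\subset\mathbb C$ be the closed square with vertices $q_1,\dots,q_4$, and for odd $l\ge 3$ let $S_l=\{2nl^{-1}q_j:0\le n\le\frac{l-1}2,\ 1\le j\le4\}$. Let $W_n=\prod_{k=1}^nS_{l_k}$, and for $w=w_1\cdots w_n\in W_n$ let $F_w=F_{w_1}\circ\cdots\circ F_{w_n}$ with $F_{w_k}(z)=w_k+l_k^{-1}z$. The scale-irregular Vicsek set is $K=\bigcap_{n\ge1}\bigcup_{w\in W_n}F_w(K_0)$, with the Euclidean metric $d$ and the Borel probability measure $\mu$ that gives mass $(\#W_n)^{-1}=\prod_{k=1}^n(2l_k-1)^{-1}$ to each cell $F_w(K_0)\cap K$, $w\in W_n$ (the image of the infinite product of the uniform distributions on the $S_{l_k}$ under the coding map). Let $V_0=\{q_0,\dots,q_4\}$, $V_n=\bigcup_{w\in W_n}F_w(V_0)$, and for $x,y\in V_n$ write $x\sim y$ if $d(x,y)=\prod_{k=1}^nl_k^{-1}$.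 Fix $1<p<\infty$. Put $\rho_n=2\prod_{k=1}^nl_k^{-1}$; for $\rho_{n+1}<r\le\rho_n$ $(n\ge0)$ let $\psi(r)=\prod_{k=1}^n(2l_k-1)^{-1}$ and $\phi(r)=\rho_n^{p-1}\psi(\rho_n)$, and for $r\ge2$ let $\psi(r)=1$, $\phi(r)=2^{p-1}$. For $u\in C(K)$ let $$\mathcal E_p(u)=\sup_{n\ge0}\ \tfrac12\Big(\prod_{k=1}^nl_k^{p-1}\Big)\sum_{x,y\in V_n,\,x\sim y}|u(x)-u(y)|^p,\qquad \mathcal F_p=\{u\in C(K):\mathcal E_p(u)<\infty\}.$$ Fix $\beta^*\in(0,\infty)$. For $\beta\ge0$ and $u\in C(K)$ let $$\mathcal E_n^\beta(u)=\tfrac12\,\phi(\rho_n)^{-\beta/\beta^*}\psi(\rho_n)\sum_{x,y\in V_n,\,x\sim y}|u(x)-u(y)|^p,\quad \mathcal E_{p,\infty}^\beta(u)=\sup_{n\ge0}\mathcal E_n^\beta(u),\quad \mathcal E_{p,p}^\beta(u)=\sum_{n\ge0}\mathcal E_n^\beta(u),$$ and for $u\in L^p(K,\mu)$ and $0<r\le\operatorname{diam}K$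 let $$\Phi_u^\beta(r)=\int_K\frac1{\mu(B(x,r))}\int_{B(x,r)}\frac{|u(x)-u(y)|^p}{\phi(r)^{\beta/\beta^*}}\,d\mu(y)\,d\mu(x),$$ $$[u]_{B_{p,\infty}^\beta}=\sup_{0<r\le\operatorname{diam}K}\Phi_u^\beta(r)^{1/p},\qquad [u]_{B_{p,p}^\beta}=\Big(\int_0^{\operatorname{diam}K}\Phi_u^\beta(r)\,\frac{dr}r\Big)^{1/p}.$$ For $q\in\{p,\infty\}$ let $B_{p,q}^\beta=\{u\in L^p(K,\mu):[u]_{B_{p,q}^\beta}<\infty\}$. Energies and seminorms take values in $[0,\infty]$; an inclusion of a Besov space in $C(K)$, or an equality with a subspace of $C(K)$, is understood through continuous $\mu$-versions. **Theorem 1.3.** Assume $\sup_nl_n<\infty$ and let $1<p<\infty$. There is a constant $\epsilon_p\in(0,1)$ depending only on $\boldsymbol l$ and $p$ such that for every $\beta^*\in(0,\infty)$ the following hold. 1. For every $\beta\in(\epsilon_p\beta^*,\infty)$ we have $B_{p,p}^\beta\subset B_{p,\infty}^\beta\subset C(K)$, and there is $C\ge1$ such that for all $u\in C(K)$ $$C^{-1}[u]^p_{B_{p,\infty}^\beta}\le\mathcal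 E_{p,\infty}^\beta(u)\le C[u]^p_{B_{p,\infty}^\beta},\qquad C^{-1}[u]^p_{B_{p,p}^\beta}\le\mathcal E_{p,p}^\beta(u)\le C[u]^p_{B_{p,p}^\beta}.$$ In particular $\mathcal F_p=B_{p,\infty}^{\beta^*}$, and there is $C\ge1$ with $C^{-1}[u]^p_{B_{p,\infty}^{\beta^*}}\le\mathcal E_p(u)\le C[u]^p_{B_{p,\infty}^{\beta^*}}$ for all $u\in\mathcal F_p$. 2. $\beta^*$ is the critical Besov exponent: $\beta^*=\max\{\beta\in[0,\infty):B_{p,\infty}^\beta\text{ contains a function that is not }\mu\text{-a.e. constant}\}$. 3. There is $C<\infty$ such that $\displaystyle\sup_{0<r\le\operatorname{diam}K}\Phi_u^{\beta^*}(r)\le C\liminf_{r\to0}\Phi_u^{\beta^*}(r)$ for all $u\in B_{p,\infty}^{\beta^*}$. 4. There is $C>1$ such that for all $u\in\mathcal F_p=B_{p,\infty}^{\beta^*}$ $$C^{-1}\mathcal E_p(u)\le\liminf_{\beta\uparrow\beta^*}(\beta^*-\beta)\mathcal E_{p,p}^\beta(u)\le\limsup_{\beta\uparrow\beta^*}(\beta^*-\beta)\mathcal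 E_{p,p}^\beta(u)\le C\mathcal E_p(u),$$ $$C^{-1}[u]^p_{B_{p,\infty}^{\beta^*}}\le\liminf_{\beta\uparrow\beta^*}(\beta^*-\beta)[u]^p_{B_{p,p}^\beta}\le\limsup_{\beta\uparrow\beta^*}(\beta^*-\beta)[u]^p_{B_{p,p}^\beta}\le C[u]^p_{B_{p,\infty}^{\beta^*}}.$$ -/

import Mathlib

open MeasureTheory Filter Topology Set
open scoped ENNReal NNReal

noncomputable section

namespace Vicsek

/-- A sequence of odd integers `≥ 3`.  The entry `l.ratio k` (`k = 0, 1, 2, …`) is the term usually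
written `l_{k+1}` (the sequence being indexed from `1`). -/
structure RatioSeq where
  ratio : ℕ → ℕ
  odd : ∀ k, Odd (ratio k)
  three_le : ∀ k, 3 ≤ ratio k

/-- The corners `q_1, …, q_4` of the square: `corner j = q_{j+1} = exp ((2(j+1)-1)πi/4)`. -/
def corner (j : Fin 4) : ℂ :=
  Complex.exp ((2 * ((j : ℕ) + 1) - 1) * Real.pi * Complex.I / 4)

/-- The closed square `K_0` with vertices `q_1, …, q_4`. -/
def square : Set ℂ := convexHull ℝ (range corner)

/-- The alphabet `S_m = {2 n m⁻¹ q_j : 0 ≤ n ≤ (m-1)/2, 1 ≤ j ≤ 4}`. -/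
def letters (m : ℕ) : Set ℂ :=
  {z | ∃ n : ℕ, ∃ j : Fin 4, 2 * n + 1 ≤ m ∧ z = 2 * n * (m : ℂ)⁻¹ * corner j}

/-- Words of length `n`: the `k`-th letter is taken from the `k`-th alphabet. -/
abbrev Word (l : RatioSeq) (n : ℕ) : Type := (k : Fin n) → letters (l.ratio k)

/-- Infinite words. -/
abbrev InfWord (l : RatioSeq) : Type := (k : ℕ) → letters (l.ratio k)

/-- The similarity `F_w = F_{w_1} ∘ ⋯ ∘ F_{w_n}`, where `F_{w_k} (z) = w_k + l_k⁻¹ z`. -/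
def cellMap (l : RatioSeq) : (n : ℕ) → Word l n → ℂ → ℂ
  | 0, _ => id
  | n + 1, w =>
      cellMap l n (fun k => w k.castSucc) ∘
        fun z => (w (Fin.last n) : ℂ) + (l.ratio n : ℂ)⁻¹ * z

/-- The scale-irregular Vicsek set. -/
def vicsek (l : RatioSeq) : Set ℂ :=
  ⋂ n : ℕ, ⋃ w : Word l (n + 1), cellMap l (n + 1) w '' square

/-! ### The canonical probability measure -/

/-- `l_1⁻¹ ⋯ l_n⁻¹`. -/
def scale (l : RatioSeq) (n : ℕ) : ℝ := ∏ k ∈ Finset.range n, ((l.ratio k : ℝ))⁻¹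

/-- The point `w_1 + l_1⁻¹ w_2 + l_1⁻¹ l_2⁻¹ w_3 + ⋯` coded by an infinite word. -/
def codingPoint (l : RatioSeq) (w : InfWord l) : ℂ := ∑' k, (scale l k : ℂ) * (w k : ℂ)

theorem norm_corner (j : Fin 4) : ‖corner j‖ = 1 := by
  have h : ((2 * ((j : ℕ) + 1) - 1) * Real.pi * Complex.I / 4 : ℂ)
      = ((2 * ((j : ℕ) + 1) - 1) * Real.pi / 4 : ℝ) * Complex.I := by
    push_cast; ring
  rw [corner, h, Complex.norm_exp_ofReal_mul_I]

theorem isClosed_square : IsClosed square :=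
  ((finite_range corner).isCompact_convexHull (𝕜 := ℝ)).isClosed

theorem zero_mem_square : (0 : ℂ) ∈ square := by
  have h : corner 2 = -corner 0 := by
    have e : ((2 * (((2 : Fin 4) : ℕ) + 1) - 1) * Real.pi * Complex.I / 4 : ℂ)
        = (2 * (((0 : Fin 4) : ℕ) + 1) - 1) * Real.pi * Complex.I / 4 + Real.pi * Complex.I := by
      simp; ring
    rw [corner, e, Complex.exp_add, Complex.exp_pi_mul_I, corner]; ring
  have h0 : corner 0 ∈ square := subset_convexHull ℝ _ ⟨0, rfl⟩
  have h2 : corner 2 ∈ square := subset_convexHull ℝ _ ⟨2, rfl⟩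
  have := (convex_convexHull ℝ (range corner)) h0 h2 (a := 1 / 2) (b := 1 / 2)
    (by norm_num) (by norm_num) (by norm_num)
  rw [h] at this
  have e : (1 / 2 : ℝ) • corner 0 + (1 / 2 : ℝ) • (-corner 0) = 0 := by simp
  rw [e] at this
  exact this

theorem letterMap_mem_square {m : ℕ} (hm : 0 < m) {s z : ℂ} (hs : s ∈ letters m)
    (hz : z ∈ square) : s + (m : ℂ)⁻¹ * z ∈ square := by
  obtain ⟨n, j, hn, rfl⟩ := hs
  have hm' : (0 : ℝ) < m := by exact_mod_cast hm
  have hn' : (2 * n + 1 : ℝ) ≤ m := by exact_mod_cast hn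
  have hc : corner j ∈ square := subset_convexHull ℝ _ ⟨j, rfl⟩
  have hsum : (∑ i : Fin 3, (![2 * n / m, 1 / m, 1 - (2 * n + 1) / m] : Fin 3 → ℝ) i) = 1 := by
    simp [Fin.sum_univ_three]; ring
  have := (convex_convexHull ℝ (range corner)).sum_mem (t := Finset.univ)
    (w := (![2 * n / m, 1 / m, 1 - (2 * n + 1) / m] : Fin 3 → ℝ))
    (z := (![corner j, z, 0] : Fin 3 → ℂ))
    (by
      intro i _
      fin_cases i
      · simp; positivity
      · simp
      · simpa using (div_le_one hm').2 hn')
    hsum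
    (by
      intro i _
      fin_cases i
      · exact hc
      · exact hz
      · exact zero_mem_square)
  have e : (∑ i : Fin 3, (![2 * n / m, 1 / m, 1 - (2 * n + 1) / m] : Fin 3 → ℝ) i •
      (![corner j, z, 0] : Fin 3 → ℂ) i) = 2 * n * (m : ℂ)⁻¹ * corner j + (m : ℂ)⁻¹ * z := by
    simp only [Fin.sum_univ_three, Matrix.cons_val, Complex.real_smul, Complex.ofReal_div,
      Complex.ofReal_mul, Complex.ofReal_natCast, Complex.ofReal_ofNat, Complex.ofReal_one, mul_zero,
      add_zero]
    ring
  rw [e] at this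
  exact this

theorem cellMap_apply (l : RatioSeq) (w : InfWord l) (n : ℕ) (z : ℂ) :
    cellMap l n (fun k => w k) z =
      ∑ k ∈ Finset.range n, (scale l k : ℂ) * (w k : ℂ) + (scale l n : ℂ) * z := by
  induction n generalizing z with
  | zero => simp [cellMap, scale]
  | succ n ih =>
    have := ih ((w n : ℂ) + (l.ratio n : ℂ)⁻¹ * z)
    simp only [cellMap, Function.comp_apply, Fin.val_castSucc, Fin.val_last]
    rw [this, Finset.sum_range_succ, scale, scale, Finset.prod_range_succ]
    push_cast
    ring

theorem cellMap_image_subset (l : RatioSeq) (w : InfWord l) {n m : ℕ} (h : n ≤ m) :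
    cellMap l m (fun k => w k) '' square ⊆ cellMap l n (fun k => w k) '' square := by
  induction m, h using Nat.le_induction with
  | base => exact subset_rfl
  | succ m _ ih =>
    refine subset_trans ?_ ih
    rintro _ ⟨z, hz, rfl⟩
    refine ⟨(w m : ℂ) + (l.ratio m : ℂ)⁻¹ * z, letterMap_mem_square ?_ (w m).2 hz, rfl⟩
    have := l.three_le m
    omega

theorem scale_nonneg (l : RatioSeq) (n : ℕ) : 0 ≤ scale l n :=
  Finset.prod_nonneg fun _ _ => by positivity

theorem scale_le (l : RatioSeq) (n : ℕ) : scale l n ≤ (1 / 3 : ℝ) ^ n := by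
  have : ∀ k ∈ Finset.range n, ((l.ratio k : ℝ))⁻¹ ≤ 1 / 3 := by
    intro k _
    rw [one_div]
    have : (3 : ℝ) ≤ l.ratio k := by exact_mod_cast l.three_le k
    exact inv_anti₀ (by norm_num) this
  calc scale l n ≤ ∏ _k ∈ Finset.range n, (1 / 3 : ℝ) :=
        Finset.prod_le_prod (fun _ _ => by positivity) this
    _ = _ := by simp

theorem norm_letter_le {m : ℕ} {s : ℂ} (hs : s ∈ letters m) : ‖s‖ ≤ 1 := by
  obtain ⟨n, j, hn, rfl⟩ := hs
  have hm' : (0 : ℝ) < m := by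
    have : 0 < m := by omega
    exact_mod_cast this
  have hn' : (2 * n + 1 : ℝ) ≤ m := by exact_mod_cast hn
  rw [norm_mul, norm_corner, mul_one, ← div_eq_mul_inv, norm_div]
  simp only [norm_mul, Complex.norm_natCast, Complex.norm_ofNat]
  rw [div_le_one hm']
  linarith

theorem summable_bound (k : ℕ) (l : RatioSeq) (w : InfWord l) :
    ‖(scale l k : ℂ) * (w k : ℂ)‖ ≤ (1 / 3 : ℝ) ^ k := by
  rw [norm_mul, Complex.norm_real, Real.norm_of_nonneg (scale_nonneg l k)]
  calc scale l k * ‖(w k : ℂ)‖ ≤ (1 / 3 : ℝ) ^ k * 1 :=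
        mul_le_mul (scale_le l k) (norm_letter_le (w k).2) (norm_nonneg _) (by positivity)
    _ = _ := mul_one _

theorem summable_third : Summable fun k : ℕ => (1 / 3 : ℝ) ^ k :=
  summable_geometric_of_lt_one (by norm_num) (by norm_num)

/-- The coded point lies in every cell `F_{w_1 ⋯ w_n}(K_0)`; it is the only such point, since the
diameters of these cells tend to `0`. -/
theorem codingPoint_mem_cell (l : RatioSeq) (w : InfWord l) (n : ℕ) :
    codingPoint l w ∈ cellMap l n (fun k => w k) '' square := by
  have hsum : Summable fun k => (scale l k : ℂ) * (w k : ℂ) :=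
    Summable.of_norm_bounded summable_third fun k => summable_bound k l w
  have hcl : IsClosed (cellMap l n (fun k => w k) '' square) := by
    have hc : Continuous (cellMap l n (fun k => w k)) := by
      have : cellMap l n (fun k => w k) = fun z =>
          ∑ k ∈ Finset.range n, (scale l k : ℂ) * (w k : ℂ) + (scale l n : ℂ) * z :=
        funext (cellMap_apply l w n)
      rw [this]; fun_prop
    exact (((finite_range corner).isCompact_convexHull (𝕜 := ℝ)).image hc).isClosed
  refine hcl.mem_of_tendsto hsum.hasSum.tendsto_sum_nat ?_
  filter_upwards [eventually_ge_atTop n] with m hm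
  refine cellMap_image_subset l w hm ⟨0, zero_mem_square, ?_⟩
  rw [cellMap_apply]; simp

theorem codingPoint_mem_vicsek (l : RatioSeq) (w : InfWord l) : codingPoint l w ∈ vicsek l :=
  mem_iInter.2 fun n => mem_iUnion.2 ⟨fun k => w k, codingPoint_mem_cell l w (n + 1)⟩

/-- The coding map from infinite words onto the Vicsek set. -/
def coding (l : RatioSeq) (w : InfWord l) : vicsek l := ⟨codingPoint l w, codingPoint_mem_vicsek l w⟩

theorem continuous_coding (l : RatioSeq) : Continuous (coding l) := by
  refine Continuous.subtype_mk ?_ _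
  exact continuous_tsum (fun k => by fun_prop) summable_third fun k w => summable_bound k l w

instance finite_letters (m : ℕ) : Finite (letters m) := by
  have : letters m ⊆ (fun x : ℕ × Fin 4 => 2 * (x.1 : ℂ) * (m : ℂ)⁻¹ * corner x.2) ''
      (Iic m ×ˢ univ) := by
    rintro z ⟨n, j, hn, rfl⟩
    exact ⟨(n, j), ⟨by simp only [mem_Iic]; omega, mem_univ _⟩, rfl⟩
  exact (((finite_Iic m).prod finite_univ).image _).subset this

instance nonempty_letters (l : RatioSeq) (k : ℕ) : Nonempty (letters (l.ratio k)) :=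
  ⟨⟨0, 0, 0, by have := l.three_le k; omega, by simp⟩⟩

/-- The canonical Borel probability measure on the Vicsek set, which gives mass
`(# W_n)⁻¹ = (2 l_1 - 1)⁻¹ ⋯ (2 l_n - 1)⁻¹` to every cell of level `n`: the image under the coding
map of the infinite product of the uniform distributions on the alphabets. -/
def mu (l : RatioSeq) : Measure (vicsek l) :=
  (Measure.infinitePi fun k : ℕ =>
    ProbabilityTheory.uniformOn (univ : Set (letters (l.ratio k)))).map (coding l)

instance isProbabilityMeasure_mu (l : RatioSeq) : IsProbabilityMeasure (mu l) :=
  Measure.isProbabilityMeasure_map (continuous_coding l).measurable.aemeasurable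

/-! ### Scale functions -/

/-- `ρ_n = 2 l_1⁻¹ ⋯ l_n⁻¹`. -/
def rho (l : RatioSeq) (n : ℕ) : ℝ := 2 * scale l n

/-- For `0 < r ≤ 2`, the unique `n` with `ρ_{n+1} < r ≤ ρ_n`; for `r ≥ 2` the value is `0`. -/
def level (l : RatioSeq) (r : ℝ) : ℕ := sInf {n : ℕ | rho l (n + 1) < r}

/-- `ψ(r) = (2 l_1 - 1)⁻¹ ⋯ (2 l_n - 1)⁻¹` for `ρ_{n+1} < r ≤ ρ_n`, and `ψ(r) = 1` for `r ≥ 2`. -/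
def psi (l : RatioSeq) (r : ℝ) : ℝ :=
  ∏ k ∈ Finset.range (level l r), (2 * (l.ratio k : ℝ) - 1)⁻¹

/-- `φ(r) = ρ_n^{p-1} ψ(ρ_n)` for `ρ_{n+1} < r ≤ ρ_n`, and `φ(r) = 2^{p-1}` for `r ≥ 2`. -/
def phi (l : RatioSeq) (p r : ℝ) : ℝ := rho l (level l r) ^ (p - 1) * psi l (rho l (level l r))

/-! ### Graph approximations and discrete energies -/

/-- The vertex set `V_n = ⋃_{w ∈ W_n} F_w (V_0)`, with `V_0 = {0, q_1, …, q_4}`, as a set of points of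
the Vicsek set. -/
def vertices (l : RatioSeq) (n : ℕ) : Set (vicsek l) :=
  {x | (x : ℂ) ∈ ⋃ w : Word l n, cellMap l n w '' insert 0 (range corner)}

/-- The (ordered) edges: pairs of vertices of level `n` at Euclidean distance `l_1⁻¹ ⋯ l_n⁻¹`. -/
def edges (l : RatioSeq) (n : ℕ) : Set (vicsek l × vicsek l) :=
  {e | e.1 ∈ vertices l n ∧ e.2 ∈ vertices l n ∧ dist e.1 e.2 = scale l n}

/-- `∑_{x, y ∈ V_n, x ∼ y} |u(x) - u(y)|^p` (a finite sum, over ordered pairs). -/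
def edgeSum (l : RatioSeq) (p : ℝ) (n : ℕ) (u : vicsek l → ℝ) : ℝ≥0∞ :=
  ∑' e : edges l n, ENNReal.ofReal (|u e.1.1 - u e.1.2| ^ p)

/-- `ℰ_{p,n}(u) = ½ (l_1 ⋯ l_n)^{p-1} ∑_{x ∼ y in V_n} |u(x) - u(y)|^p`. -/
def energyAt (l : RatioSeq) (p : ℝ) (n : ℕ) (u : vicsek l → ℝ) : ℝ≥0∞ :=
  ENNReal.ofReal (1 / 2 * ∏ k ∈ Finset.range n, (l.ratio k : ℝ) ^ (p - 1)) * edgeSum l p n u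

/-- The `p`-energy `ℰ_p(u) = sup_n ℰ_{p,n}(u)`. -/
def energy (l : RatioSeq) (p : ℝ) (u : vicsek l → ℝ) : ℝ≥0∞ := ⨆ n, energyAt l p n u

/-- The domain `ℱ_p` of the `p`-energy. -/
def energyDomain (l : RatioSeq) (p : ℝ) : Set C(vicsek l, ℝ) := {u | energy l p u < ∞}

/-- `ℰ_n^β(u) = ½ φ(ρ_n)^{-β/β*} ψ(ρ_n) ∑_{x ∼ y in V_n} |u(x) - u(y)|^p`; `βs` stands for `β*`. -/
def besovEnergyAt (l : RatioSeq) (p βs β : ℝ) (n : ℕ) (u : vicsek l → ℝ) : ℝ≥0∞ :=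
  ENNReal.ofReal (1 / 2 * phi l p (rho l n) ^ (-(β / βs)) * psi l (rho l n)) * edgeSum l p n u

/-- `ℰ_{p,∞}^β(u) = sup_n ℰ_n^β(u)`. -/
def energyInf (l : RatioSeq) (p βs β : ℝ) (u : vicsek l → ℝ) : ℝ≥0∞ :=
  ⨆ n, besovEnergyAt l p βs β n u

/-- `ℰ_{p,p}^β(u) = ∑_n ℰ_n^β(u)`. -/
def energySum (l : RatioSeq) (p βs β : ℝ) (u : vicsek l → ℝ) : ℝ≥0∞ :=
  ∑' n, besovEnergyAt l p βs β n u

/-! ### Besov–Lipschitz seminorms and spaces -/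

/-- `Φ_u^β(r) = ∫_K ⨍_{B(x,r)} |u(x) - u(y)|^p / φ(r)^{β/β*} dμ(y) dμ(x)`. -/
def Phi (l : RatioSeq) (p βs β : ℝ) (u : vicsek l → ℝ) (r : ℝ) : ℝ≥0∞ :=
  ∫⁻ x, ⨍⁻ y in Metric.ball x r,
    ENNReal.ofReal (|u x - u y| ^ p / phi l p r ^ (β / βs)) ∂(mu l) ∂(mu l)

/-- The set of radii `(0, diam K]`. -/
def radii (l : RatioSeq) : Set ℝ := Ioc 0 (Metric.diam (vicsek l))

/-- `[u]_{B_{p,q}^β}` for finite `q`. -/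
def besovNorm (l : RatioSeq) (p q βs β : ℝ) (u : vicsek l → ℝ) : ℝ≥0∞ :=
  (∫⁻ r in radii l, Phi l p βs β u r ^ (q / p) / ENNReal.ofReal r) ^ (1 / q)

/-- `[u]_{B_{p,∞}^β}`. -/
def besovNormInf (l : RatioSeq) (p βs β : ℝ) (u : vicsek l → ℝ) : ℝ≥0∞ :=
  ⨆ r ∈ radii l, Phi l p βs β u r ^ (1 / p)

/-- `B_{p,q}^β` for finite `q`. -/
def besov (l : RatioSeq) (p q βs β : ℝ) : Set (vicsek l → ℝ) :=
  {u | MemLp u (ENNReal.ofReal p) (mu l) ∧ besovNorm l p q βs β u < ∞}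

/-- `B_{p,∞}^β`. -/
def besovInf (l : RatioSeq) (p βs β : ℝ) : Set (vicsek l → ℝ) :=
  {u | MemLp u (ENNReal.ofReal p) (mu l) ∧ besovNormInf l p βs β u < ∞}

end Vicsek

end

open Vicsek

namespace Vicsek

/-! ### Lattice coordinates -/

/-! The set is studied through infinite words and integer arithmetic. In units of `2 * scale l n`
the centre of a cell is the point of `ℤ × ℤ` whose mixed-radix digits are the lattice vectors of the
letters. Digits are balanced residues, so centres determine words, and cells that come close to each
other are equal or lattice neighbours. Every edge of level `n` joins the centre of a cell to one of
its corners, and at the next level it is cut into `l.ratio n` edges. Hölder's inequality on this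
subdivision loses exactly the factor by which the energy is renormalised, so the discrete energies
increase with the level (`energyAt_mono`).

Discrete energies and double integrals dominate each other by telescoping. Passing from a centre to
a corner through averages over shrinking cells bounds an edge sum by a series of double integrals at
finer scales (`edgeSum_rpow_le`). Passing from a point to centres of shrinking cells bounds a double
integral by a series of finer edge sums (`doubleInt_rpow_le`). Both series involve `p`-th roots, and
a Hardy inequality (`exists_weighted_le`) turns them into comparisons of weighted suprema and of
weighted sums as soon as the weights grow geometrically. With `t = β / β*`, the second direction
needs growth of `φ(ρ_n)^{-t}`, which holds for `t > 0`. The first needs growth of `φ(ρ_n)^{-t}`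
divided by the number of words. Since `2 l - 1 ≤ l ^ 2`, its ratio is at least `l ^ ((p + 1) t - 2)`
for `t ≤ 1`, whence the threshold `2 / (p + 1)` for `ε_p`. The same condition makes cell averages
converge uniformly, which gives continuous versions.

The remaining claims rest on the identity that the discrete Besov energy is, up to a constant,
`φ(ρ_n) ^ (1 - t)` times the `p`-energy of level `n` (`besovEnergyAt_eq_energyAt`). For `t > 1` this
factor tends to infinity while the energies increase, so only constants survive. At `t = 1` the
projection to a diagonal is a nonconstant function of finite energy. For `t` increasing to `1` the
sum is squeezed between geometric series whose sums are of order `1 / (1 - t)`, uniformly enough to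
give the convergence statement. Weak monotonicity uses monotonicity again: the function that
averages `u` over cells has energy bounded by a double integral at a single scale, and this bound
passes down to each fixed level and then to the limit (`energyAt_le_of_frequently`). -/

/-- The four unit directions of the lattice `ℤ × ℤ`. -/
def latDir : Fin 4 → ℤ × ℤ := ![(1, 0), (0, 1), (-1, 0), (0, -1)]

/-- The embedding of the lattice `ℤ × ℤ` in the plane along the diagonals of the square. -/
noncomputable def emb (v : ℤ × ℤ) : ℂ := ((v.1 : ℂ) + v.2 * Complex.I) * corner 0

/-- The norm on the plane whose unit ball is the square. -/
noncomputable def diamond (z : ℂ) : ℝ :=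
  |(z * starRingEnd ℂ (corner 0)).re| + |(z * starRingEnd ℂ (corner 0)).im|

theorem corner_mul_conj : corner 0 * starRingEnd ℂ (corner 0) = 1 := by
  rw [Complex.mul_conj, Complex.normSq_eq_norm_sq, norm_corner]; simp

theorem corner_eq_pow (j : Fin 4) : corner j = Complex.I ^ (j : ℕ) * corner 0 := by
  have h : Complex.I = Complex.exp (Real.pi / 2 * Complex.I) := by
    rw [Complex.exp_pi_div_two_mul_I]
  have h2 : Complex.I ^ (j : ℕ) = Complex.exp ((j : ℕ) * (Real.pi / 2 * Complex.I)) := by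
    rw [Complex.exp_nat_mul, ← h]
  rw [h2, corner, corner, ← Complex.exp_add]
  congr 1
  simp only [Fin.val_zero, Nat.cast_zero]
  ring

theorem corner_eq_emb (j : Fin 4) : corner j = emb (latDir j) := by
  rw [corner_eq_pow, emb]
  fin_cases j <;> simp [latDir, pow_succ]

theorem emb_add (v w : ℤ × ℤ) : emb (v + w) = emb v + emb w := by
  simp [emb]; ring

theorem emb_sub (v w : ℤ × ℤ) : emb (v - w) = emb v - emb w := by
  simp [emb]; ring

theorem emb_nsmul (n : ℕ) (v : ℤ × ℤ) : emb (n • v) = n * emb v := by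
  simp [emb]; ring

theorem diamond_add (z w : ℂ) : diamond (z + w) ≤ diamond z + diamond w := by
  simp only [diamond, add_mul, Complex.add_re, Complex.add_im]
  have h1 := abs_add_le (z * starRingEnd ℂ (corner 0)).re (w * starRingEnd ℂ (corner 0)).re
  have h2 := abs_add_le (z * starRingEnd ℂ (corner 0)).im (w * starRingEnd ℂ (corner 0)).im
  linarith

theorem diamond_neg (z : ℂ) : diamond (-z) = diamond z := by
  rw [diamond, neg_mul, Complex.neg_re, Complex.neg_im, abs_neg, abs_neg, diamond]

theorem diamond_sub (z w : ℂ) : diamond (z - w) ≤ diamond z + diamond w := by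
  rw [sub_eq_add_neg, ← diamond_neg w]; exact diamond_add _ _

theorem diamond_smul (r : ℝ) (z : ℂ) : diamond (r * z) = |r| * diamond z := by
  simp only [diamond, mul_assoc, Complex.re_ofReal_mul, Complex.im_ofReal_mul, abs_mul]
  ring

theorem norm_mul_conj_corner (z : ℂ) : ‖z * starRingEnd ℂ (corner 0)‖ = ‖z‖ := by
  rw [norm_mul, RCLike.norm_conj, norm_corner, mul_one]

theorem norm_le_diamond (z : ℂ) : ‖z‖ ≤ diamond z := by
  rw [← norm_mul_conj_corner z]; exact Complex.norm_le_abs_re_add_abs_im _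

theorem diamond_le (z : ℂ) : diamond z ≤ 2 * ‖z‖ := by
  rw [← norm_mul_conj_corner z, diamond]
  have h1 := Complex.abs_re_le_norm (z * starRingEnd ℂ (corner 0))
  have h2 := Complex.abs_im_le_norm (z * starRingEnd ℂ (corner 0))
  linarith

theorem diamond_emb (v : ℤ × ℤ) : diamond (emb v) = ((|v.1| + |v.2| : ℤ) : ℝ) := by
  have : emb v * starRingEnd ℂ (corner 0) = (v.1 : ℂ) + v.2 * Complex.I := by
    rw [emb, mul_assoc, corner_mul_conj, mul_one]
  rw [diamond, this]
  simp

theorem emb_injective : Function.Injective emb := by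
  intro v w h
  have h1 : diamond (emb (v - w)) = 0 := by rw [emb_sub, h, sub_self]; simp [diamond]
  rw [diamond_emb] at h1
  have h2 : |(v - w).1| + |(v - w).2| = 0 := by exact_mod_cast h1
  have a1 := abs_nonneg (v - w).1
  have a2 := abs_nonneg (v - w).2
  have b1 : (v - w).1 = 0 := abs_eq_zero.1 (by omega)
  have b2 : (v - w).2 = 0 := abs_eq_zero.1 (by omega)
  simp only [Prod.fst_sub, Prod.snd_sub] at b1 b2
  ext <;> omega

theorem latDir_norm (j : Fin 4) : |(latDir j).1| + |(latDir j).2| = 1 := by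
  fin_cases j <;> simp [latDir]

theorem diamond_le_one_of_mem_square {z : ℂ} (hz : z ∈ square) : diamond z ≤ 1 := by
  have hc : Convex ℝ {z : ℂ | diamond z ≤ 1} := by
    intro x hx y hy a b ha hb hab
    simp only [mem_ofPred_eq, Complex.real_smul] at *
    calc diamond (a * x + b * y) ≤ diamond (a * x) + diamond (b * y) := diamond_add _ _
      _ = a * diamond x + b * diamond y := by
        rw [diamond_smul, diamond_smul, abs_of_nonneg ha, abs_of_nonneg hb]
      _ ≤ a * 1 + b * 1 := by gcongr
      _ = 1 := by linarith
  refine convexHull_min ?_ hc hz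
  rintro _ ⟨j, rfl⟩
  simp [corner_eq_emb, diamond_emb, latDir_norm]

/-! ### Letters -/

/-- The letter `2 k m⁻¹ q_j`. -/
noncomputable def mkLetter (m k : ℕ) (j : Fin 4) (h : 2 * k + 1 ≤ m) : letters m :=
  ⟨2 * k * (m : ℂ)⁻¹ * corner j, k, j, h, rfl⟩

theorem exists_mkLetter {m : ℕ} (a : letters m) : ∃ k j h, a = mkLetter m k j h := by
  obtain ⟨z, k, j, h, rfl⟩ := a
  exact ⟨k, j, h, rfl⟩

theorem exists_code {m : ℕ} (a : letters m) : ∃ κ : ℤ × ℤ, (a : ℂ) = 2 * (m : ℂ)⁻¹ * emb κ := by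
  obtain ⟨z, k, j, h, rfl⟩ := a
  refine ⟨k • latDir j, ?_⟩
  change 2 * k * (m : ℂ)⁻¹ * corner j = _
  rw [emb_nsmul, corner_eq_emb]; ring

/-- The lattice vector of a letter. -/
noncomputable def code {m : ℕ} (a : letters m) : ℤ × ℤ := (exists_code a).choose

theorem coe_letter {m : ℕ} (a : letters m) : (a : ℂ) = 2 * (m : ℂ)⁻¹ * emb (code a) :=
  (exists_code a).choose_spec

theorem code_injective {m : ℕ} : Function.Injective (code : letters m → ℤ × ℤ) := by
  intro a b h
  apply Subtype.ext
  rw [coe_letter, coe_letter, h]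

theorem code_mkLetter {m k : ℕ} {j : Fin 4} (h : 2 * k + 1 ≤ m) :
    code (mkLetter m k j h) = k • latDir j := by
  apply emb_injective
  have h1 := coe_letter (mkLetter m k j h)
  have h0 : (m : ℂ) ≠ 0 := by
    have : m ≠ 0 := by omega
    exact_mod_cast this
  have h2 : ((mkLetter m k j h : letters m) : ℂ) = 2 * k * (m : ℂ)⁻¹ * corner j := rfl
  rw [emb_nsmul, ← corner_eq_emb]
  have : (2 * (m : ℂ)⁻¹) ≠ 0 := by simp [h0]
  apply mul_left_cancel₀ this
  rw [← h1, h2]; ring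

/-- Letters lie on the two arms of a cross, so one coordinate vanishes. The bounds make both
coordinates balanced residues modulo `m`, which is the source of all uniqueness statements about
words. -/
theorem code_bounds {m : ℕ} (a : letters m) :
    2 * |(code a).1| + 1 ≤ m ∧ 2 * |(code a).2| + 1 ≤ m ∧ ((code a).1 = 0 ∨ (code a).2 = 0) := by
  obtain ⟨k, j, h, rfl⟩ := exists_mkLetter a
  rw [code_mkLetter]
  fin_cases j <;> simp [latDir] <;> omega

/-- The letter `0` arises from all four directions and is counted once, by `none`. With `m = 2 h +
1` there remain `h` letters on each of four arms. -/
theorem card_letters {m : ℕ} (hm : Odd m) : Nat.card (letters m) = 2 * m - 1 := by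
  obtain ⟨h, rfl⟩ := hm
  let f : Option (Fin h × Fin 4) → letters (2 * h + 1) := fun o => match o with
    | none => mkLetter _ 0 0 (by omega)
    | some (k, j) => mkLetter _ (k + 1) j (by omega)
  have hinj : Function.Injective f := by
    intro a b hab
    have hc : code (f a) = code (f b) := by rw [hab]
    rcases a with _ | ⟨k, j⟩ <;> rcases b with _ | ⟨k', j'⟩
    · rfl
    · exfalso
      simp only [f, code_mkLetter] at hc
      fin_cases j' <;> simp [latDir, Prod.ext_iff] at hc <;> omega
    · exfalso
      simp only [f, code_mkLetter] at hc
      fin_cases j <;> simp [latDir] at hc <;> omega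
    · simp only [f, code_mkLetter] at hc
      have : (k : ℕ) = k' ∧ j = j' := by
        fin_cases j <;> fin_cases j' <;> simp [latDir, Fin.ext_iff] at hc ⊢ <;>
        omega
      rw [this.2, Fin.ext this.1]
  have hsurj : Function.Surjective f := by
    intro a
    obtain ⟨k, j, hk, rfl⟩ := exists_mkLetter a
    rcases k with _ | k
    · refine ⟨none, ?_⟩
      apply code_injective
      simp only [f, code_mkLetter]; simp
    · exact ⟨some (⟨k, by omega⟩, j), rfl⟩
  rw [← Nat.card_congr (Equiv.ofBijective f ⟨hinj, hsurj⟩)]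
  simp [Nat.card_eq_fintype_card]
  omega

/-! ### Centres of cells -/

/-- The lattice coordinates of the centre of the cell of level `n` given by an infinite word. -/
noncomputable def ctrCode (l : RatioSeq) (ω : InfWord l) : ℕ → ℤ × ℤ
  | 0 => 0
  | n + 1 => l.ratio n • ctrCode l ω n + code (ω n)

theorem ratio_pos (l : RatioSeq) (n : ℕ) : 0 < l.ratio n := by
  have := l.three_le n; omega

theorem scale_pos (l : RatioSeq) (n : ℕ) : 0 < scale l n :=
  Finset.prod_pos fun k _ => inv_pos.2 (by exact_mod_cast ratio_pos l k)

theorem scale_succ (l : RatioSeq) (n : ℕ) : scale l (n + 1) = scale l n * (l.ratio n : ℝ)⁻¹ := by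
  rw [scale, scale, Finset.prod_range_succ]

theorem ratio_mul_scale_succ (l : RatioSeq) (n : ℕ) :
    (l.ratio n : ℝ) * scale l (n + 1) = scale l n := by
  rw [scale_succ]
  have : (l.ratio n : ℝ) ≠ 0 := by exact_mod_cast (ratio_pos l n).ne'
  field_simp

theorem sum_eq_emb (l : RatioSeq) (ω : InfWord l) (n : ℕ) :
    ∑ k ∈ Finset.range n, (scale l k : ℂ) * (ω k : ℂ) = 2 * scale l n * emb (ctrCode l ω n) := by
  induction n with
  | zero => simp [ctrCode, emb]
  | succ n ih =>
    have h := ratio_mul_scale_succ l n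
    have h0 : (l.ratio n : ℂ) ≠ 0 := by exact_mod_cast (ratio_pos l n).ne'
    rw [Finset.sum_range_succ, ih, coe_letter, ctrCode, emb_add, emb_nsmul, ← h]
    push_cast
    field_simp

/-- Mixed-radix expansions with balanced digits are unique. -/
theorem ctrCode_eq_iff (l : RatioSeq) (ω ω' : InfWord l) (n : ℕ) :
    ctrCode l ω n = ctrCode l ω' n ↔ ∀ k < n, ω k = ω' k := by
  constructor
  · induction n with
    | zero => intro _ k hk; omega
    | succ n ih =>
      intro h k hk
      simp only [ctrCode] at h
      obtain ⟨a1, a2, -⟩ := code_bounds (ω n)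
      obtain ⟨b1, b2, -⟩ := code_bounds (ω' n)
      have hl := ratio_pos l n
      -- The difference of two digits is a multiple of `m` of absolute value less than `m`, hence
      -- zero.
      have key : ∀ (m : ℕ) (x y c d : ℤ), 2 * |c| + 1 ≤ m → 2 * |d| + 1 ≤ m →
          m • x + c = m • y + d → x = y := by
        intro m x y c d hc hd h
        rw [nsmul_eq_mul, nsmul_eq_mul] at h
        have h1 : (m : ℤ) * (x - y) = d - c := by linarith [mul_sub (m : ℤ) x y]
        have h2 : (m : ℤ) * |x - y| < m := by
          have : |d - c| ≤ |d| + |c| := abs_sub _ _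
          calc (m : ℤ) * |x - y| = |(m : ℤ) * (x - y)| := by rw [abs_mul, Nat.abs_cast]
            _ = |d - c| := by rw [h1]
            _ < m := by omega
        have h3 : |x - y| < 1 := by
          by_contra hcon
          nlinarith
        have h4 := abs_lt.1 h3
        omega
      have e1 := key _ _ _ _ _ a1 b1 (congrArg Prod.fst h)
      have e2 := key _ _ _ _ _ a2 b2 (congrArg Prod.snd h)
      have e : ctrCode l ω n = ctrCode l ω' n := Prod.ext e1 e2
      rcases Nat.lt_succ_iff_lt_or_eq.1 hk with hk | rfl
      · exact ih e k hk
      · rw [e] at h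
        exact code_injective (add_left_cancel h)
  · induction n with
    | zero => intro _; rfl
    | succ n ih =>
      intro h
      simp only [ctrCode]
      rw [ih fun k hk => h k (by omega), h n (by omega)]

theorem coding_eq (l : RatioSeq) (ω : InfWord l) (n : ℕ) : ∃ e : ℂ, diamond e ≤ 1 ∧
    (coding l ω : ℂ) = scale l n * (2 * emb (ctrCode l ω n) + e) := by
  obtain ⟨e, he, h⟩ := codingPoint_mem_cell l ω n
  refine ⟨e, diamond_le_one_of_mem_square he, ?_⟩
  rw [cellMap_apply, sum_eq_emb] at h
  change codingPoint l ω = _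
  rw [← h]; ring

theorem dist_coding_le {l : RatioSeq} {ω ω' : InfWord l} {n : ℕ} (h : ∀ k < n, ω k = ω' k) :
    dist (coding l ω) (coding l ω') ≤ 2 * scale l n := by
  obtain ⟨e, he, h1⟩ := coding_eq l ω n
  obtain ⟨e', he', h2⟩ := coding_eq l ω' n
  rw [Subtype.dist_eq, h1, h2, (ctrCode_eq_iff l ω ω' n).2 h, dist_eq_norm, ← mul_sub, norm_mul,
    add_sub_add_left_eq_sub, Complex.norm_real, Real.norm_of_nonneg (scale_nonneg l n), mul_comm]
  gcongr
  · exact scale_nonneg l n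
  · calc ‖e - e'‖ ≤ ‖e‖ + ‖e'‖ := norm_sub_le _ _
      _ ≤ 1 + 1 := add_le_add ((norm_le_diamond _).trans he) ((norm_le_diamond _).trans he')
      _ = 2 := by norm_num

/-- Cells of level `n` at distance `< 4/3` times their radius are equal or adjacent. -/
theorem ctrCode_near {l : RatioSeq} {ω ω' : InfWord l} {n : ℕ}
    (h : dist (coding l ω) (coding l ω') < scale l n) :
    |(ctrCode l ω' n - ctrCode l ω n).1| + |(ctrCode l ω' n - ctrCode l ω n).2| ≤ 1 := by
  obtain ⟨e, he, h1⟩ := coding_eq l ω n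
  obtain ⟨e', he', h2⟩ := coding_eq l ω' n
  have hs := scale_pos l n
  rw [dist_comm, Subtype.dist_eq, dist_eq_norm] at h
  set v := ctrCode l ω' n - ctrCode l ω n with hv
  have h3 : (coding l ω' : ℂ) - coding l ω = (scale l n : ℝ) * (2 * emb v + (e' - e)) := by
    rw [h1, h2, hv, emb_sub]; ring
  -- The diamond norm is at most twice the Euclidean one. The two offsets inside the cells cost at
  -- most `1` each, so the integer `|v.1| + |v.2|` is less than `2`.
  have h4 : diamond (2 * emb v + (e' - e)) < 2 := by
    have h5 := diamond_le ((coding l ω' : ℂ) - coding l ω)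
    rw [h3, diamond_smul, abs_of_pos hs, ← h3] at h5
    by_contra hcon
    nlinarith
  have h6 : diamond (2 * emb v) < 4 := by
    have h7 : (2 * emb v : ℂ) = (2 * emb v + (e' - e)) - (e' - e) := by ring
    rw [h7]
    calc _ ≤ _ := diamond_sub _ _
      _ < 2 + (1 + 1) := add_lt_add_of_lt_of_le h4
        ((diamond_sub _ _).trans (add_le_add he' he))
      _ = 4 := by norm_num
  have h8 : diamond (2 * emb v) = 2 * diamond (emb v) := by
    have := diamond_smul 2 (emb v); simpa using this
  rw [h8, diamond_emb] at h6
  have : ((|v.1| + |v.2| : ℤ) : ℝ) < 2 := by linarith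
  have : |v.1| + |v.2| < 2 := by exact_mod_cast this
  omega

theorem tendsto_scale (l : RatioSeq) : Tendsto (scale l) atTop (𝓝 0) :=
  squeeze_zero (scale_nonneg l) (scale_le l)
    (tendsto_pow_atTop_nhds_zero_of_lt_one (by norm_num) (by norm_num))

/-- A point approximated by the centres of the cells of a word is the coded point. -/
theorem coding_eq_of_centers {l : RatioSeq} {ω : InfWord l} {z : ℂ}
    (h : Tendsto (fun n => 2 * scale l n * emb (ctrCode l ω n)) atTop (𝓝 z)) :
    (coding l ω : ℂ) = z := by
  have hsum : Summable fun k => (scale l k : ℂ) * (ω k : ℂ) :=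
    Summable.of_norm_bounded summable_third fun k => summable_bound k l ω
  refine tendsto_nhds_unique hsum.hasSum.tendsto_sum_nat ?_
  simpa only [sum_eq_emb] using h

/-- Membership in the set provides a cell for each level, but not a consistent chain of cells.
Compactness does: the words whose level-`n` cell contains the point form a decreasing sequence of
nonempty compact sets. -/
theorem coding_surjective (l : RatioSeq) : Function.Surjective (coding l) := by
  intro x
  have hx := mem_iInter.1 x.2
  let K : ℕ → Set (InfWord l) := fun n => {ω | (x : ℂ) ∈ cellMap l (n + 1) (fun k => ω k) '' square}
  have hsq : IsCompact square := (finite_range corner).isCompact_convexHull (𝕜 := ℝ)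
  have hcl : ∀ n, IsClosed (K n) := by
    intro n
    let g : InfWord l → ℂ := fun ω => ∑ k ∈ Finset.range (n + 1), (scale l k : ℂ) * (ω k : ℂ)
    have hg : Continuous g := by fun_prop
    have hs : (scale l (n + 1) : ℂ) ≠ 0 := by exact_mod_cast (scale_pos l _).ne'
    have : K n = (fun ω => (scale l (n + 1) : ℂ)⁻¹ * ((x : ℂ) - g ω)) ⁻¹' square := by
      ext ω
      simp only [K, mem_ofPred_eq, mem_image, mem_preimage]
      constructor
      · rintro ⟨z, hz, h⟩
        rw [cellMap_apply] at h
        rw [← h, add_sub_cancel_left, inv_mul_cancel_left₀ hs]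
        exact hz
      · intro h
        refine ⟨_, h, ?_⟩
        rw [cellMap_apply, mul_inv_cancel_left₀ hs]
        simp [g]
    rw [this]
    exact hsq.isClosed.preimage (by fun_prop)
  have hne : (⋂ n, K n).Nonempty := by
    refine IsCompact.nonempty_iInter_of_sequence_nonempty_isCompact_isClosed K ?_ ?_ ?_ hcl
    · intro n ω h
      exact cellMap_image_subset l ω (by omega : n + 1 ≤ n + 1 + 1) h
    · intro n
      obtain ⟨w, hw⟩ := mem_iUnion.1 (hx n)
      refine ⟨fun k => if h : k < n + 1 then w ⟨k, h⟩ else (nonempty_letters l k).some, ?_⟩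
      simp only [K, mem_ofPred_eq]
      have : (fun k : Fin (n + 1) => if h : (k : ℕ) < n + 1 then w ⟨k, h⟩
          else (nonempty_letters l k).some) = w := by
        funext k
        exact dif_pos k.2
      rw [this]
      exact hw
    · exact (hcl 0).isCompact
  obtain ⟨ω, hω⟩ := hne
  refine ⟨ω, Subtype.ext (coding_eq_of_centers ?_)⟩
  rw [tendsto_iff_dist_tendsto_zero]
  refine squeeze_zero' (Eventually.of_forall fun _ => dist_nonneg) ?_ (tendsto_scale l)
  filter_upwards [eventually_ge_atTop 1] with n hn
  obtain ⟨n, rfl⟩ := Nat.exists_eq_add_of_le' hn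
  obtain ⟨z, hz, h⟩ := mem_iInter.1 hω n
  rw [cellMap_apply, sum_eq_emb] at h
  rw [← h, dist_eq_norm, sub_add_cancel_left, norm_neg, norm_mul, Complex.norm_real,
    Real.norm_of_nonneg (scale_nonneg _ _)]
  have := (norm_le_diamond z).trans (diamond_le_one_of_mem_square hz)
  nlinarith [scale_nonneg l (n + 1)]

/-! ### Finite words and vertices -/

/-- The infinite word that starts with `w` and continues with `τ`. -/
def glue {l : RatioSeq} {n : ℕ} (w : Word l n) (τ : InfWord l) : InfWord l :=
  fun k => if h : k < n then w ⟨k, h⟩ else τ k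

/-- The prefix of length `n` of an infinite word. -/
def pre {l : RatioSeq} (n : ℕ) (ω : InfWord l) : Word l n := fun k => ω k

/-- The infinite word whose letters are all `0`. -/
noncomputable def zeroWord (l : RatioSeq) : InfWord l :=
  fun k => mkLetter _ 0 0 (by have := l.three_le k; omega)

/-- The infinite word that codes the corner `q_j`. -/
noncomputable def endWord (l : RatioSeq) (j : Fin 4) : InfWord l :=
  fun k => mkLetter _ ((l.ratio k - 1) / 2) j (by have := l.three_le k; omega)

/-- The centre of a cell. -/
noncomputable def ctr {l : RatioSeq} {n : ℕ} (w : Word l n) : vicsek l :=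
  coding l (glue w (zeroWord l))

/-- The corners of a cell. -/
noncomputable def crn {l : RatioSeq} {n : ℕ} (w : Word l n) (j : Fin 4) : vicsek l :=
  coding l (glue w (endWord l j))

/-- The lattice coordinates of the centre of a cell. -/
noncomputable def wcode {l : RatioSeq} {n : ℕ} (w : Word l n) : ℤ × ℤ :=
  ctrCode l (glue w (zeroWord l)) n

theorem glue_lt {l : RatioSeq} {n : ℕ} (w : Word l n) (τ : InfWord l) {k : ℕ} (h : k < n) :
    glue w τ k = w ⟨k, h⟩ := dif_pos h

theorem glue_ge {l : RatioSeq} {n : ℕ} (w : Word l n) (τ : InfWord l) {k : ℕ} (h : n ≤ k) :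
    glue w τ k = τ k := dif_neg (by omega)

theorem pre_glue {l : RatioSeq} {n : ℕ} (w : Word l n) (τ : InfWord l) : pre n (glue w τ) = w := by
  funext k
  exact glue_lt w τ k.2

theorem pre_eq_iff {l : RatioSeq} {n : ℕ} {ω ω' : InfWord l} :
    pre n ω = pre n ω' ↔ ∀ k < n, ω k = ω' k :=
  ⟨fun h k hk => congrFun h ⟨k, hk⟩, fun h => funext fun k => h k k.2⟩

theorem ctrCode_eq_wcode {l : RatioSeq} (n : ℕ) (ω : InfWord l) :
    ctrCode l ω n = wcode (pre n ω) := by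
  rw [wcode, ctrCode_eq_iff]
  intro k hk
  rw [glue_lt _ _ hk, pre]

theorem wcode_injective {l : RatioSeq} {n : ℕ} : Function.Injective (wcode : Word l n → ℤ × ℤ) := by
  intro w w' h
  rw [wcode, wcode, ctrCode_eq_iff, ← pre_eq_iff, pre_glue, pre_glue] at h
  exact h

theorem coe_ctr {l : RatioSeq} {n : ℕ} (w : Word l n) :
    (ctr w : ℂ) = scale l n * (2 * emb (wcode w)) := by
  refine coding_eq_of_centers ?_
  refine tendsto_const_nhds.congr' ?_
  filter_upwards [eventually_ge_atTop n] with N hN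
  induction N, hN using Nat.le_induction with
  | base => rw [wcode]; ring
  | succ N hN ih =>
    rw [ih, ctrCode, emb_add, glue_ge _ _ hN, zeroWord, code_mkLetter, emb_nsmul,
      ← ratio_mul_scale_succ l N]
    simp [emb]; ring

/-- Along the continuation by `endWord l j` the centre of the cell of level `N` misses the corner by
exactly `scale l N` in direction `j`. This persists from level to level because `l.ratio N = 2 h +
1` and the letter is the `h`-th one, at the end of the arm. -/
theorem coe_crn {l : RatioSeq} {n : ℕ} (w : Word l n) (j : Fin 4) :
    (crn w j : ℂ) = scale l n * (2 * emb (wcode w) + corner j) := by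
  refine coding_eq_of_centers ?_
  have h0 : Tendsto (fun N => (scale l n * (2 * emb (wcode w) + corner j) : ℂ) -
      (scale l N : ℂ) * corner j) atTop (𝓝 (scale l n * (2 * emb (wcode w) + corner j) -
      ((0 : ℝ) : ℂ) * corner j)) := by
    refine tendsto_const_nhds.sub (Tendsto.mul_const _ ?_)
    exact (Complex.continuous_ofReal.tendsto 0).comp (tendsto_scale l)
  simp only [Complex.ofReal_zero, zero_mul, sub_zero] at h0
  refine h0.congr' ?_
  filter_upwards [eventually_ge_atTop n] with N hN
  induction N, hN using Nat.le_induction with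
  | base =>
    have : ctrCode l (glue w (endWord l j)) n = wcode w := by rw [ctrCode_eq_wcode, pre_glue]
    rw [this]; ring
  | succ N hN ih =>
    obtain ⟨h, hh⟩ := l.odd N
    have h1 : (l.ratio N - 1) / 2 = h := by omega
    have h2 : (l.ratio N : ℂ) = 2 * h + 1 := by rw [hh]; push_cast; ring
    rw [sub_eq_iff_eq_add] at ih
    rw [ih, ctrCode, emb_add, glue_ge _ _ hN, endWord, code_mkLetter, emb_nsmul, emb_nsmul,
      ← ratio_mul_scale_succ l N, h1, ← corner_eq_emb]
    push_cast
    rw [h2]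
    ring

/-- The lattice position of a corner. -/
noncomputable def crnCode {l : RatioSeq} {n : ℕ} (w : Word l n) (j : Fin 4) : ℤ × ℤ :=
  2 • wcode w + latDir j

theorem coe_ctr' {l : RatioSeq} {n : ℕ} (w : Word l n) :
    (ctr w : ℂ) = scale l n * emb (2 • wcode w) := by
  rw [coe_ctr, emb_nsmul]; push_cast; ring

theorem coe_crn' {l : RatioSeq} {n : ℕ} (w : Word l n) (j : Fin 4) :
    (crn w j : ℂ) = scale l n * emb (crnCode w j) := by
  rw [coe_crn, crnCode, emb_add, emb_nsmul, corner_eq_emb]; push_cast; ring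

theorem scale_mul_emb_injective (l : RatioSeq) (n : ℕ) {v v' : ℤ × ℤ}
    (h : (scale l n : ℂ) * emb v = scale l n * emb v') : v = v' :=
  emb_injective (mul_left_cancel₀ (by exact_mod_cast (scale_pos l n).ne') h)

theorem latDir_injective : Function.Injective latDir := by decide

theorem norm_emb_sq (v : ℤ × ℤ) : ‖emb v‖ ^ 2 = ((v.1 ^ 2 + v.2 ^ 2 : ℤ) : ℝ) := by
  rw [emb, norm_mul, norm_corner, mul_one, ← Complex.normSq_eq_norm_sq]
  simp [Complex.normSq_apply]
  ring

theorem exists_latDir {v : ℤ × ℤ} (h : ‖emb v‖ = 1) : ∃ j, v = latDir j := by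
  have h1 := norm_emb_sq v
  rw [h, one_pow] at h1
  have h2 : v.1 ^ 2 + v.2 ^ 2 = 1 := by exact_mod_cast h1.symm
  obtain ⟨a, b⟩ := v
  simp only at h2
  have ha : a ≤ 1 := by nlinarith [sq_nonneg b]
  have ha' : -1 ≤ a := by nlinarith [sq_nonneg b]
  have hb : b ≤ 1 := by nlinarith [sq_nonneg a]
  have hb' : -1 ≤ b := by nlinarith [sq_nonneg a]
  interval_cases a <;> interval_cases b <;> simp at h2
  · exact ⟨2, rfl⟩
  · exact ⟨3, rfl⟩
  · exact ⟨1, rfl⟩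
  · exact ⟨0, rfl⟩

theorem cellMap_eq {l : RatioSeq} {n : ℕ} (w : Word l n) (z : ℂ) :
    cellMap l n w z = scale l n * (2 * emb (wcode w) + z) := by
  have h := cellMap_apply l (glue w (zeroWord l)) n z
  have h1 : (fun k : Fin n => glue w (zeroWord l) k) = w := pre_glue w _
  rw [h1, sum_eq_emb] at h
  rw [h, wcode]; ring

theorem mem_vertices_iff {l : RatioSeq} {n : ℕ} {x : vicsek l} :
    x ∈ vertices l n ↔ ∃ w : Word l n, x = ctr w ∨ ∃ j, x = crn w j := by
  simp only [vertices, mem_ofPred_eq, mem_iUnion]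
  refine exists_congr fun w => ?_
  simp only [image_insert_eq, mem_insert_iff, cellMap_eq, add_zero, mem_image, mem_range,
    exists_exists_eq_and]
  refine or_congr ?_ (exists_congr fun j => ?_)
  · rw [← coe_ctr, Subtype.ext_iff]
  · rw [← coe_crn, Subtype.ext_iff, eq_comm]

theorem dist_ctr_crn {l : RatioSeq} {n : ℕ} (w : Word l n) (j : Fin 4) :
    dist (ctr w) (crn w j) = scale l n := by
  rw [Subtype.dist_eq, coe_ctr, coe_crn, dist_comm, dist_eq_norm, ← mul_sub, add_sub_cancel_left,
    norm_mul, norm_corner, mul_one, Complex.norm_real, Real.norm_of_nonneg (scale_nonneg l n)]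

theorem ctr_injective {l : RatioSeq} {n : ℕ} : Function.Injective (ctr : Word l n → vicsek l) := by
  intro w w' h
  have h1 := congrArg (Subtype.val) h
  rw [coe_ctr', coe_ctr'] at h1
  have h2 := scale_mul_emb_injective l n h1
  apply wcode_injective
  have a := congrArg Prod.fst h2
  have b := congrArg Prod.snd h2
  simp at a b
  exact Prod.ext a b

theorem crn_right_injective {l : RatioSeq} {n : ℕ} (w : Word l n) : Function.Injective (crn w) := by
  intro j j' h
  have h1 := congrArg (Subtype.val) h
  rw [coe_crn', coe_crn'] at h1
  have h2 := scale_mul_emb_injective l n h1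
  exact latDir_injective (add_left_cancel h2)

/-- In units of the scale, centres have even coordinates, while a corner has an odd one. -/
theorem ctr_ne_crn {l : RatioSeq} {n : ℕ} (w w' : Word l n) (j : Fin 4) : ctr w ≠ crn w' j := by
  intro h
  have h1 := congrArg (Subtype.val) h
  rw [coe_ctr', coe_crn'] at h1
  have h2 := scale_mul_emb_injective l n h1
  have a := congrArg Prod.fst h2
  have b := congrArg Prod.snd h2
  fin_cases j <;> simp [crnCode, latDir] at a b <;> omega

/-- Vertices are lattice points in units of the scale, so adjacent ones differ by a unit vector.
Corners have odd coordinate sum, so two corners are never adjacent. A neighbour of a centre is one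
of the four corners of that cell. -/
theorem exists_eq_crn {l : RatioSeq} {n : ℕ} {x y : vicsek l} (hx : x ∈ vertices l n)
    (hy : y ∈ vertices l n) (h : dist x y = scale l n) :
    ∃ w : Word l n, ∃ j, (x = ctr w ∧ y = crn w j) ∨ (x = crn w j ∧ y = ctr w) := by
  have hs := scale_pos l n
  have key : ∀ {x y : vicsek l} {v v' : ℤ × ℤ}, dist x y = scale l n →
      (x : ℂ) = scale l n * emb v → (y : ℂ) = scale l n * emb v' → ∃ j, v' = v + latDir j := by
    intro x y v v' h hx hy
    rw [Subtype.dist_eq, hx, hy, dist_comm, dist_eq_norm, ← mul_sub, norm_mul, Complex.norm_real,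
      Real.norm_of_nonneg hs.le, ← emb_sub] at h
    obtain ⟨j, hj⟩ := exists_latDir (v := v' - v) (by
      apply mul_left_cancel₀ hs.ne'; rw [h, mul_one])
    exact ⟨j, by rw [← hj]; abel⟩
  have key2 : ∀ {x y : vicsek l} {w : Word l n}, x = ctr w → y ∈ vertices l n →
      dist x y = scale l n → ∃ j, y = crn w j := by
    intro x y w hx hy h
    have : ∃ v', (y : ℂ) = scale l n * emb v' := by
      obtain ⟨w', rfl | ⟨j, rfl⟩⟩ := mem_vertices_iff.1 hy
      · exact ⟨_, coe_ctr' w'⟩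
      · exact ⟨_, coe_crn' w' j⟩
    obtain ⟨v', hv'⟩ := this
    obtain ⟨j, hj⟩ := key h (by rw [hx, coe_ctr']) hv'
    refine ⟨j, Subtype.ext ?_⟩
    rw [hv', coe_crn', hj, crnCode]
  obtain ⟨w, hw | ⟨i, hi⟩⟩ := mem_vertices_iff.1 hx
  · obtain ⟨j, hj⟩ := key2 hw hy h
    exact ⟨w, j, Or.inl ⟨hw, hj⟩⟩
  · obtain ⟨w', hw' | ⟨i', hi'⟩⟩ := mem_vertices_iff.1 hy
    · obtain ⟨j, hj⟩ := key2 hw' hx (by rw [dist_comm, h])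
      exact ⟨w', j, Or.inr ⟨hj, hw'⟩⟩
    · exfalso
      obtain ⟨j, hj⟩ := key h (by rw [hi, coe_crn']) (by rw [hi', coe_crn'])
      have a := congrArg Prod.fst hj
      have b := congrArg Prod.snd hj
      have ho : ∀ i, ((latDir i).1 + (latDir i).2) % 2 = 1 := by decide
      have h1 := ho i
      have h2 := ho i'
      have h3 := ho j
      simp [crnCode] at a b
      omega

noncomputable instance fintypeWord (l : RatioSeq) (n : ℕ) : Fintype (Word l n) := Fintype.ofFinite _

/-- The `p`-th power of the increment of `u` along the edge from the centre of the cell `w` to its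
`j`-th corner. -/
noncomputable def edgeTerm {l : RatioSeq} (p : ℝ) (u : vicsek l → ℝ) {n : ℕ} (w : Word l n)
    (j : Fin 4) : ℝ≥0∞ := ENNReal.ofReal (|u (ctr w) - u (crn w j)| ^ p)

/-- A corner may belong to two cells, but the centre endpoint identifies the cell, so nothing is
counted twice. The factor `2` is for the two orientations. -/
theorem edgeSum_eq (l : RatioSeq) (p : ℝ) (n : ℕ) (u : vicsek l → ℝ) :
    edgeSum l p n u = 2 * ∑ w : Word l n, ∑ j, edgeTerm p u w j := by
  let f : (Word l n × Fin 4) × Bool → edges l n := fun a => match a with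
    | (a, true) => ⟨(ctr a.1, crn a.1 a.2), mem_vertices_iff.2 ⟨a.1, Or.inl rfl⟩,
        mem_vertices_iff.2 ⟨a.1, Or.inr ⟨a.2, rfl⟩⟩, dist_ctr_crn a.1 a.2⟩
    | (a, false) => ⟨(crn a.1 a.2, ctr a.1), mem_vertices_iff.2 ⟨a.1, Or.inr ⟨a.2, rfl⟩⟩,
        mem_vertices_iff.2 ⟨a.1, Or.inl rfl⟩, by rw [dist_comm]; exact dist_ctr_crn a.1 a.2⟩
  have hf : Function.Bijective f := by
    constructor
    · rintro ⟨⟨w, j⟩, b⟩ ⟨⟨w', j'⟩, b'⟩ h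
      have h1 := congrArg (fun e : edges l n => e.1.1) h
      have h2 := congrArg (fun e : edges l n => e.1.2) h
      rcases b <;> rcases b' <;> simp only [f] at h1 h2
      · obtain rfl := ctr_injective h2
        obtain rfl := crn_right_injective w h1
        rfl
      · exact absurd h1.symm (ctr_ne_crn _ _ _)
      · exact absurd h1 (ctr_ne_crn _ _ _)
      · obtain rfl := ctr_injective h1
        obtain rfl := crn_right_injective w h2
        rfl
    · rintro ⟨⟨x, y⟩, hx, hy, h⟩
      obtain ⟨w, j, ⟨rfl, rfl⟩ | ⟨rfl, rfl⟩⟩ := exists_eq_crn hx hy h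
      · exact ⟨((w, j), true), rfl⟩
      · exact ⟨((w, j), false), rfl⟩
  rw [edgeSum, ← (Equiv.ofBijective f hf).tsum_eq, tsum_fintype, Fintype.sum_prod_type,
    Fintype.sum_prod_type, Finset.mul_sum]
  refine Finset.sum_congr rfl fun w _ => ?_
  rw [Finset.mul_sum]
  refine Finset.sum_congr rfl fun j _ => ?_
  rw [Fintype.sum_bool, two_mul]
  simp only [Equiv.ofBijective_apply, f, edgeTerm]
  rw [abs_sub_comm (u (crn w j))]

/-! ### Children of cells -/

/-- The word `w` followed by the letter `a`. -/
def child {l : RatioSeq} {n : ℕ} (w : Word l n) (a : letters (l.ratio n)) : Word l (n + 1) :=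
  Fin.snoc (α := fun k : Fin (n + 1) => letters (l.ratio k)) w a

theorem sum_child {l : RatioSeq} {n : ℕ} (f : Word l (n + 1) → ℝ≥0∞) [Fintype (letters (l.ratio n))] :
    ∑ w, f w = ∑ w : Word l n, ∑ a, f (child w a) := by
  rw [← Fintype.sum_prod_type' (fun (w : Word l n) (a : letters (l.ratio n)) => f (child w a))]
  let e : Word l n × letters (l.ratio n) ≃ Word l (n + 1) :=
    (Equiv.prodComm _ _).trans (Fin.snocEquiv (fun k : Fin (n + 1) => letters (l.ratio k)))
  exact (e.sum_comp f).symm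

theorem pre_child {l : RatioSeq} {n : ℕ} (w : Word l n) (a : letters (l.ratio n)) (τ : InfWord l) :
    pre n (glue (child w a) τ) = w := by
  funext k
  rw [pre, glue_lt _ _ (by omega)]
  exact Fin.snoc_castSucc (α := fun k : Fin (n + 1) => letters (l.ratio k)) a w k

theorem wcode_child {l : RatioSeq} {n : ℕ} (w : Word l n) (a : letters (l.ratio n)) :
    wcode (child w a) = l.ratio n • wcode w + code a := by
  rw [wcode, ctrCode, ctrCode_eq_wcode, pre_child, glue_lt _ _ (Nat.lt_succ_self n)]
  congr 2
  exact Fin.snoc_last (α := fun k : Fin (n + 1) => letters (l.ratio k)) a w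

theorem coe_ctr_child {l : RatioSeq} {n : ℕ} (w : Word l n) (a : letters (l.ratio n)) :
    (ctr (child w a) : ℂ) = ctr w + scale l (n + 1) * (2 * emb (code a)) := by
  rw [coe_ctr, coe_ctr, wcode_child, emb_add, emb_nsmul, ← ratio_mul_scale_succ l n]
  push_cast; ring

theorem coe_crn_eq {l : RatioSeq} {n : ℕ} (w : Word l n) (j : Fin 4) :
    (crn w j : ℂ) = ctr w + scale l n * corner j := by
  rw [coe_ctr, coe_crn]; ring

noncomputable instance fintypeLetters (m : ℕ) : Fintype (letters m) := Fintype.ofFinite _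

/-! ### Subdivision of edges and monotonicity of the discrete energies -/

theorem ofReal_rpow_sub_le_sum {p : ℝ} (hp : 1 ≤ p) (x : ℕ → ℝ) (m : ℕ) :
    ENNReal.ofReal (|x 0 - x m| ^ p) ≤ ENNReal.ofReal ((m : ℝ) ^ (p - 1)) *
      ∑ i ∈ Finset.range m, ENNReal.ofReal (|x i - x (i + 1)| ^ p) := by
  rw [← ENNReal.ofReal_sum_of_nonneg fun _ _ => by positivity,
    ← ENNReal.ofReal_mul (by positivity)]
  apply ENNReal.ofReal_le_ofReal
  have h1 := Real.rpow_sum_le_const_mul_sum_rpow (Finset.range m) (fun i => x i - x (i + 1)) hp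
  rw [Finset.card_range] at h1
  refine le_trans ?_ h1
  apply Real.rpow_le_rpow (abs_nonneg _) _ (by linarith)
  rw [← Finset.sum_range_sub' x m]
  exact Finset.abs_sum_le_sum_abs _ _

/-- The letter at position `k` of the arm in direction `j`. -/
noncomputable def arm (l : RatioSeq) (n k : ℕ) (j : Fin 4) : letters (l.ratio n) :=
  mkLetter _ (min k ((l.ratio n - 1) / 2)) j (by have := ratio_pos l n; omega)

/-- The truncation by `min` in `arm` only makes it total; it is inactive on the actual arm. -/
theorem code_arm {l : RatioSeq} {n k : ℕ} {j : Fin 4} (h : 2 * k + 1 ≤ l.ratio n) :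
    code (arm l n k j) = k • latDir j := by
  rw [arm, code_mkLetter, min_eq_left (by omega)]

/-- The points that subdivide the edge from the centre of a cell to a corner. -/
noncomputable def pathPt {l : RatioSeq} {n : ℕ} (w : Word l n) (j : Fin 4) (i : ℕ) : vicsek l :=
  if Even i then ctr (child w (arm l n (i / 2) j)) else crn (child w (arm l n (i / 2) j)) j

/-- Small cells along an arm touch at corners: their centres are the even points of the path and
their outer corners the odd ones. -/
theorem coe_pathPt {l : RatioSeq} {n : ℕ} (w : Word l n) (j : Fin 4) {i : ℕ} (hi : i ≤ l.ratio n) :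
    (pathPt w j i : ℂ) = ctr w + scale l (n + 1) * (i * corner j) := by
  have ho := l.odd n
  rw [pathPt]
  split_ifs with h
  · have h1 : 2 * (i / 2) + 1 ≤ l.ratio n := by
      obtain ⟨a, rfl⟩ := h; obtain ⟨b, hb⟩ := ho; omega
    rw [coe_ctr_child, code_arm h1, emb_nsmul, corner_eq_emb]
    have h2 : (i : ℂ) = 2 * (i / 2 : ℕ) := by
      obtain ⟨a, rfl⟩ := h
      have : (a + a) / 2 = a := by omega
      rw [this]; push_cast; ring
    rw [h2]; ring
  · have h1 : 2 * (i / 2) + 1 ≤ l.ratio n := by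
      rw [Nat.not_even_iff_odd] at h
      obtain ⟨a, rfl⟩ := h; obtain ⟨b, hb⟩ := ho; omega
    rw [coe_crn_eq, coe_ctr_child, code_arm h1, emb_nsmul, corner_eq_emb]
    have h2 : (i : ℂ) = 2 * (i / 2 : ℕ) + 1 := by
      rw [Nat.not_even_iff_odd] at h
      obtain ⟨a, rfl⟩ := h
      have : (2 * a + 1) / 2 = a := by omega
      rw [this]; push_cast; ring
    rw [h2]; ring

theorem pathPt_zero {l : RatioSeq} {n : ℕ} (w : Word l n) (j : Fin 4) : pathPt w j 0 = ctr w := by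
  apply Subtype.ext
  rw [coe_pathPt w j (Nat.zero_le _)]; simp

theorem pathPt_ratio {l : RatioSeq} {n : ℕ} (w : Word l n) (j : Fin 4) :
    pathPt w j (l.ratio n) = crn w j := by
  apply Subtype.ext
  rw [coe_pathPt w j le_rfl, coe_crn_eq, ← ratio_mul_scale_succ l n]; push_cast; ring

theorem latDir_add_two (j : Fin 4) : latDir (j + 2) = -latDir j := by
  revert j; decide

theorem corner_add_two (j : Fin 4) : corner (j + 2) = -corner j := by
  rw [corner_eq_emb, corner_eq_emb, latDir_add_two]; simp [emb]; ring

/-- The direction, seen from the centre of the small cell, of the `i`-th edge in the subdivision of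
an edge. -/
def stepDir (j : Fin 4) (i : ℕ) : Fin 4 := if Even i then j else j + 2

/-- Every step is an edge of the small cell with index `(i + 1) / 2`. For odd `i` it starts at the
outer corner of the preceding cell, which is the inner corner, in direction `j + 2`, of the next
one. -/
theorem edgeTerm_step {l : RatioSeq} (p : ℝ) (u : vicsek l → ℝ) {n : ℕ} (w : Word l n) (j : Fin 4)
    {i : ℕ} (hi : i < l.ratio n) :
    ENNReal.ofReal (|u (pathPt w j i) - u (pathPt w j (i + 1))| ^ p) =
      edgeTerm p u (child w (arm l n ((i + 1) / 2) j)) (stepDir j i) := by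
  rw [edgeTerm, stepDir]
  by_cases h : Even i
  · have h1 : ¬ Even (i + 1) := by simpa [Nat.even_add_one] using h
    have h2 : (i + 1) / 2 = i / 2 := by obtain ⟨a, rfl⟩ := h; omega
    rw [if_pos h, pathPt, pathPt, if_pos h, if_neg h1, h2]
  · have h1 : Even (i + 1) := Nat.even_add_one.2 h
    have h3 : pathPt w j (i + 1) = ctr (child w (arm l n ((i + 1) / 2) j)) := by
      rw [pathPt, if_pos h1]
    have h4 : pathPt w j i = crn (child w (arm l n ((i + 1) / 2) j)) (j + 2) := by
      apply Subtype.ext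
      rw [coe_crn_eq, ← h3, coe_pathPt w j hi.le, coe_pathPt w j hi, corner_add_two]
      push_cast; ring
    rw [if_neg h, h3, h4, abs_sub_comm]

/-- The energy of `u` on the edges inside the cell `w` of one level further. -/
noncomputable def childSum {l : RatioSeq} (p : ℝ) (u : vicsek l → ℝ) {n : ℕ} (w : Word l n) : ℝ≥0∞ :=
  ∑ a, ∑ j, edgeTerm p u (child w a) j

/-- The steps on the four arms are pairwise different edges. Away from the central cell the arm
letter determines the direction. In the central cell, shared by all arms, each arm uses only the
edge in its own direction. -/
theorem sum_steps_le {l : RatioSeq} (p : ℝ) (u : vicsek l → ℝ) {n : ℕ} (w : Word l n) :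
    ∑ j, ∑ i ∈ Finset.range (l.ratio n), ENNReal.ofReal
      (|u (pathPt w j i) - u (pathPt w j (i + 1))| ^ p) ≤ childSum p u w := by
  let g : letters (l.ratio n) × Fin 4 → ℝ≥0∞ := fun x => edgeTerm p u (child w x.1) x.2
  let f : Fin 4 × Fin (l.ratio n) → letters (l.ratio n) × Fin 4 := fun x =>
    (arm l n ((x.2 + 1) / 2) x.1, stepDir x.1 x.2)
  have hf : Function.Injective f := by
    have ho := l.odd n
    rintro ⟨j, i, hi⟩ ⟨j', i', hi'⟩ h
    simp only [f, Prod.mk.injEq] at h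
    obtain ⟨h1, h2⟩ := h
    have h3 := congrArg code h1
    rw [code_arm (by obtain ⟨b, hb⟩ := ho; omega), code_arm (by obtain ⟨b, hb⟩ := ho; omega)] at h3
    have : i = i' ∧ j = j' := by
      rcases Nat.even_or_odd' i with ⟨a, rfl | rfl⟩ <;>
      rcases Nat.even_or_odd' i' with ⟨a', rfl | rfl⟩ <;>
      · simp [stepDir] at h2
        have e1 : (2 * a + 1) / 2 = a := by omega
        have e2 : (2 * a' + 1) / 2 = a' := by omega
        have e3 : (2 * a + 1 + 1) / 2 = a + 1 := by omega
        have e4 : (2 * a' + 1 + 1) / 2 = a' + 1 := by omega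
        simp only [e1, e2, e3, e4] at h3
        have g1 := congrArg Prod.fst h3
        have g2 := congrArg Prod.snd h3
        fin_cases j <;> fin_cases j' <;> simp [latDir, Fin.ext_iff] at h2 g1 g2 ⊢ <;> omega
    simp [this.1, this.2]
  have h1 : ∑ j, ∑ i ∈ Finset.range (l.ratio n), ENNReal.ofReal
      (|u (pathPt w j i) - u (pathPt w j (i + 1))| ^ p) = ∑ x, g (f x) := by
    rw [Fintype.sum_prod_type]
    refine Finset.sum_congr rfl fun j _ => ?_
    rw [Finset.sum_range]
    exact Finset.sum_congr rfl fun i _ => edgeTerm_step p u w j i.2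
  have h2 : childSum p u w = ∑ x, g x := by
    rw [childSum, Fintype.sum_prod_type]
  rw [h1, h2, ← tsum_fintype (L := .unconditional _), ← tsum_fintype (L := .unconditional _)]
  exact ENNReal.tsum_comp_le_tsum_of_injective hf g

theorem sum_edgeTerm_le_childSum {l : RatioSeq} {p : ℝ} (hp : 1 ≤ p) (u : vicsek l → ℝ) {n : ℕ}
    (w : Word l n) :
    ∑ j, edgeTerm p u w j ≤ ENNReal.ofReal ((l.ratio n : ℝ) ^ (p - 1)) * childSum p u w := by
  refine le_trans ?_ (mul_le_mul_right (sum_steps_le p u w) _)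
  rw [Finset.mul_sum]
  refine Finset.sum_le_sum fun j _ => ?_
  have := ofReal_rpow_sub_le_sum hp (fun i => u (pathPt w j i)) (l.ratio n)
  rwa [pathPt_zero, pathPt_ratio] at this

/-- All letters lie on arms, so the centre of a child is reached from the centre of the parent by an
initial piece of one of the four paths. -/
theorem ctr_child_le {l : RatioSeq} {p : ℝ} (hp : 1 ≤ p) (u : vicsek l → ℝ) {n : ℕ}
    (w : Word l n) (a : letters (l.ratio n)) :
    ENNReal.ofReal (|u (ctr w) - u (ctr (child w a))| ^ p) ≤
      ENNReal.ofReal ((l.ratio n : ℝ) ^ (p - 1)) * childSum p u w := by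
  obtain ⟨k, j, hk, rfl⟩ := exists_mkLetter a
  have h1 := ofReal_rpow_sub_le_sum hp (fun i => u (pathPt w j i)) (2 * k)
  have h2 : pathPt w j (2 * k) = ctr (child w (mkLetter _ k j hk)) := by
    apply Subtype.ext
    rw [coe_pathPt w j (by omega), coe_ctr_child, code_mkLetter, emb_nsmul, corner_eq_emb]
    push_cast; ring
  rw [pathPt_zero, h2] at h1
  refine h1.trans (mul_le_mul' (ENNReal.ofReal_le_ofReal ?_) ?_)
  · exact Real.rpow_le_rpow (by positivity) (by exact_mod_cast (by omega : 2 * k ≤ l.ratio n))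
      (by linarith)
  · refine le_trans ?_ (sum_steps_le p u w)
    refine le_trans ?_ (Finset.single_le_sum (fun j _ => zero_le) (Finset.mem_univ j))
    exact Finset.sum_le_sum_of_subset (Finset.range_mono (by omega))

theorem sum_childSum {l : RatioSeq} (p : ℝ) (u : vicsek l → ℝ) (n : ℕ) :
    2 * ∑ w : Word l n, childSum p u w = edgeSum l p (n + 1) u := by
  rw [edgeSum_eq, sum_child]; rfl

theorem edgeSum_le_succ {l : RatioSeq} {p : ℝ} (hp : 1 ≤ p) (u : vicsek l → ℝ) (n : ℕ) :
    edgeSum l p n u ≤ ENNReal.ofReal ((l.ratio n : ℝ) ^ (p - 1)) * edgeSum l p (n + 1) u := by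
  rw [← sum_childSum, edgeSum_eq, mul_left_comm, Finset.mul_sum (a := ENNReal.ofReal _)]
  gcongr with w
  exact sum_edgeTerm_le_childSum hp u w

/-- The Hölder loss `(l.ratio n) ^ (p - 1)` of one subdivision is exactly the quotient of
consecutive normalising factors. -/
theorem energyAt_mono {l : RatioSeq} {p : ℝ} (hp : 1 ≤ p) (u : vicsek l → ℝ) :
    Monotone fun n => energyAt l p n u := by
  refine monotone_nat_of_le_succ fun n => ?_
  rw [energyAt, energyAt, Finset.prod_range_succ, ← mul_assoc (1 / 2 : ℝ),
    ENNReal.ofReal_mul (p := 1 / 2 * ∏ k ∈ Finset.range n, (l.ratio k : ℝ) ^ (p - 1)) (by positivity),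
    mul_assoc (ENNReal.ofReal _)]
  gcongr
  exact edgeSum_le_succ hp u n

theorem crn_eq_crn {l : RatioSeq} {n : ℕ} {w w' : Word l n} {j : Fin 4}
    (h : wcode w' = wcode w + latDir j) : crn w j = crn w' (j + 2) := by
  apply Subtype.ext
  rw [coe_crn, coe_crn, h, emb_add, corner_add_two, corner_eq_emb]; ring

theorem ofReal_rpow_sub_le {p : ℝ} (hp : 1 ≤ p) (a b c : ℝ) :
    ENNReal.ofReal (|a - c| ^ p) ≤ ENNReal.ofReal ((2 : ℝ) ^ (p - 1)) *
      (ENNReal.ofReal (|a - b| ^ p) + ENNReal.ofReal (|b - c| ^ p)) := by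
  have := ofReal_rpow_sub_le_sum hp (fun i : ℕ => if i = 0 then a else if i = 1 then b else c) 2
  simpa [Finset.sum_range_succ] using this

theorem ctr_adjacent_le {l : RatioSeq} {p : ℝ} (hp : 1 ≤ p) (u : vicsek l → ℝ) {n : ℕ}
    {w w' : Word l n} {j : Fin 4} (h : wcode w' = wcode w + latDir j) :
    ENNReal.ofReal (|u (ctr w) - u (ctr w')| ^ p) ≤
      ENNReal.ofReal ((2 : ℝ) ^ (p - 1)) * (edgeTerm p u w j + edgeTerm p u w' (j + 2)) := by
  refine (ofReal_rpow_sub_le hp _ (u (crn w j)) _).trans_eq ?_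
  rw [edgeTerm, edgeTerm, ← crn_eq_crn h, abs_sub_comm (u (crn w j))]

/-- The number of words of length `n`. -/
def numWords (l : RatioSeq) (n : ℕ) : ℕ := ∏ k ∈ Finset.range n, (2 * l.ratio k - 1)

theorem numWords_pos (l : RatioSeq) (n : ℕ) : 0 < numWords l n :=
  Finset.prod_pos fun k _ => by have := ratio_pos l k; omega

theorem numWords_succ (l : RatioSeq) (n : ℕ) :
    numWords l (n + 1) = numWords l n * (2 * l.ratio n - 1) := Finset.prod_range_succ _ _

theorem card_letter (l : RatioSeq) (n : ℕ) :
    Fintype.card (letters (l.ratio n)) = 2 * l.ratio n - 1 := by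
  rw [← Nat.card_eq_fintype_card, card_letters (l.odd n)]

theorem sum_ctr_child_le {l : RatioSeq} {p : ℝ} (hp : 1 ≤ p) (u : vicsek l → ℝ) (n : ℕ) :
    ∑ w : Word l n, ∑ a, ENNReal.ofReal (|u (ctr w) - u (ctr (child w a))| ^ p) ≤
      (2 * l.ratio n - 1 : ℕ) * (ENNReal.ofReal ((l.ratio n : ℝ) ^ (p - 1)) *
        edgeSum l p (n + 1) u) := by
  calc _ ≤ ∑ w : Word l n, ∑ _a : letters (l.ratio n),
        ENNReal.ofReal ((l.ratio n : ℝ) ^ (p - 1)) * childSum p u w :=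
        Finset.sum_le_sum fun w _ => Finset.sum_le_sum fun a _ => ctr_child_le hp u w a
    _ = (2 * l.ratio n - 1 : ℕ) * (ENNReal.ofReal ((l.ratio n : ℝ) ^ (p - 1)) *
        ∑ w : Word l n, childSum p u w) := by
      simp only [Finset.sum_const, Finset.card_univ, card_letter, nsmul_eq_mul]
      rw [Finset.mul_sum, Finset.mul_sum]
    _ ≤ _ := by
      gcongr
      rw [← sum_childSum, two_mul]
      exact le_self_add

/-! ### Integration over infinite words -/

/-- The infinite product of the uniform distributions. -/
noncomputable def wordMeasure (l : RatioSeq) : Measure (InfWord l) :=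
  Measure.infinitePi fun k : ℕ => ProbabilityTheory.uniformOn (univ : Set (letters (l.ratio k)))

instance (l : RatioSeq) : IsProbabilityMeasure (wordMeasure l) := by
  unfold wordMeasure; infer_instance

theorem mu_eq (l : RatioSeq) : mu l = (wordMeasure l).map (coding l) := rfl

/-- The infinite words that start with `w`. -/
def cyl {l : RatioSeq} {n : ℕ} (w : Word l n) : Set (InfWord l) := {ω | pre n ω = w}

theorem measurable_pre {l : RatioSeq} (n : ℕ) : Measurable (pre n : InfWord l → Word l n) :=
  measurable_pi_lambda _ fun k => measurable_pi_apply (k : ℕ)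

theorem measurableSet_cyl {l : RatioSeq} {n : ℕ} (w : Word l n) : MeasurableSet (cyl w) :=
  measurable_pre n (measurableSet_singleton w)

theorem measure_cyl {l : RatioSeq} {n : ℕ} (w : Word l n) :
    wordMeasure l (cyl w) = (numWords l n : ℝ≥0∞)⁻¹ := by
  have h : cyl w = (Finset.range n : Set ℕ).pi fun k => {glue w (zeroWord l) k} := by
    ext ω
    simp only [cyl, mem_ofPred_eq, Set.mem_pi, Finset.coe_range, mem_Iio, mem_singleton_iff]
    rw [← pre_eq_iff, pre_glue]
  rw [h, wordMeasure, Measure.infinitePi_pi _ fun _ _ => measurableSet_singleton _, numWords,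
    Nat.cast_prod, ENNReal.prod_inv_distrib]
  · refine Finset.prod_congr rfl fun k _ => ?_
    rw [ProbabilityTheory.uniformOn_univ, Measure.count_singleton, card_letter, one_div]
  · intro i _ j _ _
    exact Or.inr (ENNReal.natCast_ne_top _)

theorem lintegral_eq_sum_cyl {l : RatioSeq} (n : ℕ) (G : InfWord l → ℝ≥0∞) :
    ∫⁻ ω, G ω ∂wordMeasure l = ∑ w : Word l n, ∫⁻ ω in cyl w, G ω ∂wordMeasure l := by
  rw [← setLIntegral_univ, ← tsum_fintype (L := .unconditional _),
    ← lintegral_iUnion (fun w => measurableSet_cyl w)]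
  · congr 2
    ext ω; simp [cyl]
  · intro w w' h
    exact Set.disjoint_left.2 fun ω h1 h2 => h (h1.symm.trans h2)

theorem lintegral_pre {l : RatioSeq} (n : ℕ) (F : Word l n → ℝ≥0∞) :
    ∫⁻ ω, F (pre n ω) ∂wordMeasure l = (numWords l n : ℝ≥0∞)⁻¹ * ∑ w, F w := by
  rw [lintegral_eq_sum_cyl n, Finset.mul_sum]
  refine Finset.sum_congr rfl fun w _ => ?_
  rw [← measure_cyl w, mul_comm, ← setLIntegral_const]
  exact setLIntegral_congr_fun (measurableSet_cyl w) fun ω h => by rw [show pre n ω = w from h]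

theorem numWords_ne_zero (l : RatioSeq) (n : ℕ) : (numWords l n : ℝ≥0∞) ≠ 0 := by
  exact_mod_cast (numWords_pos l n).ne'

theorem dist_coding_le_of_pre {l : RatioSeq} {ω ω' : InfWord l} {n : ℕ} (h : pre n ω = pre n ω') :
    dist (coding l ω) (coding l ω') ≤ 2 * scale l n := dist_coding_le (pre_eq_iff.1 h)

/-! ### General inequalities -/

theorem ofReal_abs_rpow {p : ℝ} (hp : 0 ≤ p) (x : ℝ) : ENNReal.ofReal (|x| ^ p) = ‖x‖ₑ ^ p := by
  rw [Real.enorm_eq_ofReal_abs, ENNReal.ofReal_rpow_of_nonneg (abs_nonneg x) hp]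

/-- Hölder against the constant `1`. The total mass is kept because the inequality is also applied
to geometric weights on `ℕ`. -/
theorem rpow_lintegral_le {α : Type*} [MeasurableSpace α] {ν : Measure α} {p : ℝ} (hp : 1 < p)
    {f : α → ℝ≥0∞} (hf : AEMeasurable f ν) :
    (∫⁻ x, f x ∂ν) ^ p ≤ ν univ ^ (p - 1) * ∫⁻ x, f x ^ p ∂ν := by
  have hpq : p.HolderConjugate (p / (p - 1)) := Real.HolderConjugate.conjExponent hp
  have h := ENNReal.lintegral_mul_le_Lp_mul_Lq ν hpq hf (aemeasurable_const (b := (1 : ℝ≥0∞)))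
  simp only [Pi.mul_apply, mul_one, ENNReal.one_rpow, lintegral_const, one_mul] at h
  calc (∫⁻ x, f x ∂ν) ^ p ≤ ((∫⁻ x, f x ^ p ∂ν) ^ (1 / p) * ν univ ^ (1 / (p / (p - 1)))) ^ p :=
        ENNReal.rpow_le_rpow h (by linarith)
    _ = ν univ ^ (p - 1) * ∫⁻ x, f x ^ p ∂ν := by
        have h0 : p ≠ 0 := by linarith
        have h1 : p - 1 ≠ 0 := by linarith
        rw [ENNReal.mul_rpow_of_nonneg _ _ (by linarith), ← ENNReal.rpow_mul, ← ENNReal.rpow_mul,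
          one_div_mul_cancel h0, ENNReal.rpow_one, mul_comm]
        congr 2
        field_simp

/-- Minkowski's inequality for the telescoping sum, followed by Fatou's lemma. Both telescoping
arguments use it: with counting measure on edges, and with the measure on words. -/
theorem lintegral_rpow_sub_lim_le {α : Type*} [MeasurableSpace α] {ν : Measure α} {p : ℝ}
    (hp : 1 ≤ p) {f : ℕ → α → ℝ} {g : α → ℝ} (hf : ∀ k, AEStronglyMeasurable (f k) ν)
    (h : ∀ x, Tendsto (fun k => f k x) atTop (𝓝 (g x))) :
    (∫⁻ x, ENNReal.ofReal (|f 0 x - g x| ^ p) ∂ν) ^ (1 / p) ≤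
      ∑' k, (∫⁻ x, ENNReal.ofReal (|f k x - f (k + 1) x| ^ p) ∂ν) ^ (1 / p) := by
  have hp0 : 0 < p := by linarith
  have hq : ENNReal.ofReal p ≠ 0 := by simpa using hp0
  have hq1 : 1 ≤ ENNReal.ofReal p := by simpa using hp
  have key : ∀ F : α → ℝ, (∫⁻ x, ENNReal.ofReal (|F x| ^ p) ∂ν) ^ (1 / p) =
      eLpNorm F (ENNReal.ofReal p) ν := by
    intro F
    rw [eLpNorm_eq_lintegral_rpow_enorm_toReal hq ENNReal.ofReal_ne_top,
      ENNReal.toReal_ofReal hp0.le]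
    simp only [ofReal_abs_rpow hp0.le]
  rw [key (fun x => f 0 x - g x)]
  simp only [fun k => key (fun x => f k x - f (k + 1) x)]
  have h1 : ∀ N, eLpNorm (fun x => f 0 x - f N x) (ENNReal.ofReal p) ν ≤
      ∑' k, eLpNorm (fun x => f k x - f (k + 1) x) (ENNReal.ofReal p) ν := by
    intro N
    have e : (fun x => f 0 x - f N x) =
        ∑ k ∈ Finset.range N, fun x => f k x - f (k + 1) x := by
      funext x
      rw [Finset.sum_apply, Finset.sum_range_sub' (fun k => f k x)]
    rw [e]
    exact (eLpNorm_sum_le (fun k _ => (hf k).sub (hf (k + 1))) hq1).trans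
      (ENNReal.sum_le_tsum _)
  refine (Lp.eLpNorm_lim_le_liminf_eLpNorm (f := fun N x => f 0 x - f N x)
    (fun N => (hf 0).sub (hf N)) _ ?_).trans ?_
  · exact Eventually.of_forall fun x => tendsto_const_nhds.sub (h x)
  · exact liminf_le_of_le (by isBoundedDefault) fun b hb => by
      obtain ⟨N, hN⟩ := hb.exists
      exact hN.trans (h1 N)

theorem ofReal_rpow_sub_integral_le {α : Type*} [MeasurableSpace α] {ν : Measure α}
    [IsProbabilityMeasure ν] {p : ℝ} (hp : 1 < p) {U : α → ℝ} (hU : Measurable U)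
    (hi : Integrable U ν) (a : ℝ) :
    ENNReal.ofReal (|a - ∫ y, U y ∂ν| ^ p) ≤ ∫⁻ y, ENNReal.ofReal (|a - U y| ^ p) ∂ν := by
  simp only [ofReal_abs_rpow (by linarith : 0 ≤ p)]
  have h1 : a - ∫ y, U y ∂ν = ∫ y, (a - U y) ∂ν := by
    rw [integral_sub (integrable_const a) hi]; simp
  rw [h1]
  refine (ENNReal.rpow_le_rpow (enorm_integral_le_lintegral_enorm _) (by linarith)).trans ?_
  refine (rpow_lintegral_le hp (by fun_prop)).trans ?_
  simp

theorem ofReal_rpow_integral_sub_integral_le {α : Type*} [MeasurableSpace α] {ν ν' : Measure α}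
    [IsProbabilityMeasure ν] [IsProbabilityMeasure ν'] {p : ℝ} (hp : 1 < p) {U : α → ℝ}
    (hU : Measurable U) (hi : Integrable U ν) (hi' : Integrable U ν') :
    ENNReal.ofReal (|∫ y, U y ∂ν - ∫ y, U y ∂ν'| ^ p) ≤
      ∫⁻ x, ∫⁻ y, ENNReal.ofReal (|U x - U y| ^ p) ∂ν' ∂ν := by
  rw [abs_sub_comm]
  refine (ofReal_rpow_sub_integral_le hp hU hi _).trans (lintegral_mono fun x => ?_)
  rw [abs_sub_comm]
  exact ofReal_rpow_sub_integral_le hp hU hi' _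

/-- Hardy's inequality for geometric weights. -/
theorem tsum_rpow_geometric_le {p : ℝ} (hp : 1 < p) {θ : ℝ≥0∞} (hθ : θ < 1) (x : ℕ → ℝ≥0∞) :
    ∑' n, (∑' k, θ ^ k * x (n + k)) ^ p ≤ ((1 - θ)⁻¹) ^ p * ∑' n, x n ^ p := by
  set S := (1 - θ)⁻¹ with hS
  have hpos : 1 - θ ≠ 0 := (tsub_pos_of_lt hθ).ne'
  have hS0 : S ≠ 0 := by simp [hS]
  have hSt : S ≠ ∞ := by simpa [hS] using hpos
  have h1 : ∀ n, (∑' k, θ ^ k * x (n + k)) ^ p ≤ S ^ (p - 1) * ∑' k, θ ^ k * x (n + k) ^ p := by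
    intro n
    -- Hölder with respect to the measure of mass `θ ^ k` at `k`, whose total mass is `S`;
    -- interchanging the two sums then costs one more factor `S`.
    let ν : Measure ℕ := Measure.count.withDensity fun k => θ ^ k
    have hν : ∀ f : ℕ → ℝ≥0∞, ∫⁻ k, f k ∂ν = ∑' k, θ ^ k * f k := by
      intro f
      rw [lintegral_withDensity_eq_lintegral_mul _ (measurable_of_countable _)
        (measurable_of_countable _), lintegral_count]
      rfl
    have h2 := rpow_lintegral_le (ν := ν) hp (f := fun k => x (n + k))
      (measurable_of_countable _).aemeasurable
    have h3 : ν univ = S := by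
      rw [← setLIntegral_one, setLIntegral_univ, hν]
      simp [ENNReal.tsum_geometric, hS]
    rwa [hν, hν, h3] at h2
  calc ∑' n, (∑' k, θ ^ k * x (n + k)) ^ p ≤ ∑' n, S ^ (p - 1) * ∑' k, θ ^ k * x (n + k) ^ p :=
        ENNReal.tsum_le_tsum h1
    _ = S ^ (p - 1) * ∑' k, θ ^ k * ∑' n, x (n + k) ^ p := by
        rw [ENNReal.tsum_mul_left, ENNReal.tsum_comm]
        simp only [ENNReal.tsum_mul_left]
    _ ≤ S ^ (p - 1) * ∑' k, θ ^ k * ∑' n, x n ^ p := by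
        refine mul_le_mul_right (ENNReal.tsum_le_tsum fun k => mul_le_mul_right ?_ _) _
        exact ENNReal.tsum_comp_le_tsum_of_injective (add_left_injective k) fun n => x n ^ p
    _ = S ^ p * ∑' n, x n ^ p := by
        rw [ENNReal.tsum_mul_right, ENNReal.tsum_geometric, ← mul_assoc, ← hS]
        congr 1
        conv_lhs => rw [← ENNReal.rpow_one S, ← ENNReal.rpow_mul, one_mul]
        rw [← ENNReal.rpow_add _ _ hS0 hSt]
        congr 1; ring

/-! ### Double integrals -/

/-- `∬_{d(x,y) < r} |u(x) - u(y)|^p dμ dμ`. -/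
noncomputable def doubleInt (l : RatioSeq) (p : ℝ) (u : vicsek l → ℝ) (r : ℝ) : ℝ≥0∞ :=
  ∫⁻ x, ∫⁻ y in Metric.ball x r, ENNReal.ofReal (|u x - u y| ^ p) ∂mu l ∂mu l

theorem doubleInt_mono (l : RatioSeq) (p : ℝ) (u : vicsek l → ℝ) : Monotone (doubleInt l p u) :=
  fun _ _ h => lintegral_mono fun _ => lintegral_mono_set (Metric.ball_subset_ball h)

theorem measurable_coding (l : RatioSeq) : Measurable (coding l) := (continuous_coding l).measurable

theorem measurable_integrand {l : RatioSeq} (p : ℝ) {u : vicsek l → ℝ} (hu : Measurable u) :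
    Measurable fun z : vicsek l × vicsek l => ENNReal.ofReal (|u z.1 - u z.2| ^ p) := by
  fun_prop

theorem doubleInt_eq {l : RatioSeq} (p : ℝ) {u : vicsek l → ℝ} (hu : Measurable u) (r : ℝ) :
    doubleInt l p u r = ∫⁻ ω, ∫⁻ ω', {ω' | dist (coding l ω') (coding l ω) < r}.indicator
      (fun ω' => ENNReal.ofReal (|u (coding l ω) - u (coding l ω')| ^ p)) ω'
        ∂wordMeasure l ∂wordMeasure l := by
  have h1 : ∀ x, ∫⁻ y in Metric.ball x r, ENNReal.ofReal (|u x - u y| ^ p) ∂mu l =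
      ∫⁻ y, {z : vicsek l × vicsek l | dist z.2 z.1 < r}.indicator
        (fun z => ENNReal.ofReal (|u z.1 - u z.2| ^ p)) (x, y) ∂mu l := by
    intro x
    rw [← lintegral_indicator measurableSet_ball]
    rfl
  have hm : Measurable ({z : vicsek l × vicsek l | dist z.2 z.1 < r}.indicator
      fun z => ENNReal.ofReal (|u z.1 - u z.2| ^ p)) := by
    refine (measurable_integrand p hu).indicator ?_
    exact (isOpen_lt (by fun_prop) continuous_const).measurableSet
  simp only [doubleInt, h1]
  rw [mu_eq, lintegral_map (hm.lintegral_prod_right') (measurable_coding l)]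
  refine lintegral_congr fun ω => ?_
  refine (lintegral_map (hm.comp measurable_prodMk_left) (measurable_coding l)).trans ?_
  rfl

/-- `∬ |u(x) - u(y)|^p` over a product of two cells. -/
noncomputable def cellInt {l : RatioSeq} (p : ℝ) (u : vicsek l → ℝ) {n m : ℕ} (w : Word l n)
    (w' : Word l m) : ℝ≥0∞ :=
  ∫⁻ ω in cyl w, ∫⁻ ω' in cyl w', ENNReal.ofReal (|u (coding l ω) - u (coding l ω')| ^ p)
    ∂wordMeasure l ∂wordMeasure l

theorem cellInt_mono {l : RatioSeq} (p : ℝ) (u : vicsek l → ℝ) {n m n' m' : ℕ} {w : Word l n}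
    {w' : Word l m} {v : Word l n'} {v' : Word l m'} (h : cyl w ⊆ cyl v) (h' : cyl w' ⊆ cyl v') :
    cellInt p u w w' ≤ cellInt p u v v' :=
  (lintegral_mono_set h).trans (lintegral_mono fun _ => lintegral_mono_set h')

theorem measurable_inner {l : RatioSeq} (p : ℝ) {u : vicsek l → ℝ} (hu : Measurable u)
    (ν : Measure (InfWord l)) [SFinite ν] :
    Measurable fun ω : InfWord l => ∫⁻ ω', ENNReal.ofReal
      (|u (coding l ω) - u (coding l ω')| ^ p) ∂ν := by
  have hc := hu.comp (measurable_coding l)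
  have hm : ∀ U : InfWord l → ℝ, Measurable U → Measurable fun z : InfWord l × InfWord l =>
      ENNReal.ofReal (|U z.1 - U z.2| ^ p) := by
    intro U hU
    fun_prop
  exact (hm _ hc).lintegral_prod_right'

/-- Products of different pairs of cylinders are disjoint, so any family of pairs of cells whose
points are closer than `r` may be summed. The relation `R` leaves the choice of the family open. -/
theorem sum_cellInt_le {l : RatioSeq} (p : ℝ) {u : vicsek l → ℝ} (hu : Measurable u) {n : ℕ} {r : ℝ}
    (R : Word l n → Word l n → Prop) [∀ a b, Decidable (R a b)]
    (hR : ∀ ω ω', R (pre n ω) (pre n ω') → dist (coding l ω') (coding l ω) < r) :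
    ∑ a, ∑ b, (if R a b then cellInt p u a b else 0) ≤ doubleInt l p u r := by
  rw [doubleInt_eq p hu, lintegral_eq_sum_cyl n]
  refine Finset.sum_le_sum fun a _ => ?_
  let G : Word l n → InfWord l → ℝ≥0∞ := fun b ω => if R a b then
      ∫⁻ ω' in cyl b, ENNReal.ofReal (|u (coding l ω) - u (coding l ω')| ^ p)
        ∂wordMeasure l else 0
  have hG : ∀ b, Measurable (G b) := by
    intro b
    by_cases hab : R a b
    · simp only [G, if_pos hab]
      exact measurable_inner p hu _
    · simp only [G, if_neg hab]
      exact measurable_const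
  have h1 : ∀ b, (if R a b then cellInt p u a b else 0) = ∫⁻ ω in cyl a, G b ω ∂wordMeasure l := by
    intro b
    by_cases hab : R a b
    · simp only [G, if_pos hab]
      rfl
    · simp only [G, if_neg hab, lintegral_zero]
  rw [Finset.sum_congr rfl fun b _ => h1 b, ← lintegral_finsetSum _ fun b _ => hG b]
  refine setLIntegral_mono' (measurableSet_cyl a) fun ω hω => ?_
  rw [lintegral_eq_sum_cyl n]
  refine Finset.sum_le_sum fun b _ => ?_
  by_cases hab : R a b
  · simp only [G, if_pos hab]
    refine setLIntegral_mono' (measurableSet_cyl b) fun ω' hω' => ?_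
    have h2 : pre n ω = a := hω
    have h3 : pre n ω' = b := hω'
    have h4 : dist (coding l ω') (coding l ω) < r := hR ω ω' (by rw [h2, h3]; exact hab)
    have h5 : ω' ∈ {ω' | dist (coding l ω') (coding l ω) < r} := h4
    exact (indicator_of_mem h5
      (fun ω' => ENNReal.ofReal (|u (coding l ω) - u (coding l ω')| ^ p))).ge
  · simp only [G, if_neg hab]
    exact bot_le

theorem scale_anti (l : RatioSeq) : Antitone (scale l) := by
  refine antitone_nat_of_succ_le fun n => ?_
  rw [← ratio_mul_scale_succ l n]
  have h1 : (1 : ℝ) ≤ l.ratio n := by exact_mod_cast ratio_pos l n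
  nlinarith [scale_pos l (n + 1)]

theorem three_mul_scale_le (l : RatioSeq) (n : ℕ) : 3 * scale l (n + 1) ≤ scale l n := by
  rw [← ratio_mul_scale_succ l n]
  have h1 : (3 : ℝ) ≤ l.ratio n := by exact_mod_cast l.three_le n
  nlinarith [scale_pos l (n + 1)]

/-- The level drops by one because the open ball of radius `rho l n` about a point need not contain
its cell of level `n`, whereas cells of level `n + 1` have diameter less than `rho l n`. -/
theorem sum_cellInt_self_le {l : RatioSeq} (p : ℝ) {u : vicsek l → ℝ} (hu : Measurable u) (n : ℕ) :
    ∑ a : Word l (n + 1), cellInt p u a a ≤ doubleInt l p u (rho l n) := by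
  classical
  refine le_trans ?_ (sum_cellInt_le p hu (n := n + 1) (fun a b => a = b) ?_)
  · refine Finset.sum_le_sum fun a _ => ?_
    rw [Finset.sum_ite_eq]; simp
  · intro ω ω' h
    have h1 := dist_coding_le_of_pre h.symm
    have h2 := three_mul_scale_le l n
    have h3 := scale_pos l (n + 1)
    rw [rho]; linarith

/-! ### Averages over cells -/

/-- The uniform probability measure on the infinite words that start with `w`. -/
noncomputable def cylMeasure {l : RatioSeq} {n : ℕ} (w : Word l n) : Measure (InfWord l) :=
  (numWords l n : ℝ≥0∞) • (wordMeasure l).restrict (cyl w)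

instance {l : RatioSeq} {n : ℕ} (w : Word l n) : IsProbabilityMeasure (cylMeasure w) := by
  constructor
  rw [cylMeasure, Measure.smul_apply, Measure.restrict_apply_univ, measure_cyl, smul_eq_mul,
    ENNReal.mul_inv_cancel (numWords_ne_zero l n) (ENNReal.natCast_ne_top _)]

/-- The average of `u` over a cell. -/
noncomputable def avg {l : RatioSeq} (u : vicsek l → ℝ) {n : ℕ} (w : Word l n) : ℝ :=
  ∫ ω, u (coding l ω) ∂cylMeasure w

theorem integrable_cyl {l : RatioSeq} {u : vicsek l → ℝ} (hu : Measurable u)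
    (hi : Integrable u (mu l)) {n : ℕ} (w : Word l n) :
    Integrable (fun ω => u (coding l ω)) (cylMeasure w) := by
  rw [mu_eq, integrable_map_measure hu.aestronglyMeasurable
    (measurable_coding l).aemeasurable] at hi
  exact (hi.restrict).smul_measure (ENNReal.natCast_ne_top _)

theorem avg_sub_avg_le {l : RatioSeq} {p : ℝ} (hp : 1 < p) {u : vicsek l → ℝ} (hu : Measurable u)
    (hi : Integrable u (mu l)) {n m : ℕ} (w : Word l n) (w' : Word l m) :
    ENNReal.ofReal (|avg u w - avg u w'| ^ p) ≤
      numWords l n * numWords l m * cellInt p u w w' := by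
  refine (ofReal_rpow_integral_sub_integral_le hp (hu.comp (measurable_coding l))
    (integrable_cyl hu hi w) (integrable_cyl hu hi w')).trans_eq ?_
  simp only [cylMeasure, lintegral_smul_measure, smul_eq_mul, cellInt, Function.comp_apply]
  rw [lintegral_const_mul' _ _ (ENNReal.natCast_ne_top _), mul_assoc]

theorem sub_avg_le {l : RatioSeq} {p : ℝ} (hp : 1 < p) {u : vicsek l → ℝ} (hu : Measurable u)
    (hi : Integrable u (mu l)) {n : ℕ} (w : Word l n) (a : ℝ) :
    ENNReal.ofReal (|a - avg u w| ^ p) ≤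
      numWords l n * ∫⁻ ω in cyl w, ENNReal.ofReal (|a - u (coding l ω)| ^ p) ∂wordMeasure l := by
  refine (ofReal_rpow_sub_integral_le hp (hu.comp (measurable_coding l))
    (integrable_cyl hu hi w) a).trans_eq ?_
  simp only [cylMeasure, lintegral_smul_measure, smul_eq_mul, Function.comp_apply]

theorem cyl_pre_subset {l : RatioSeq} {n m : ℕ} (h : n ≤ m) (ω : InfWord l) :
    cyl (pre m ω) ⊆ cyl (pre n ω) := by
  intro ω' h'
  have h1 := pre_eq_iff.1 (show pre m ω' = pre m ω from h')
  exact pre_eq_iff.2 fun k hk => h1 k (by omega)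

theorem avg_pre_succ_sub_le {l : RatioSeq} {p : ℝ} (hp : 1 < p) {u : vicsek l → ℝ}
    (hu : Measurable u) (hi : Integrable u (mu l)) (n : ℕ) (ω : InfWord l) :
    ENNReal.ofReal (|avg u (pre n ω) - avg u (pre (n + 1) ω)| ^ p) ≤
      numWords l n * numWords l (n + 1) * cellInt p u (pre n ω) (pre n ω) :=
  (avg_sub_avg_le hp hu hi _ _).trans
    (mul_le_mul_right (cellInt_mono p u subset_rfl (cyl_pre_subset (Nat.le_succ n) ω)) _)

instance (l : RatioSeq) : CompactSpace (vicsek l) := by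
  rw [← isCompact_univ_iff, ← (coding_surjective l).range_eq]
  exact isCompact_range (continuous_coding l)

theorem integrable_of_continuous {l : RatioSeq} {u : vicsek l → ℝ} (hu : Continuous u) :
    Integrable u (mu l) := hu.integrable_of_hasCompactSupport (HasCompactSupport.of_compactSpace u)

theorem tendsto_avg_pre {l : RatioSeq} {u : vicsek l → ℝ} (hu : Continuous u) (ω : ℕ → InfWord l)
    {x : vicsek l} (h : Tendsto (fun n => coding l (ω n)) atTop (𝓝 x)) :
    Tendsto (fun n => avg u (pre n (ω n))) atTop (𝓝 (u x)) := by
  rw [Metric.tendsto_atTop]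
  intro ε hε
  obtain ⟨δ, hδ, hd⟩ := Metric.continuousAt_iff.1 hu.continuousAt (ε / 2) (by linarith)
  have h2 := tendsto_scale l
  have e1 : ∀ᶠ n in atTop, dist (coding l (ω n)) x < δ / 2 :=
    h (Metric.ball_mem_nhds x (by linarith))
  have e2 : ∀ᶠ n in atTop, scale l n < δ / 4 := h2.eventually_lt_const (by linarith)
  obtain ⟨N, hN⟩ := eventually_atTop.1 (e1.and e2)
  refine ⟨N, fun n hn => ?_⟩
  obtain ⟨h3, h4⟩ := hN n hn
  have hb : ∀ᵐ ω' ∂cylMeasure (pre n (ω n)), ‖u (coding l ω') - u x‖ ≤ ε / 2 := by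
    refine Measure.ae_smul_measure (ae_restrict_of_forall_mem (measurableSet_cyl _) ?_) _
    intro ω' hω'
    have h5 := dist_coding_le_of_pre (show pre n ω' = pre n (ω n) from hω')
    have h6 : dist (coding l ω') x < δ := by
      calc _ ≤ _ := dist_triangle _ (coding l (ω n)) _
        _ < δ := by linarith
    exact (hd h6).le
  have hi := integrable_of_continuous hu
  have h7 : avg u (pre n (ω n)) - u x =
      ∫ ω', (u (coding l ω') - u x) ∂cylMeasure (pre n (ω n)) := by
    rw [integral_sub (integrable_cyl hu.measurable hi _) (integrable_const _)]
    simp [avg]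
  rw [dist_eq_norm, h7]
  have h8 := norm_integral_le_of_norm_le_const hb
  simp at h8
  exact lt_of_le_of_lt h8 (by linarith)

/-! ### Discrete energies are controlled by double integrals -/

/-- The double integral at the scale of the cells of level `n`, in the normalisation that compares
with `edgeSum`. -/
noncomputable def cellEnergy (l : RatioSeq) (p : ℝ) (u : vicsek l → ℝ) (n : ℕ) : ℝ≥0∞ :=
  (numWords l n : ℝ≥0∞) ^ 2 * doubleInt l p u (rho l n)

theorem numWords_succ_le {l : RatioSeq} {L : ℕ} (hL : ∀ k, l.ratio k ≤ L) (n : ℕ) :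
    (numWords l (n + 1) : ℝ≥0∞) ≤ (2 * L : ℕ) * numWords l n := by
  rw [numWords_succ, mul_comm]
  have := hL n
  exact_mod_cast Nat.mul_le_mul_right _ (by omega)

theorem numWords_two_mul_le {l : RatioSeq} {L : ℕ} (hL : ∀ k, l.ratio k ≤ L) (n : ℕ) :
    (numWords l (n + 1) * numWords l (n + 2) : ℝ≥0∞) ≤ ((2 * L : ℕ) : ℝ≥0∞) ^ 3 *
      (numWords l n : ℝ≥0∞) ^ 2 := by
  have h1 := numWords_succ_le hL n
  have h2 := numWords_succ_le hL (n + 1)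
  calc (numWords l (n + 1) * numWords l (n + 2) : ℝ≥0∞)
      ≤ ((2 * L : ℕ) * numWords l n) * ((2 * L : ℕ) * ((2 * L : ℕ) * numWords l n)) :=
        mul_le_mul' h1 (h2.trans (mul_le_mul_right h1 _))
    _ = _ := by ring

/-- The difference of the averages over a cell and over a subcell is controlled by the double
integral of the cell with itself. Words with different prefixes run through different cells, so the
sum over `w` is part of the sum over all cells of level `m + 1`. -/
theorem sum_avg_sub_le {l : RatioSeq} {L : ℕ} (hL : ∀ k, l.ratio k ≤ L) {p : ℝ} (hp : 1 < p)
    {u : vicsek l → ℝ} (hu : Measurable u) (hi : Integrable u (mu l)) {n m : ℕ} (hnm : n ≤ m + 1)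
    (τ : InfWord l) :
    ∑ w : Word l n, ENNReal.ofReal (|avg u (pre (m + 1) (glue w τ)) -
      avg u (pre (m + 2) (glue w τ))| ^ p) ≤ ((2 * L : ℕ) : ℝ≥0∞) ^ 3 * cellEnergy l p u m := by
  have hinj : Function.Injective fun w : Word l n => pre (m + 1) (glue w τ) := by
    intro w w' h
    rw [← pre_glue w τ, ← pre_glue w' τ]
    have h1 := pre_eq_iff.1 h
    exact pre_eq_iff.2 fun k hk => h1 k (by omega)
  calc _ ≤ ∑ w : Word l n, (numWords l (m + 1) * numWords l (m + 2) : ℝ≥0∞) *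
        cellInt p u (pre (m + 1) (glue w τ)) (pre (m + 1) (glue w τ)) :=
        Finset.sum_le_sum fun w _ => avg_pre_succ_sub_le hp hu hi (m + 1) (glue w τ)
    _ ≤ (numWords l (m + 1) * numWords l (m + 2) : ℝ≥0∞) *
        ∑ a : Word l (m + 1), cellInt p u a a := by
        rw [← Finset.mul_sum]
        gcongr
        rw [← tsum_fintype (L := .unconditional _), ← tsum_fintype (L := .unconditional _)]
        exact ENNReal.tsum_comp_le_tsum_of_injective hinj fun a => cellInt p u a a
    _ ≤ _ := by
        rw [cellEnergy, ← mul_assoc]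
        exact mul_le_mul' (numWords_two_mul_le hL m) (sum_cellInt_self_le p hu m)

/-- For continuous `u` the values at the centre and at a corner are limits of averages along two
chains of cells. The increment along the edge is therefore a telescoping series of differences of
averages, summed in `ℓ^p` over all edges. -/
theorem edgeSum_rpow_le {l : RatioSeq} {L : ℕ} (hL : ∀ k, l.ratio k ≤ L) {p : ℝ} (hp : 1 < p) :
    ∃ C : ℝ≥0, ∀ u : vicsek l → ℝ, Continuous u → ∀ n,
      edgeSum l p (n + 1) u ^ (1 / p) ≤ C * ∑' k, cellEnergy l p u (n + k) ^ (1 / p) := by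
  have hp0 : 0 ≤ 1 / p := by positivity
  -- The `2` counts orientations, `2 ^ (p - 1)` splits a difference of two terms, `8` is two chains
  -- times four directions, and `(2 * L) ^ 3` pays for the change of levels in the numbers of words.
  let A : ℝ≥0 := 2 * (Real.toNNReal ((2 : ℝ) ^ (p - 1)) * (8 * ((2 * L : ℕ) : ℝ≥0) ^ 3))
  refine ⟨A ^ (1 / p), fun u hu n => ?_⟩
  have hi := integrable_of_continuous hu
  let f : ℕ → Word l (n + 1) × Fin 4 → ℝ := fun k x =>
    avg u (pre (n + 1 + k) (glue x.1 (zeroWord l))) -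
      avg u (pre (n + 1 + k) (glue x.1 (endWord l x.2)))
  have h1 := lintegral_rpow_sub_lim_le (ν := (Measure.count : Measure (Word l (n + 1) × Fin 4)))
    hp.le (f := f) (g := fun x => u (ctr x.1) - u (crn x.1 x.2))
    (fun k => (measurable_of_countable _).aestronglyMeasurable) (by
      intro x
      have hs : Tendsto (fun k => n + 1 + k) atTop atTop := tendsto_atTop_mono
        (fun k => Nat.le_add_left k (n + 1)) tendsto_id
      exact ((tendsto_avg_pre hu (fun _ => glue x.1 (zeroWord l)) tendsto_const_nhds).comp hs).sub
        ((tendsto_avg_pre hu (fun _ => glue x.1 (endWord l x.2)) tendsto_const_nhds).comp hs))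
  simp only [lintegral_count, tsum_fintype] at h1
  -- Both chains start at the same cell.
  have h2 : ∀ x, f 0 x = 0 := by
    intro x
    have e : ∀ τ, pre (n + 1 + 0) (glue x.1 τ) = x.1 := pre_glue x.1
    simp only [f, e, sub_self]
  simp only [h2, zero_sub, abs_neg] at h1
  have h3 : ∀ k, ∑ x, ENNReal.ofReal (|f k x - f (k + 1) x| ^ p) ≤
      ENNReal.ofReal ((2 : ℝ) ^ (p - 1)) *
        (8 * (((2 * L : ℕ) : ℝ≥0∞) ^ 3 * cellEnergy l p u (n + k))) := by
    intro k
    let a : Word l (n + 1) → InfWord l → ℝ := fun w τ =>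
      avg u (pre (n + k + 1) (glue w τ)) - avg u (pre (n + k + 2) (glue w τ))
    have e1 : ∀ x, f k x - f (k + 1) x = a x.1 (zeroWord l) - a x.1 (endWord l x.2) := by
      intro x
      simp only [f, a]
      rw [show n + 1 + k = n + k + 1 by ring, show n + 1 + (k + 1) = n + k + 2 by ring]
      ring
    have e2 : ∀ x, ENNReal.ofReal (|f k x - f (k + 1) x| ^ p) ≤ ENNReal.ofReal ((2 : ℝ) ^ (p - 1)) *
        (ENNReal.ofReal (|a x.1 (zeroWord l)| ^ p) +
          ENNReal.ofReal (|a x.1 (endWord l x.2)| ^ p)) := by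
      intro x
      have := ofReal_rpow_sub_le hp.le (a x.1 (zeroWord l)) 0 (a x.1 (endWord l x.2))
      rwa [← e1, sub_zero, zero_sub, abs_neg] at this
    refine (Finset.sum_le_sum fun x _ => e2 x).trans ?_
    rw [← Finset.mul_sum]
    gcongr
    have e3 : ∀ τ : InfWord l, ∑ w : Word l (n + 1), ENNReal.ofReal (|a w τ| ^ p) ≤
        ((2 * L : ℕ) : ℝ≥0∞) ^ 3 * cellEnergy l p u (n + k) := fun τ =>
      sum_avg_sub_le hL hp hu.measurable hi (by omega) τ
    rw [Finset.sum_add_distrib, Fintype.sum_prod_type_right, Fintype.sum_prod_type_right]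
    calc _ ≤ ∑ _j : Fin 4, ((2 * L : ℕ) : ℝ≥0∞) ^ 3 * cellEnergy l p u (n + k) +
          ∑ _j : Fin 4, ((2 * L : ℕ) : ℝ≥0∞) ^ 3 * cellEnergy l p u (n + k) :=
          add_le_add (Finset.sum_le_sum fun j _ => e3 _) (Finset.sum_le_sum fun j _ => e3 _)
      _ = _ := by
          simp only [Finset.sum_const, Finset.card_univ, Fintype.card_fin, nsmul_eq_mul]
          push_cast; ring
  calc edgeSum l p (n + 1) u ^ (1 / p)
      = 2 ^ (1 / p) * (∑ x : Word l (n + 1) × Fin 4,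
          ENNReal.ofReal (|u (ctr x.1) - u (crn x.1 x.2)| ^ p)) ^ (1 / p) := by
        rw [edgeSum_eq, ENNReal.mul_rpow_of_nonneg _ _ hp0, Fintype.sum_prod_type]; rfl
    _ ≤ 2 ^ (1 / p) * ∑' k, (ENNReal.ofReal ((2 : ℝ) ^ (p - 1)) *
        (8 * (((2 * L : ℕ) : ℝ≥0∞) ^ 3 * cellEnergy l p u (n + k)))) ^ (1 / p) :=
        mul_le_mul_right (h1.trans (ENNReal.tsum_le_tsum fun k => ENNReal.rpow_le_rpow (h3 k) hp0)) _
    _ = _ := by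
        rw [← ENNReal.tsum_mul_left, ← ENNReal.tsum_mul_left]
        refine tsum_congr fun k => ?_
        rw [ENNReal.coe_rpow_of_nonneg _ hp0, ← ENNReal.mul_rpow_of_nonneg _ _ hp0,
          ← ENNReal.mul_rpow_of_nonneg _ _ hp0]
        congr 1
        simp only [A, ENNReal.coe_mul, ENNReal.ofReal, ENNReal.coe_pow, ENNReal.coe_natCast,
          ENNReal.coe_ofNat]
        ring

/-! ### Functions averaged over cells, and energy bounds along subsequences -/

/-- A word that codes a given point. -/
noncomputable def address {l : RatioSeq} (x : vicsek l) : InfWord l :=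
  Function.surjInv (coding_surjective l) x

theorem coding_address {l : RatioSeq} (x : vicsek l) : coding l (address x) = x :=
  Function.surjInv_eq _ x

/-- The centre of a cell lies in no other cell of that level, so the arbitrary choice of an address
does not matter there. -/
theorem pre_eq_of_coding_eq_ctr {l : RatioSeq} {n : ℕ} {w : Word l n} {ω : InfWord l}
    (h : coding l ω = ctr w) : pre n ω = w := by
  obtain ⟨e, he, h1⟩ := coding_eq l ω n
  rw [h, coe_ctr, ctrCode_eq_wcode] at h1
  have h2 := mul_left_cancel₀ (by exact_mod_cast (scale_pos l n).ne' : (scale l n : ℂ) ≠ 0) h1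
  apply wcode_injective
  set v := wcode w - wcode (pre n ω) with hv
  have h3 : e = (2 : ℝ) * emb v := by
    rw [hv, emb_sub]; push_cast; linear_combination -h2
  rw [h3, diamond_smul, diamond_emb] at he
  have h4 : ((|v.1| + |v.2| : ℤ) : ℝ) < 1 := by
    rw [abs_of_pos (by norm_num : (0 : ℝ) < 2)] at he; linarith
  have h5 : |v.1| + |v.2| < 1 := by exact_mod_cast h4
  have a1 := abs_nonneg v.1
  have a2 := abs_nonneg v.2
  have b1 : v.1 = 0 := abs_eq_zero.1 (by omega)
  have b2 : v.2 = 0 := abs_eq_zero.1 (by omega)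
  rw [hv] at b1 b2
  simp only [Prod.fst_sub, Prod.snd_sub] at b1 b2
  ext <;> omega

/-- The function that takes at `x` the average of `u` over a cell of level `n` that contains `x`. -/
noncomputable def localAvg {l : RatioSeq} (u : vicsek l → ℝ) (n : ℕ) (x : vicsek l) : ℝ :=
  avg u (pre n (address x))

/-- The averaged function compares, along an edge, the means over two nearby cells. No limit of
averages occurs, so one scale suffices, in contrast with `edgeSum_rpow_le`. -/
theorem sum_edgeTerm_localAvg_le {l : RatioSeq} {p : ℝ} (hp : 1 < p)
    {u : vicsek l → ℝ} (hu : Measurable u) (hi : Integrable u (mu l)) (n : ℕ) (j : Fin 4) :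
    ∑ w : Word l (n + 1), edgeTerm p (localAvg u (n + 1)) w j ≤
      (numWords l (n + 1) : ℝ≥0∞) ^ 2 * doubleInt l p u (rho l n) := by
  classical
  let b : Word l (n + 1) → Word l (n + 1) := fun w => pre (n + 1) (address (crn w j))
  have h1 : ∀ w, edgeTerm p (localAvg u (n + 1)) w j ≤
      (numWords l (n + 1) : ℝ≥0∞) ^ 2 * cellInt p u w (b w) := by
    intro w
    rw [edgeTerm, localAvg, localAvg, pre_eq_of_coding_eq_ctr (coding_address (ctr w)), sq]
    exact avg_sub_avg_le hp hu hi w (b w)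
  refine (Finset.sum_le_sum fun w _ => h1 w).trans ?_
  rw [← Finset.mul_sum]
  gcongr
  refine le_trans ?_ (sum_cellInt_le p hu (n := n + 1) (fun w w' => b w = w') ?_)
  · refine Finset.sum_le_sum fun a _ => ?_
    rw [Finset.sum_ite_eq]; simp
  · intro ω ω' h
    set w := pre (n + 1) ω
    have d1 : dist (coding l ω') (crn w j) ≤ 2 * scale l (n + 1) := by
      rw [← coding_address (crn w j)]
      exact dist_coding_le_of_pre h.symm
    have d2 : dist (ctr w) (coding l ω) ≤ 2 * scale l (n + 1) :=
      dist_coding_le_of_pre (pre_glue w _)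
    have d3 := dist_ctr_crn w j
    rw [dist_comm] at d3
    have h2 := three_mul_scale_le l n
    have h3 := scale_pos l (n + 1)
    -- The three distances add up to at most `5 * scale l (n + 1)`, while `rho l n` is at least `6 *
    -- scale l (n + 1)`, as all ratios are at least `3`.
    calc dist (coding l ω') (coding l ω) ≤ _ := dist_triangle4 _ (crn w j) (ctr w) _
      _ < rho l n := by rw [rho]; linarith

theorem energyAt_localAvg_le {l : RatioSeq} {L : ℕ} (hL : ∀ k, l.ratio k ≤ L) {p : ℝ} (hp : 1 < p)
    {u : vicsek l → ℝ} (hu : Measurable u) (hi : Integrable u (mu l)) (n : ℕ) :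
    energyAt l p (n + 1) (localAvg u (n + 1)) ≤ ENNReal.ofReal (L ^ (p - 1)) * (2 * L : ℕ) ^ 2 * 4 *
      (ENNReal.ofReal (∏ k ∈ Finset.range n, (l.ratio k : ℝ) ^ (p - 1)) * cellEnergy l p u n) := by
  have h1 : ∑ w : Word l (n + 1), ∑ j, edgeTerm p (localAvg u (n + 1)) w j ≤
      4 * (((2 * L : ℕ) : ℝ≥0∞) ^ 2 * cellEnergy l p u n) := by
    rw [Finset.sum_comm]
    calc _ ≤ ∑ _j : Fin 4, (numWords l (n + 1) : ℝ≥0∞) ^ 2 * doubleInt l p u (rho l n) :=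
          Finset.sum_le_sum fun j _ => sum_edgeTerm_localAvg_le hp hu hi n j
      _ = 4 * ((numWords l (n + 1) : ℝ≥0∞) ^ 2 * doubleInt l p u (rho l n)) := by simp
      _ ≤ _ := by
          rw [cellEnergy, ← mul_assoc (_ ^ 2), ← mul_pow]
          gcongr
          exact numWords_succ_le hL n
  rw [energyAt, edgeSum_eq, Finset.prod_range_succ]
  have h2 : ENNReal.ofReal (1 / 2 * ((∏ k ∈ Finset.range n, (l.ratio k : ℝ) ^ (p - 1)) *
      (l.ratio n : ℝ) ^ (p - 1))) * 2 ≤ ENNReal.ofReal (L ^ (p - 1)) *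
      ENNReal.ofReal (∏ k ∈ Finset.range n, (l.ratio k : ℝ) ^ (p - 1)) := by
    rw [← ENNReal.ofReal_ofNat, ← ENNReal.ofReal_mul (by positivity),
      ← ENNReal.ofReal_mul (by positivity)]
    apply ENNReal.ofReal_le_ofReal
    have h3 : (l.ratio n : ℝ) ^ (p - 1) ≤ (L : ℝ) ^ (p - 1) :=
      Real.rpow_le_rpow (by positivity) (by exact_mod_cast hL n) (by linarith)
    have h4 : 0 ≤ ∏ k ∈ Finset.range n, (l.ratio k : ℝ) ^ (p - 1) := by positivity
    nlinarith
  rw [← mul_assoc]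
  calc _ ≤ _ := mul_le_mul' h2 h1
    _ = _ := by ring

/-- If the double integrals are bounded by `b` along a subsequence, so is the energy. -/
theorem energyAt_le_of_frequently {l : RatioSeq} {L : ℕ} (hL : ∀ k, l.ratio k ≤ L) {p : ℝ}
    (hp : 1 < p) {u : vicsek l → ℝ} (hu : Continuous u) {b : ℝ≥0∞}
    (hb : ∃ᶠ m in atTop, ENNReal.ofReal (∏ k ∈ Finset.range m, (l.ratio k : ℝ) ^ (p - 1)) *
      cellEnergy l p u m ≤ b) (n : ℕ) :
    energyAt l p n u ≤ ENNReal.ofReal (L ^ (p - 1)) * (2 * L : ℕ) ^ 2 * 4 * b := by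
  have hi := integrable_of_continuous hu
  have h1 : ∀ x, Tendsto (fun m => localAvg u (m + 1) x) atTop (𝓝 (u x)) := fun x =>
    (tendsto_avg_pre hu (fun _ => address x)
      (by rw [coding_address]; exact tendsto_const_nhds)).comp (tendsto_add_atTop_nat 1)
  have h2 : Tendsto (fun m => energyAt l p n (localAvg u (m + 1))) atTop (𝓝 (energyAt l p n u)) := by
    simp only [energyAt, edgeSum_eq, edgeTerm]
    refine ENNReal.Tendsto.const_mul (ENNReal.Tendsto.const_mul ?_ (Or.inr (by simp)))
      (Or.inr ENNReal.ofReal_ne_top)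
    refine tendsto_finsetSum _ fun w _ => tendsto_finsetSum _ fun j _ => ENNReal.tendsto_ofReal ?_
    exact (((h1 _).sub (h1 _)).abs).rpow_const (Or.inr (by linarith))
  -- The energy at the fixed level `n` involves finitely many vertices and so passes to the limit.
  -- Monotonicity bounds it by the energy at level `m + 1`, where the averaged function is
  -- controlled.
  refine le_of_tendsto_of_frequently h2 ?_
  refine (hb.and_eventually (eventually_ge_atTop n)).mono fun m hm => ?_
  calc energyAt l p n (localAvg u (m + 1)) ≤ energyAt l p (m + 1) (localAvg u (m + 1)) :=
        energyAt_mono hp.le _ (by omega)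
    _ ≤ _ := energyAt_localAvg_le hL hp hu.measurable hi m
    _ ≤ _ := mul_le_mul_right hm.1 _

/-! ### Continuous versions -/

theorem continuous_pre {l : RatioSeq} (n : ℕ) : Continuous (pre n : InfWord l → Word l n) :=
  continuous_pi fun k => continuous_apply (k : ℕ)

theorem isQuotientMap_coding (l : RatioSeq) : IsQuotientMap (coding l) :=
  (continuous_coding l).isClosedMap.isQuotientMap (continuous_coding l) (coding_surjective l)

/-- Summability makes the averages over the cells of a word converge uniformly, so their limit is
continuous on infinite words. It takes equal values on all addresses of a point, so it descends
through the quotient map `coding`. Convergence of the averages in `L^p` identifies it with `u`. -/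
theorem exists_continuous_of_tsum_ne_top {l : RatioSeq} {L : ℕ} (hL : ∀ k, l.ratio k ≤ L) {p : ℝ}
    (hp : 1 < p) {u : vicsek l → ℝ} (hu : Measurable u) (hi : Integrable u (mu l))
    (hs : ∑' m, cellEnergy l p u m ^ (1 / p) ≠ ∞) :
    ∃ v : C(vicsek l, ℝ), u =ᵐ[mu l] v := by
  have hp0 : 0 < p := by linarith
  have hp1 : 0 < 1 / p := by positivity
  have root : ∀ {x : ℝ} {b : ℝ≥0∞}, ENNReal.ofReal (|x| ^ p) ≤ b → ‖x‖ₑ ≤ b ^ (1 / p) := by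
    intro x b h
    rw [ofReal_abs_rpow hp0.le] at h
    have := ENNReal.rpow_le_rpow h hp1.le
    rwa [← ENNReal.rpow_mul, mul_one_div_cancel hp0.ne', ENNReal.rpow_one] at this
  let K : ℝ≥0∞ := (((2 * L : ℕ) : ℝ≥0∞) ^ 3) ^ (1 / p)
  have hK : K ≠ ∞ := ENNReal.rpow_ne_top_of_nonneg hp1.le
    (ENNReal.pow_ne_top (ENNReal.natCast_ne_top _))
  have ht : ∀ m, cellEnergy l p u m ^ (1 / p) ≠ ∞ := ENNReal.ne_top_of_tsum_ne_top hs
  let δ : ℕ → ℝ := fun m => (K * cellEnergy l p u m ^ (1 / p)).toReal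
  have hδ : Summable δ := ENNReal.summable_toReal (by
    rw [ENNReal.tsum_mul_left]; exact ENNReal.mul_ne_top hK hs)
  let a : ℕ → InfWord l → ℝ := fun m ω => avg u (pre (m + 1) ω)
  have ha : ∀ m ω, ‖a (m + 1) ω - a m ω‖ ≤ δ m := by
    intro m ω
    have h1 := (avg_pre_succ_sub_le hp hu hi (m + 1) ω).trans
      (mul_le_mul_right ((Finset.single_le_sum (f := fun a => cellInt p u a a)
        (fun _ _ => bot_le) (Finset.mem_univ (pre (m + 1) ω))).trans (sum_cellInt_self_le p hu m)) _)
    have h2 : ENNReal.ofReal (|avg u (pre (m + 1) ω) - avg u (pre (m + 1 + 1) ω)| ^ p) ≤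
        ((2 * L : ℕ) : ℝ≥0∞) ^ 3 * cellEnergy l p u m := by
      refine h1.trans ?_
      rw [cellEnergy, ← mul_assoc]
      exact mul_le_mul' (numWords_two_mul_le hL m) le_rfl
    have h3 := root h2
    rw [ENNReal.mul_rpow_of_nonneg _ _ hp1.le] at h3
    rw [norm_sub_rev, ← toReal_enorm]
    exact ENNReal.toReal_mono (ENNReal.mul_ne_top hK (ht m)) h3
  let f : InfWord l → ℝ := fun ω => a 0 ω + ∑' m, (a (m + 1) ω - a m ω)
  have hac : ∀ m, Continuous (a m) := fun m =>
    (continuous_of_discreteTopology (f := fun w : Word l (m + 1) => avg u w)).comp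
      (continuous_pre (m + 1))
  have hf : Continuous f := (hac 0).add
    (continuous_tsum (fun m => (hac (m + 1)).sub (hac m)) hδ ha)
  have hlim : ∀ ω, Tendsto (fun m => a m ω) atTop (𝓝 (f ω)) := by
    intro ω
    have h1 : Summable fun m => a (m + 1) ω - a m ω := Summable.of_norm_bounded hδ fun m => ha m ω
    have h2 := h1.hasSum.tendsto_sum_nat.const_add (a 0 ω)
    simpa only [Finset.sum_range_sub (fun m => a m ω), add_sub_cancel] using h2
  -- Cells of level `m + 1` around two addresses of one point share that point, so their points are
  -- within `4 * scale l (m + 1) < rho l m` and the double integral controls the difference of their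
  -- averages.
  have hfib : ∀ ω ω', coding l ω = coding l ω' → f ω = f ω' := by
    intro ω ω' h
    have h1 : ∀ m, ‖a m ω - a m ω'‖ ≤ δ m := by
      intro m
      classical
      have h2 := avg_sub_avg_le hp hu hi (pre (m + 1) ω) (pre (m + 1) ω')
      have h3 : cellInt p u (pre (m + 1) ω) (pre (m + 1) ω') ≤ doubleInt l p u (rho l m) := by
        let R : Word l (m + 1) → Word l (m + 1) → Prop := fun b b' =>
          b = pre (m + 1) ω ∧ b' = pre (m + 1) ω'
        refine le_trans ?_ (sum_cellInt_le p hu (n := m + 1) R ?_)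
        · refine le_trans ?_ (Finset.single_le_sum (fun _ _ => bot_le)
            (Finset.mem_univ (pre (m + 1) ω)))
          refine le_trans ?_ (Finset.single_le_sum (fun _ _ => bot_le)
            (Finset.mem_univ (pre (m + 1) ω')))
          simp [R]
        · rintro τ τ' ⟨h3, h4⟩
          have d1 := dist_coding_le_of_pre h3.symm
          have d2 := dist_coding_le_of_pre h4
          have h5 := three_mul_scale_le l m
          have h6 := scale_pos l (m + 1)
          have h7 := dist_triangle (coding l τ') (coding l ω') (coding l τ)
          rw [← h] at h7 d2
          rw [rho]; linarith
      have h4 : (numWords l (m + 1) * numWords l (m + 1) : ℝ≥0∞) ≤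
          ((2 * L : ℕ) : ℝ≥0∞) ^ 3 * (numWords l m : ℝ≥0∞) ^ 2 := by
        refine le_trans ?_ (numWords_two_mul_le hL m)
        gcongr
        rw [numWords_succ l (m + 1)]
        exact Nat.le_mul_of_pos_right _ (by have := ratio_pos l (m + 1); omega)
      have h5 := root (h2.trans (mul_le_mul' h4 h3))
      rw [mul_assoc, ENNReal.mul_rpow_of_nonneg _ _ hp1.le] at h5
      rw [← toReal_enorm]
      exact ENNReal.toReal_mono (ENNReal.mul_ne_top hK (ht m)) h5
    have h3 := squeeze_zero_norm h1 hδ.tendsto_atTop_zero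
    exact sub_eq_zero.1 (tendsto_nhds_unique ((hlim ω).sub (hlim ω')) h3)
  let v : vicsek l → ℝ := fun x => f (address x)
  have hv : ∀ ω, v (coding l ω) = f ω := fun ω => hfib _ _ (coding_address _)
  have hvc : Continuous v := (isQuotientMap_coding l).continuous_iff.2 (by
    have : v ∘ coding l = f := funext hv
    rw [this]; exact hf)
  refine ⟨⟨v, hvc⟩, ?_⟩
  have h1 : ∀ m, ∫⁻ ω, ENNReal.ofReal (|u (coding l ω) - a m ω| ^ p) ∂wordMeasure l ≤
      (numWords l (m + 1) : ℝ≥0∞) * doubleInt l p u (rho l m) := by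
    intro m
    rw [lintegral_eq_sum_cyl (m + 1)]
    refine le_trans (Finset.sum_le_sum fun w _ => ?_)
      ((Finset.mul_sum _ _ _).symm.le.trans (mul_le_mul_right (sum_cellInt_self_le p hu m) _))
    rw [cellInt, ← lintegral_const_mul' _ _ (ENNReal.natCast_ne_top _)]
    refine setLIntegral_mono' (measurableSet_cyl w) fun ω hω => ?_
    have h2 : a m ω = avg u w := by simp only [a]; rw [show pre (m + 1) ω = w from hω]
    rw [h2]
    exact sub_avg_le hp hu hi w _
  have h2 : Tendsto (fun m => (numWords l (m + 1) : ℝ≥0∞) * doubleInt l p u (rho l m)) atTop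
      (𝓝 0) := by
    have h3 : Tendsto (fun m => cellEnergy l p u m) atTop (𝓝 0) := by
      have h4 := (ENNReal.tendsto_atTop_zero_of_tsum_ne_top hs).ennrpow_const p
      simp only [← ENNReal.rpow_mul, one_div_mul_cancel hp0.ne', ENNReal.rpow_one,
        ENNReal.zero_rpow_of_pos hp0] at h4
      exact h4
    have h5 : Tendsto (fun m => ((2 * L : ℕ) : ℝ≥0∞) * cellEnergy l p u m) atTop (𝓝 0) := by
      simpa using ENNReal.Tendsto.const_mul h3 (Or.inr (ENNReal.natCast_ne_top (2 * L)))
    refine tendsto_of_tendsto_of_tendsto_of_le_of_le tendsto_const_nhds h5 (fun _ => bot_le) ?_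
    intro m
    simp only [cellEnergy]
    rw [← mul_assoc]
    refine mul_le_mul' ((numWords_succ_le hL m).trans (mul_le_mul_right ?_ _)) le_rfl
    exact_mod_cast Nat.le_self_pow two_ne_zero (numWords l m)
  have huc := hu.comp (measurable_coding l)
  -- Fatou's lemma: the averages tend to `f` pointwise and to `u` in `L^p`.
  have h3 : ∫⁻ ω, ENNReal.ofReal (|u (coding l ω) - f ω| ^ p) ∂wordMeasure l = 0 := by
    have hma : ∀ m, Measurable (a m) := fun m => (hac m).measurable
    have h4 : ∀ ω, ENNReal.ofReal (|u (coding l ω) - f ω| ^ p) =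
        liminf (fun m => ENNReal.ofReal (|u (coding l ω) - a m ω| ^ p)) atTop := by
      intro ω
      refine (Tendsto.liminf_eq (ENNReal.tendsto_ofReal ?_)).symm
      exact ((tendsto_const_nhds.sub (hlim ω)).abs).rpow_const (Or.inr hp0.le)
    simp only [h4]
    have hm : ∀ m, Measurable fun ω => ENNReal.ofReal (|u (coding l ω) - a m ω| ^ p) := by
      intro m
      have := (huc.sub (hma m))
      exact ((measurable_norm.comp this).pow_const p).ennreal_ofReal
    refine le_antisymm ((lintegral_liminf_le hm).trans ?_) bot_le
    rw [← h2.liminf_eq]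
    exact liminf_le_liminf (Eventually.of_forall h1)
  have hm : Measurable fun ω => ENNReal.ofReal (|u (coding l ω) - f ω| ^ p) :=
    ((measurable_norm.comp (huc.sub hf.measurable)).pow_const p).ennreal_ofReal
  have h4 := (lintegral_eq_zero_iff hm).1 h3
  rw [mu_eq]
  refine (ae_map_iff (measurable_coding l).aemeasurable
    (measurableSet_eq_fun hu hvc.measurable)).2 ?_
  filter_upwards [h4] with ω hω
  rw [hv]
  simp only [Pi.zero_apply, ENNReal.ofReal_eq_zero] at hω
  by_contra hne
  have : 0 < |u (coding l ω) - f ω| := abs_pos.2 (sub_ne_zero.2 hne)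
  exact absurd hω (not_le.2 (Real.rpow_pos_of_pos this p))

/-! ### Double integrals are controlled by discrete energies -/

/-- The discrete energy `ψ(ρ_n) ∑ |u(x) - u(y)|^p`. -/
noncomputable def meanEnergy (l : RatioSeq) (p : ℝ) (u : vicsek l → ℝ) (n : ℕ) : ℝ≥0∞ :=
  (numWords l n : ℝ≥0∞)⁻¹ * edgeSum l p n u

/-- `∫ |u(x) - u(z)|^p dμ`, with `z` the centre of the cell of level `n` that contains `x`. -/
noncomputable def centerInt (l : RatioSeq) (p : ℝ) (u : vicsek l → ℝ) (n : ℕ) : ℝ≥0∞ :=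
  ∫⁻ ω, ENNReal.ofReal (|u (ctr (pre n ω)) - u (coding l ω)| ^ p) ∂wordMeasure l

theorem lintegral_ctr_sub_le {l : RatioSeq} {L : ℕ} (hL : ∀ k, l.ratio k ≤ L) {p : ℝ} (hp : 1 ≤ p)
    (u : vicsek l → ℝ) (n : ℕ) :
    ∫⁻ ω, ENNReal.ofReal (|u (ctr (pre n ω)) - u (ctr (pre (n + 1) ω))| ^ p) ∂wordMeasure l ≤
      (2 * L : ℕ) * ENNReal.ofReal ((L : ℝ) ^ (p - 1)) * meanEnergy l p u (n + 1) := by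
  have h1 : ∀ ω : InfWord l, pre n ω = pre n (glue (pre (n + 1) ω) (zeroWord l)) := by
    intro ω
    refine pre_eq_iff.2 fun k hk => ?_
    rw [glue_lt _ _ (by omega), pre]
  have h2 := lintegral_pre (l := l) (n + 1) fun w => ENNReal.ofReal
    (|u (ctr (pre n (glue w (zeroWord l)))) - u (ctr w)| ^ p)
  simp only [← h1] at h2
  rw [h2, sum_child]
  simp only [pre_child]
  have h3 := sum_ctr_child_le hp u n
  rw [meanEnergy, mul_left_comm]
  refine mul_le_mul_right (h3.trans ?_) _
  rw [mul_assoc]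
  have h4 := hL n
  gcongr
  omega

theorem tendsto_ctr_pre {l : RatioSeq} (ω : InfWord l) :
    Tendsto (fun n => ctr (pre n ω)) atTop (𝓝 (coding l ω)) := by
  rw [tendsto_iff_dist_tendsto_zero]
  have h := (tendsto_scale l).const_mul 2
  rw [mul_zero] at h
  exact squeeze_zero (fun _ => dist_nonneg) (fun n => dist_coding_le_of_pre (pre_glue _ _)) h

theorem measurable_comp_pre {l : RatioSeq} (n : ℕ) {β : Type*} [MeasurableSpace β]
    (F : Word l n → β) : Measurable fun ω : InfWord l => F (pre n ω) :=
  (measurable_of_countable F).comp (measurable_pre n)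

/-- Telescoping along the centres of the cells that contain the point; each step runs from a parent
to a child and is paid for by edges one level finer. -/
theorem centerInt_rpow_le {l : RatioSeq} {L : ℕ} (hL : ∀ k, l.ratio k ≤ L) {p : ℝ} (hp : 1 ≤ p)
    {u : vicsek l → ℝ} (hu : Continuous u) (n : ℕ) :
    centerInt l p u n ^ (1 / p) ≤ ((2 * L : ℕ) * ENNReal.ofReal ((L : ℝ) ^ (p - 1))) ^ (1 / p) *
      ∑' k, meanEnergy l p u (n + 1 + k) ^ (1 / p) := by
  have hp1 : 0 ≤ 1 / p := by positivity
  have h1 := lintegral_rpow_sub_lim_le (ν := wordMeasure l) hp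
    (f := fun k ω => u (ctr (pre (n + k) ω))) (g := fun ω => u (coding l ω))
    (fun k => (measurable_comp_pre (n + k) fun w => u (ctr w)).aestronglyMeasurable) (by
      intro ω
      have hs : Tendsto (fun k => n + k) atTop atTop := tendsto_atTop_mono
        (fun k => Nat.le_add_left k n) tendsto_id
      exact ((hu.tendsto _).comp (tendsto_ctr_pre ω)).comp hs)
  refine h1.trans ?_
  rw [← ENNReal.tsum_mul_left]
  refine ENNReal.tsum_le_tsum fun k => ?_
  rw [← ENNReal.mul_rpow_of_nonneg _ _ hp1]
  refine ENNReal.rpow_le_rpow ?_ hp1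
  have := lintegral_ctr_sub_le hL hp u (n + k)
  rwa [show n + 1 + k = n + k + 1 by ring]

theorem cellInt_le {l : RatioSeq} {p : ℝ} (hp : 1 ≤ p) {u : vicsek l → ℝ} (hu : Measurable u) {n : ℕ}
    (a b : Word l n) :
    cellInt p u a b ≤ ENNReal.ofReal ((3 : ℝ) ^ (p - 1)) * ((numWords l n : ℝ≥0∞)⁻¹ *
      ((∫⁻ ω in cyl a, ENNReal.ofReal (|u (ctr a) - u (coding l ω)| ^ p) ∂wordMeasure l) +
      (∫⁻ ω in cyl b, ENNReal.ofReal (|u (ctr b) - u (coding l ω)| ^ p) ∂wordMeasure l) +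
      (numWords l n : ℝ≥0∞)⁻¹ * ENNReal.ofReal (|u (ctr a) - u (ctr b)| ^ p))) := by
  have hm : ∀ c : ℝ, Measurable fun ω => ENNReal.ofReal (|c - u (coding l ω)| ^ p) := by
    intro c
    have := hu.comp (measurable_coding l)
    exact ((measurable_norm.comp (measurable_const.sub this)).pow_const p).ennreal_ofReal
  have h3 : ∀ ω ω', ENNReal.ofReal (|u (coding l ω) - u (coding l ω')| ^ p) ≤
      ENNReal.ofReal ((3 : ℝ) ^ (p - 1)) * (ENNReal.ofReal (|u (ctr a) - u (coding l ω)| ^ p) +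
        ENNReal.ofReal (|u (ctr a) - u (ctr b)| ^ p) +
        ENNReal.ofReal (|u (ctr b) - u (coding l ω')| ^ p)) := by
    intro ω ω'
    have := ofReal_rpow_sub_le_sum hp (fun i : ℕ => if i = 0 then u (coding l ω) else
      if i = 1 then u (ctr a) else if i = 2 then u (ctr b) else u (coding l ω')) 3
    simp only [Finset.sum_range_succ] at this
    simpa [abs_sub_comm (u (coding l ω)) (u (ctr a))] using this
  calc cellInt p u a b ≤ ∫⁻ ω in cyl a, ∫⁻ ω' in cyl b, ENNReal.ofReal ((3 : ℝ) ^ (p - 1)) *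
        (ENNReal.ofReal (|u (ctr a) - u (coding l ω)| ^ p) +
        ENNReal.ofReal (|u (ctr a) - u (ctr b)| ^ p) +
        ENNReal.ofReal (|u (ctr b) - u (coding l ω')| ^ p)) ∂wordMeasure l ∂wordMeasure l :=
        lintegral_mono fun ω => lintegral_mono fun ω' => h3 ω ω'
    _ = _ := by
        simp only [lintegral_const_mul' _ _ ENNReal.ofReal_ne_top, lintegral_const,
          lintegral_add_left measurable_const, Measure.restrict_apply_univ, measure_cyl]
        rw [lintegral_add_right _ measurable_const, lintegral_add_right _ measurable_const,
          lintegral_mul_const' _ _ (by simpa using (numWords_pos l n).ne')]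
        simp only [lintegral_const, Measure.restrict_apply_univ, measure_cyl]
        ring

/-- The converse of `sum_cellInt_le`: pairs of cells outside `R` contain no points closer than `r`
and contribute nothing. -/
theorem doubleInt_le_sum_cellInt {l : RatioSeq} (p : ℝ) {u : vicsek l → ℝ} (hu : Measurable u)
    {n : ℕ} {r : ℝ} (R : Word l n → Word l n → Prop) [∀ a b, Decidable (R a b)]
    (hR : ∀ ω ω', dist (coding l ω') (coding l ω) < r → R (pre n ω) (pre n ω')) :
    doubleInt l p u r ≤ ∑ a, ∑ b, (if R a b then cellInt p u a b else 0) := by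
  rw [doubleInt_eq p hu, lintegral_eq_sum_cyl n]
  refine Finset.sum_le_sum fun a _ => ?_
  let G : Word l n → InfWord l → ℝ≥0∞ := fun b ω => if R a b then
      ∫⁻ ω' in cyl b, ENNReal.ofReal (|u (coding l ω) - u (coding l ω')| ^ p)
        ∂wordMeasure l else 0
  have hG : ∀ b, Measurable (G b) := by
    intro b
    by_cases hab : R a b
    · simp only [G, if_pos hab]
      exact measurable_inner p hu _
    · simp only [G, if_neg hab]
      exact measurable_const
  have h1 : ∀ b, (if R a b then cellInt p u a b else 0) = ∫⁻ ω in cyl a, G b ω ∂wordMeasure l := by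
    intro b
    by_cases hab : R a b
    · simp only [G, if_pos hab]
      rfl
    · simp only [G, if_neg hab, lintegral_zero]
  rw [Finset.sum_congr rfl fun b _ => h1 b, ← lintegral_finsetSum _ fun b _ => hG b]
  refine setLIntegral_mono' (measurableSet_cyl a) fun ω hω => ?_
  rw [lintegral_eq_sum_cyl n]
  refine Finset.sum_le_sum fun b _ => ?_
  by_cases hab : R a b
  · simp only [G, if_pos hab]
    exact lintegral_mono fun ω' => indicator_le_self _ _ _
  · simp only [G, if_neg hab]
    rw [← lintegral_zero (μ := (wordMeasure l).restrict (cyl b))]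
    refine setLIntegral_mono' (measurableSet_cyl b) fun ω' hω' => ?_
    have h2 : pre n ω = a := hω
    have h3 : pre n ω' = b := hω'
    have h4 : ω' ∉ {ω' | dist (coding l ω') (coding l ω) < r} := by
      intro h
      have := hR ω ω' h
      rw [h2, h3] at this
      exact hab this
    exact (indicator_of_notMem h4
      (fun ω' => ENNReal.ofReal (|u (coding l ω) - u (coding l ω')| ^ p))).le

/-- Lattice positions determine cells, so a cell has at most one successor and one predecessor in
direction `v`; each value of `F` and of `G` is counted at most once. -/
theorem sum_adjacent_le {l : RatioSeq} {n : ℕ} [DecidableEq (ℤ × ℤ)] (v : ℤ × ℤ)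
    (F G : Word l n → ℝ≥0∞) :
    ∑ a, ∑ b, (if wcode b = wcode a + v then F a + G b else 0) ≤ ∑ a, F a + ∑ a, G a := by
  classical
  have h1 : ∀ a b : Word l n, (if wcode b = wcode a + v then F a + G b else 0) =
      (if wcode b = wcode a + v then F a else 0) + (if wcode b = wcode a + v then G b else 0) := by
    intro a b; split_ifs <;> simp
  simp only [h1, Finset.sum_add_distrib]
  have key : ∀ (P : Word l n → Prop) [DecidablePred P] (c : ℝ≥0∞),
      (∀ a b, P a → P b → a = b) → ∑ b, (if P b then c else 0) ≤ c := by
    intro P _ c hP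
    by_cases h : ∃ b, P b
    · obtain ⟨b, hb⟩ := h
      rw [Finset.sum_eq_single b]
      · rw [if_pos hb]
      · intro a _ hab
        rw [if_neg fun ha => hab (hP a b ha hb)]
      · simp
    · push Not at h
      simp [h]
  refine add_le_add (Finset.sum_le_sum fun a _ => key _ _ ?_) ?_
  · intro b b' h h'
    exact wcode_injective (h.trans h'.symm)
  · rw [Finset.sum_comm]
    refine Finset.sum_le_sum fun b _ => key _ _ ?_
    intro a a' h h'
    exact wcode_injective (add_right_cancel (h.symm.trans h'))

theorem eq_zero_or_exists_latDir {v : ℤ × ℤ} (h : |v.1| + |v.2| ≤ 1) :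
    v = 0 ∨ ∃ j, v = latDir j := by
  obtain ⟨a, b⟩ := v
  simp only at h
  have ha := abs_le.1 (by have := abs_nonneg b; omega : |a| ≤ 1)
  have hb := abs_le.1 (by have := abs_nonneg a; omega : |b| ≤ 1)
  obtain ⟨h1, h2⟩ := ha
  obtain ⟨h3, h4⟩ := hb
  interval_cases a <;> interval_cases b <;> simp at h
  · exact Or.inr ⟨2, rfl⟩
  · exact Or.inr ⟨3, rfl⟩
  · exact Or.inl rfl
  · exact Or.inr ⟨1, rfl⟩
  · exact Or.inr ⟨0, rfl⟩

/-- Only equal or adjacent cells interact. The increment is split at the two centres, and adjacent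
centres are joined through the common corner by two edges. -/
theorem doubleInt_le {l : RatioSeq} {p : ℝ} (hp : 1 ≤ p) {u : vicsek l → ℝ} (hu : Measurable u)
    {n : ℕ} {r : ℝ} (hr : ∀ ω ω', dist (coding l ω') (coding l ω) < r →
      |(wcode (pre n ω') - wcode (pre n ω)).1| + |(wcode (pre n ω') - wcode (pre n ω)).2| ≤ 1) :
    doubleInt l p u r ≤ ENNReal.ofReal ((3 : ℝ) ^ (p - 1)) * ((numWords l n : ℝ≥0∞)⁻¹ *
      (10 * centerInt l p u n + ENNReal.ofReal ((2 : ℝ) ^ (p - 1)) * meanEnergy l p u n)) := by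
  classical
  set c3 := ENNReal.ofReal ((3 : ℝ) ^ (p - 1))
  set c2 := ENNReal.ofReal ((2 : ℝ) ^ (p - 1))
  set N := (numWords l n : ℝ≥0∞)⁻¹ with hN
  let g : Word l n → ℝ≥0∞ := fun a =>
    ∫⁻ ω in cyl a, ENNReal.ofReal (|u (ctr a) - u (coding l ω)| ^ p) ∂wordMeasure l
  have hg : ∑ a, g a = centerInt l p u n := by
    rw [centerInt, lintegral_eq_sum_cyl n]
    refine Finset.sum_congr rfl fun a _ => ?_
    refine setLIntegral_congr_fun (measurableSet_cyl a) fun ω hω => ?_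
    rw [show pre n ω = a from hω]
  have h1 := doubleInt_le_sum_cellInt p hu (n := n) (r := r) (fun a b =>
    |(wcode b - wcode a).1| + |(wcode b - wcode a).2| ≤ 1) hr
  refine h1.trans ?_
  let F : Fin 4 → Word l n → ℝ≥0∞ := fun j a => c3 * (N * (g a + N * (c2 * edgeTerm p u a j)))
  have h2 : ∀ a b, (if |(wcode b - wcode a).1| + |(wcode b - wcode a).2| ≤ 1 then
      cellInt p u a b else 0) ≤ (if a = b then c3 * (N * (g a + g a)) else 0) +
      ∑ j, if wcode b = wcode a + latDir j then F j a + F (j + 2) b else 0 := by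
    intro a b
    split_ifs with h h' h'
    · refine le_add_right ?_
      subst h'
      refine (cellInt_le hp hu a a).trans ?_
      simp [g, c3, N, Real.zero_rpow (by linarith : p ≠ 0)]
    · refine le_add_left ?_
      rcases eq_zero_or_exists_latDir h with h0 | ⟨j, hj⟩
      · exact absurd (wcode_injective (sub_eq_zero.1 h0)).symm h'
      · have hj' : wcode b = wcode a + latDir j := by rw [← hj]; abel
        refine le_trans ?_ (Finset.single_le_sum (fun _ _ => bot_le) (Finset.mem_univ j))
        rw [if_pos hj']
        refine (cellInt_le hp hu a b).trans ?_
        simp only [F]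
        have e : c3 * (N * (g a + N * (c2 * edgeTerm p u a j))) +
            c3 * (N * (g b + N * (c2 * edgeTerm p u b (j + 2)))) = c3 * (N * (g a + g b +
              N * (c2 * (edgeTerm p u a j + edgeTerm p u b (j + 2))))) := by ring
        rw [e]
        exact mul_le_mul_right (mul_le_mul_right (add_le_add le_rfl
          (mul_le_mul_right (ctr_adjacent_le hp u hj') _)) _) _
    · exact bot_le
    · exact bot_le
  refine (Finset.sum_le_sum fun a _ => Finset.sum_le_sum fun b _ => h2 a b).trans ?_
  simp only [Finset.sum_add_distrib, Finset.sum_ite_eq, Finset.mem_univ, if_true]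
  have h3 : ∑ a, ∑ b, ∑ j, (if wcode b = wcode a + latDir j then F j a + F (j + 2) b else 0) ≤
      ∑ j, (∑ a, F j a + ∑ a, F (j + 2) a) := by
    have e : ∀ a : Word l n, ∑ b, ∑ j, (if wcode b = wcode a + latDir j then F j a + F (j + 2) b
        else 0) = ∑ j, ∑ b, (if wcode b = wcode a + latDir j then F j a + F (j + 2) b else 0) :=
      fun a => Finset.sum_comm
    rw [Finset.sum_congr rfl fun a _ => e a, Finset.sum_comm]
    exact Finset.sum_le_sum fun j _ => sum_adjacent_le (latDir j) (F j) (F (j + 2))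
  -- The factor `10` of `centerInt` is `2` from pairs of equal cells and `2 * 4` from both members
  -- of adjacent pairs in four directions.
  refine (add_le_add le_rfl h3).trans_eq ?_
  have h4 : ∑ j : Fin 4, ∑ a, F (j + 2) a = ∑ j, ∑ a, F j a :=
    Equiv.sum_comp (Equiv.addRight (2 : Fin 4)) fun j => ∑ a, F j a
  have h5 : ∑ j, ∑ a, F j a = c3 * (N * (4 * centerInt l p u n +
      N * (c2 * ∑ a : Word l n, ∑ j, edgeTerm p u a j))) := by
    simp only [F, ← Finset.mul_sum, Finset.sum_add_distrib, hg]
    rw [Finset.sum_comm (s := Finset.univ) (t := Finset.univ) (f := fun a j => edgeTerm p u j a)]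
    simp
  rw [Finset.sum_add_distrib, h4, h5, meanEnergy, edgeSum_eq, ← hN]
  simp only [← Finset.mul_sum, Finset.sum_add_distrib, hg]
  ring

theorem meanEnergy_le_succ {l : RatioSeq} {L : ℕ} (hL : ∀ k, l.ratio k ≤ L) {p : ℝ} (hp : 1 ≤ p)
    (u : vicsek l → ℝ) (n : ℕ) :
    meanEnergy l p u n ≤ (2 * L : ℕ) * ENNReal.ofReal ((L : ℝ) ^ (p - 1)) *
      meanEnergy l p u (n + 1) := by
  have h1 := edgeSum_le_succ hp u n
  have h2 : (numWords l n : ℝ≥0∞)⁻¹ ≤ (2 * L : ℕ) * (numWords l (n + 1) : ℝ≥0∞)⁻¹ := by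
    rw [← div_eq_mul_inv, ENNReal.le_div_iff_mul_le (Or.inl (numWords_ne_zero _ _))
      (Or.inl (ENNReal.natCast_ne_top _)), mul_comm, ← div_eq_mul_inv]
    exact ENNReal.div_le_of_le_mul (numWords_succ_le hL n)
  have h3 : ENNReal.ofReal ((l.ratio n : ℝ) ^ (p - 1)) ≤ ENNReal.ofReal ((L : ℝ) ^ (p - 1)) :=
    ENNReal.ofReal_le_ofReal (Real.rpow_le_rpow (by positivity) (by exact_mod_cast hL n)
      (by linarith))
  calc meanEnergy l p u n ≤ ((2 * L : ℕ) * (numWords l (n + 1) : ℝ≥0∞)⁻¹) *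
        (ENNReal.ofReal ((L : ℝ) ^ (p - 1)) * edgeSum l p (n + 1) u) :=
        mul_le_mul' h2 (h1.trans (mul_le_mul' h3 le_rfl))
    _ = _ := by rw [meanEnergy]; ring

/-- Apply `doubleInt_le` at a suitable level and replace the distance to centres by its telescoping
series. -/
theorem doubleInt_rpow_le {l : RatioSeq} {L : ℕ} (hL : ∀ k, l.ratio k ≤ L) {p : ℝ} (hp : 1 ≤ p) :
    ∃ C : ℝ≥0, ∀ u : vicsek l → ℝ, Continuous u → ∀ n,
      (numWords l n * doubleInt l p u (rho l n)) ^ (1 / p) ≤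
        C * ∑' k, meanEnergy l p u (n + k) ^ (1 / p) := by
  have hp0 : 0 < p := by linarith
  have hp1 : 0 ≤ 1 / p := by positivity
  set B : ℝ≥0∞ := (2 * L : ℕ) * ENNReal.ofReal ((L : ℝ) ^ (p - 1)) with hB
  have hBt : B ≠ ∞ := ENNReal.mul_ne_top (ENNReal.natCast_ne_top _) ENNReal.ofReal_ne_top
  set c3 := ENNReal.ofReal ((3 : ℝ) ^ (p - 1)) with hc3
  set c2 := ENNReal.ofReal ((2 : ℝ) ^ (p - 1)) with hc2
  have hL1 : (1 : ℝ≥0∞) ≤ (2 * L : ℕ) := by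
    have := hL 0
    have := l.three_le 0
    exact_mod_cast (by omega : 1 ≤ 2 * L)
  let K : ℝ≥0∞ := (2 * L : ℕ) * (c3 * (10 * B + c2 * (B + 1)))
  have hK : K ≠ ∞ := by
    refine ENNReal.mul_ne_top (ENNReal.natCast_ne_top _) (ENNReal.mul_ne_top ENNReal.ofReal_ne_top ?_)
    exact ENNReal.add_ne_top.2 ⟨ENNReal.mul_ne_top (by simp) hBt,
      ENNReal.mul_ne_top ENNReal.ofReal_ne_top (ENNReal.add_ne_top.2 ⟨hBt, by simp⟩)⟩
  refine ⟨(K ^ (1 / p)).toNNReal, fun u hu n => ?_⟩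
  rw [ENNReal.coe_toNNReal (ENNReal.rpow_ne_top_of_nonneg hp1 hK)]
  set S := ∑' k, meanEnergy l p u (n + k) ^ (1 / p) with hS
  have pow_root : ∀ x : ℝ≥0∞, (x ^ (1 / p)) ^ p = x := fun x => by
    rw [← ENNReal.rpow_mul, one_div_mul_cancel hp0.ne', ENNReal.rpow_one]
  have hterm : meanEnergy l p u n ≤ S ^ p := by
    have h1 : meanEnergy l p u (n + 0) ^ (1 / p) ≤ S := ENNReal.le_tsum 0
    have := ENNReal.rpow_le_rpow h1 hp0.le
    rwa [pow_root] at this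
  -- The level is one coarser than `n`, since `rho l (n + 1) < scale l n` is what forces cells to be
  -- neighbours. For `n = 0` there is a single cell and level `0` itself works.
  obtain ⟨m, hr, hNm, hcen, hmean⟩ : ∃ m, (∀ ω ω', dist (coding l ω') (coding l ω) < rho l n →
      |(wcode (pre m ω') - wcode (pre m ω)).1| + |(wcode (pre m ω') - wcode (pre m ω)).2| ≤ 1) ∧
      (numWords l n : ℝ≥0∞) ≤ (2 * L : ℕ) * numWords l m ∧ centerInt l p u m ≤ B * S ^ p ∧
      meanEnergy l p u m ≤ (B + 1) * S ^ p := by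
    have hc : ∀ m, centerInt l p u m ≤
        B * (∑' k, meanEnergy l p u (m + 1 + k) ^ (1 / p)) ^ p := by
      intro m
      have := ENNReal.rpow_le_rpow (centerInt_rpow_le hL hp hu m) hp0.le
      rwa [pow_root, ENNReal.mul_rpow_of_nonneg _ _ hp0.le, pow_root] at this
    rcases n with _ | n
    · refine ⟨0, fun ω ω' _ => ?_, le_mul_of_one_le_left bot_le hL1, (hc 0).trans ?_, ?_⟩
      · rw [← ctrCode_eq_wcode, ← ctrCode_eq_wcode]; simp [ctrCode]
      · refine mul_le_mul_right (ENNReal.rpow_le_rpow ?_ hp0.le) _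
        simp only [zero_add] at hS ⊢
        rw [hS]
        simp only [add_comm 1]
        exact ENNReal.tsum_comp_le_tsum_of_injective (add_left_injective 1)
          fun k => meanEnergy l p u k ^ (1 / p)
      · rw [add_mul, one_mul]; exact le_add_left hterm
    · refine ⟨n, fun ω ω' h => ?_, numWords_succ_le hL n, hc n, ?_⟩
      · rw [← ctrCode_eq_wcode, ← ctrCode_eq_wcode]
        refine ctrCode_near ?_
        have h2 := three_mul_scale_le l n
        have h3 := scale_pos l (n + 1)
        rw [dist_comm]
        rw [rho] at h
        linarith
      · rw [add_mul, one_mul]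
        exact le_add_right ((meanEnergy_le_succ hL hp u n).trans (mul_le_mul_right hterm _))
  have h1 : numWords l n * doubleInt l p u (rho l n) ≤ K * S ^ p := by
    calc numWords l n * doubleInt l p u (rho l n)
        ≤ ((2 * L : ℕ) * numWords l m) * (c3 * ((numWords l m : ℝ≥0∞)⁻¹ *
          (10 * (B * S ^ p) + c2 * ((B + 1) * S ^ p)))) := by
          refine mul_le_mul' hNm ((doubleInt_le hp hu.measurable hr).trans ?_)
          gcongr
      _ = ((numWords l m : ℝ≥0∞) * (numWords l m : ℝ≥0∞)⁻¹) * (K * S ^ p) := by ring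
      _ = K * S ^ p := by
          rw [ENNReal.mul_inv_cancel (numWords_ne_zero l m) (ENNReal.natCast_ne_top _), one_mul]
  have h2 := ENNReal.rpow_le_rpow h1 hp1
  rwa [ENNReal.mul_rpow_of_nonneg K _ hp1, ← ENNReal.rpow_mul S, mul_one_div_cancel hp0.ne',
    ENNReal.rpow_one] at h2

/-- Full support upgrades almost everywhere equality of continuous functions to equality, which is
used to see that `diagProj` is not almost everywhere constant. -/
instance (l : RatioSeq) : (mu l).IsOpenPosMeasure := by
  refine ⟨fun O hO hne => ?_⟩
  obtain ⟨x, hx⟩ := hne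
  obtain ⟨ε, hε, hb⟩ := Metric.isOpen_iff.1 hO x hx
  have h1 := (tendsto_scale l).eventually_lt_const (by linarith : (0 : ℝ) < ε / 2)
  obtain ⟨n, hn⟩ := h1.exists
  have h2 : cyl (pre n (address x)) ⊆ coding l ⁻¹' O := by
    intro ω hω
    refine hb ?_
    have := dist_coding_le_of_pre (show pre n ω = pre n (address x) from hω)
    rw [coding_address] at this
    rw [Metric.mem_ball]; linarith
  rw [mu_eq, Measure.map_apply (measurable_coding l) hO.measurableSet]
  refine ((?_ : 0 < wordMeasure l (cyl (pre n (address x)))).trans_le (measure_mono h2)).ne'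
  rw [measure_cyl]
  exact ENNReal.inv_pos.2 (ENNReal.natCast_ne_top _)

/-! ### A nonconstant function of finite energy -/

/-- The increment, in the cell of level `n`, of the coordinate of the projection of the coded point
to the diagonal `[-q_1, q_1]`. -/
noncomputable def shadowStep (l : RatioSeq) (ω : InfWord l) (n : ℕ) : ℝ :=
  if (ctrCode l ω n).2 = 0 then 2 * scale l (n + 1) * (code (ω n)).1 else 0

/-- The coordinate of the projection to the diagonal, up to level `n`. -/
noncomputable def shadow (l : RatioSeq) (ω : InfWord l) (n : ℕ) : ℝ :=
  ∑ k ∈ Finset.range n, shadowStep l ω k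

theorem shadow_succ (l : RatioSeq) (ω : InfWord l) (n : ℕ) :
    shadow l ω (n + 1) = shadow l ω n + shadowStep l ω n := Finset.sum_range_succ _ _

theorem ctrCode_succ_fst (l : RatioSeq) (ω : InfWord l) (n : ℕ) :
    (ctrCode l ω (n + 1)).1 = l.ratio n * (ctrCode l ω n).1 + (code (ω n)).1 := by
  simp [ctrCode]

theorem ctrCode_succ_snd (l : RatioSeq) (ω : InfWord l) (n : ℕ) :
    (ctrCode l ω (n + 1)).2 = l.ratio n * (ctrCode l ω n).2 + (code (ω n)).2 := by
  simp [ctrCode]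

theorem eq_zero_of_mul_add_eq_zero {m : ℕ} {c κ : ℤ} (hκ : 2 * |κ| + 1 ≤ m) (h : m * c + κ = 0) :
    c = 0 := by
  by_contra hc
  have h1 : 1 ≤ |c| := Int.one_le_abs hc
  have h2 : |(m : ℤ) * c| = |κ| := by
    rw [show (m : ℤ) * c = -κ by linarith, abs_neg]
  rw [abs_mul, Nat.abs_cast] at h2
  nlinarith [abs_nonneg κ]

/-- A cell off the diagonal has all its descendants off the diagonal. If the cell of level `n` lies
on the diagonal, so do all its ancestors, every step counts, and the shadow is the centre itself. -/
theorem shadow_eq (l : RatioSeq) (ω : InfWord l) (n : ℕ) (h : (ctrCode l ω n).2 = 0) :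
    shadow l ω n = 2 * scale l n * (ctrCode l ω n).1 := by
  induction n with
  | zero => simp [shadow, ctrCode]
  | succ n ih =>
    rw [ctrCode_succ_snd] at h
    have hc := eq_zero_of_mul_add_eq_zero (code_bounds (ω n)).2.1 h
    rw [shadow_succ, ih hc, shadowStep, if_pos hc, ctrCode_succ_fst, ← ratio_mul_scale_succ l n]
    push_cast; ring

theorem shadow_congr {l : RatioSeq} {ω ω' : InfWord l} {n : ℕ} (h : ∀ k < n, ω k = ω' k) :
    shadow l ω n = shadow l ω' n := by
  refine Finset.sum_congr rfl fun k hk => ?_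
  rw [Finset.mem_range] at hk
  rw [shadowStep, shadowStep, (ctrCode_eq_iff l ω ω' k).2 fun i hi => h i (by omega), h k hk]

/-- One coordinate of two neighbouring cells: either the parents agree in it, or they differ by one
and the two digits sit at opposite extremes, hence are nonzero. -/
theorem abs_le_one_of_near {m : ℕ} (hm : 3 ≤ m) {x κ κ' : ℤ} (hκ : 2 * |κ| + 1 ≤ m)
    (hκ' : 2 * |κ'| + 1 ≤ m) (h : |m * x + (κ' - κ)| ≤ 1) :
    x = 0 ∨ (|x| = 1 ∧ κ ≠ 0 ∧ κ' ≠ 0 ∧ |m * x + (κ' - κ)| = 1) := by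
  have hx : |x| ≤ 1 := by
    by_contra hcon
    have h1 : (m : ℤ) * |x| ≤ 1 + (|κ'| + |κ|) := by
      calc (m : ℤ) * |x| = |(m : ℤ) * x| := by rw [abs_mul, Nat.abs_cast]
        _ = |(m * x + (κ' - κ)) - (κ' - κ)| := by ring_nf
        _ ≤ |m * x + (κ' - κ)| + |κ' - κ| := abs_sub _ _
        _ ≤ 1 + (|κ'| + |κ|) := add_le_add h (abs_sub _ _)
    have h2 : (m : ℤ) * 2 ≤ m * |x| := by
      have : (2 : ℤ) ≤ |x| := by omega
      nlinarith
    omega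
  obtain ⟨a, b⟩ := abs_le.1 hx
  have hx' : x = -1 ∨ x = 0 ∨ x = 1 := by omega
  rcases hx' with rfl | rfl | rfl
  · right
    rw [mul_neg_one] at h ⊢
    refine ⟨by norm_num, ?_⟩
    simp only [abs_le, abs_eq (by norm_num : (0 : ℤ) ≤ 1)] at h ⊢
    have := abs_lt.1 (by omega : |κ| < m)
    rcases abs_cases κ with h1 | h1 <;> rcases abs_cases κ' with h2 | h2 <;> omega
  · exact Or.inl rfl
  · right
    rw [mul_one] at h ⊢
    refine ⟨by norm_num, ?_⟩
    simp only [abs_le, abs_eq (by norm_num : (0 : ℤ) ≤ 1)] at h ⊢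
    rcases abs_cases κ with h1 | h1 <;> rcases abs_cases κ' with h2 | h2 <;> omega

/-- Neighbouring cells have the same shadow unless they are neighbours along the diagonal itself. By
induction on the level, according to the relative position of the parents. -/
theorem shadow_eq_of_near {l : RatioSeq} {ω ω' : InfWord l} (n : ℕ)
    (h : |(ctrCode l ω' n - ctrCode l ω n).1| + |(ctrCode l ω' n - ctrCode l ω n).2| ≤ 1)
    (h' : (ctrCode l ω' n - ctrCode l ω n).1 = 0 ∨ (ctrCode l ω n).2 ≠ 0) :
    shadow l ω n = shadow l ω' n := by
  induction n with
  | zero => rfl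
  | succ n ih =>
    obtain ⟨b1, b2, b3⟩ := code_bounds (ω n)
    obtain ⟨b1', b2', b3'⟩ := code_bounds (ω' n)
    simp only [Prod.fst_sub, Prod.snd_sub] at h h' ih
    rw [ctrCode_succ_fst, ctrCode_succ_fst, ctrCode_succ_snd, ctrCode_succ_snd] at h
    rw [ctrCode_succ_fst, ctrCode_succ_fst, ctrCode_succ_snd] at h'
    set c := ctrCode l ω n
    set c' := ctrCode l ω' n
    set κ := code (ω n)
    set κ' := code (ω' n)
    have e1 : (l.ratio n : ℤ) * c'.1 + κ'.1 - (l.ratio n * c.1 + κ.1) =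
        l.ratio n * (c'.1 - c.1) + (κ'.1 - κ.1) := by ring
    have e2 : (l.ratio n : ℤ) * c'.2 + κ'.2 - (l.ratio n * c.2 + κ.2) =
        l.ratio n * (c'.2 - c.2) + (κ'.2 - κ.2) := by ring
    rw [e1, e2] at h
    rw [e1] at h'
    have a1 := abs_nonneg (l.ratio n * (c'.1 - c.1) + (κ'.1 - κ.1))
    have a2 := abs_nonneg (l.ratio n * (c'.2 - c.2) + (κ'.2 - κ.2))
    have h3 := l.three_le n
    rcases abs_le_one_of_near (x := c'.1 - c.1) h3 b1 b1' (by omega) with hx | ⟨hx, hx1, hx2, hx3⟩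
    · rcases abs_le_one_of_near (x := c'.2 - c.2) h3 b2 b2' (by omega) with hy | ⟨hy, hy1, hy2, hy3⟩
      -- Same parent. Only a parent on the diagonal matters, and then the first digits agree:
      -- otherwise one letter would have two nonzero coordinates, against the shape of the cross.
      · have hcc : c = c' := Prod.ext (by omega) (by omega)
        have hpre := (ctrCode_eq_iff l ω ω' n).1 hcc
        rw [shadow_succ, shadow_succ, shadow_congr hpre]
        congr 1
        have hκ : c.2 = 0 → κ.1 = κ'.1 := by
          intro hc
          rw [hx, mul_zero, zero_add] at h h'
          rw [hy, mul_zero, zero_add] at h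
          rw [hc, mul_zero, zero_add] at h'
          rcases h' with h' | h'
          · omega
          · have k1 : κ.1 = 0 := by tauto
            by_cases hk : κ'.1 - κ.1 = 0
            · omega
            · have := Int.one_le_abs hk
              have h5 : |κ'.2 - κ.2| = 0 := by have := abs_nonneg (κ'.2 - κ.2); omega
              have h6 := abs_eq_zero.1 h5
              have k2 : κ'.2 ≠ 0 := by omega
              have k3 : κ'.1 = 0 := by tauto
              omega
        rw [shadowStep, shadowStep]
        change (if c.2 = 0 then 2 * scale l (n + 1) * (κ.1 : ℝ) else 0) =
          (if c'.2 = 0 then 2 * scale l (n + 1) * (κ'.1 : ℝ) else 0)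
        rw [← hcc]
        split_ifs with hc
        · rw [hκ hc]
        · rfl
      -- Parents adjacent across the diagonal direction: both letters lie on the second axis and do
      -- not move the projection.
      · have k1 : κ.1 = 0 := by tauto
        have k2 : κ'.1 = 0 := by tauto
        rw [shadow_succ, shadow_succ, ih (by rw [hx, hy]; simp) (Or.inl hx)]
        congr 1
        rw [shadowStep, shadowStep]
        change (if c.2 = 0 then 2 * scale l (n + 1) * (κ.1 : ℝ) else 0) =
          (if c'.2 = 0 then 2 * scale l (n + 1) * (κ'.1 : ℝ) else 0)
        rw [k1, k2]
        simp
    -- Parents adjacent along the diagonal direction: both letters lie on the first axis, so the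
    -- hypothesis places both parents off the diagonal, where no step counts.
    · have k1 : κ.2 = 0 := by tauto
      have k2 : κ'.2 = 0 := by tauto
      have hy : c'.2 - c.2 = 0 := by
        rcases abs_le_one_of_near (x := c'.2 - c.2) h3 b2 b2' (by omega) with hy | ⟨-, hy1, -, -⟩
        · exact hy
        · exact absurd k1 hy1
      have hc : c.2 ≠ 0 := by
        rcases h' with h' | h'
        · rw [h'] at hx3; simp at hx3
        · intro hc
          rw [hc, k1] at h'; simp at h'
      have hc' : c'.2 ≠ 0 := by omega
      rw [shadow_succ, shadow_succ, ih (by rw [hx, hy]; simp) (Or.inr hc)]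
      congr 1
      rw [shadowStep, shadowStep, if_neg hc, if_neg hc']

/-- Two addresses of a point run through neighbouring cells. In the exceptional case both cells lie
on the diagonal, and their shadows are centres one lattice step apart. Thus the projection is well
defined in the limit. -/
theorem abs_shadow_sub_le {l : RatioSeq} {ω ω' : InfWord l} (h : coding l ω = coding l ω') (n : ℕ) :
    |shadow l ω n - shadow l ω' n| ≤ 2 * scale l n := by
  have hn := ctrCode_near (l := l) (ω := ω) (ω' := ω') (n := n)
    (by rw [h, dist_self]; exact scale_pos l n)
  have hs := scale_pos l n
  by_cases h' : (ctrCode l ω' n - ctrCode l ω n).1 = 0 ∨ (ctrCode l ω n).2 ≠ 0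
  · rw [shadow_eq_of_near n hn h', sub_self, abs_zero]; positivity
  · push Not at h'
    obtain ⟨h1, h2⟩ := h'
    have h3 := Int.one_le_abs h1
    have h4 : (ctrCode l ω' n).2 = 0 := by
      have h5 : |(ctrCode l ω' n - ctrCode l ω n).2| = 0 := by
        have := abs_nonneg (ctrCode l ω' n - ctrCode l ω n).2
        omega
      have := abs_eq_zero.1 h5
      simp only [Prod.snd_sub] at this
      omega
    rw [shadow_eq l ω n h2, shadow_eq l ω' n h4, ← mul_sub, abs_mul, abs_of_pos (by positivity)]
    have h5 : |(ctrCode l ω n).1 - (ctrCode l ω' n).1| ≤ 1 := by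
      rw [abs_sub_comm]
      have := abs_nonneg (ctrCode l ω' n - ctrCode l ω n).2
      simp only [Prod.fst_sub, Prod.snd_sub] at *
      omega
    have h6 : |((ctrCode l ω n).1 : ℝ) - (ctrCode l ω' n).1| ≤ 1 := by exact_mod_cast h5
    nlinarith

theorem norm_shadowStep_le (l : RatioSeq) (n : ℕ) (ω : InfWord l) :
    ‖shadowStep l ω n‖ ≤ (1 / 3 : ℝ) ^ n := by
  refine le_trans ?_ (scale_le l n)
  rw [shadowStep]
  split_ifs
  · have h1 := (code_bounds (ω n)).1
    have h2 : (2 * |((code (ω n)).1 : ℝ)| + 1) ≤ l.ratio n := by exact_mod_cast h1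
    have hs := scale_pos l (n + 1)
    rw [Real.norm_eq_abs, abs_mul, abs_of_pos (by positivity), ← ratio_mul_scale_succ l n]
    nlinarith
  · simpa using scale_nonneg l n

/-- The coordinate of the projection of the coded point to the diagonal `[-q_1, q_1]`. -/
noncomputable def shadowLim (l : RatioSeq) (ω : InfWord l) : ℝ := ∑' n, shadowStep l ω n

theorem tendsto_shadow (l : RatioSeq) (ω : InfWord l) :
    Tendsto (shadow l ω) atTop (𝓝 (shadowLim l ω)) :=
  (Summable.of_norm_bounded summable_third
    fun n => norm_shadowStep_le l n ω).hasSum.tendsto_sum_nat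

theorem continuous_shadowLim (l : RatioSeq) : Continuous (shadowLim l) := by
  refine continuous_tsum (fun n => ?_) summable_third (norm_shadowStep_le l)
  have h : (fun ω => shadowStep l ω n) =
      (fun w : Word l (n + 1) => shadowStep l (glue w (zeroWord l)) n) ∘ pre (n + 1) := by
    funext ω
    have h1 : ∀ k < n + 1, ω k = glue (pre (n + 1) ω) (zeroWord l) k := by
      intro k hk
      rw [glue_lt _ _ hk, pre]
    rw [Function.comp_apply, shadowStep, shadowStep, ← h1 n (by omega),
      (ctrCode_eq_iff l ω _ n).2 fun k hk => h1 k (by omega)]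
  rw [h]
  exact continuous_of_discreteTopology.comp (continuous_pre (n + 1))

theorem shadowLim_eq {l : RatioSeq} {ω ω' : InfWord l} (h : coding l ω = coding l ω') :
    shadowLim l ω = shadowLim l ω' := by
  have h1 := (tendsto_shadow l ω).sub (tendsto_shadow l ω')
  have h2 : Tendsto (fun n => 2 * scale l n) atTop (𝓝 0) := by
    simpa using (tendsto_scale l).const_mul 2
  exact sub_eq_zero.1 (tendsto_nhds_unique h1 (squeeze_zero_norm (abs_shadow_sub_le h) h2))

/-- The coordinate of the projection to the diagonal `[-q_1, q_1]` along the Vicsek set. -/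
noncomputable def diagProj (l : RatioSeq) (x : vicsek l) : ℝ := shadowLim l (address x)

theorem diagProj_coding {l : RatioSeq} (ω : InfWord l) :
    diagProj l (coding l ω) = shadowLim l ω := shadowLim_eq (coding_address _)

theorem continuous_diagProj (l : RatioSeq) : Continuous (diagProj l) := by
  refine (isQuotientMap_coding l).continuous_iff.2 ?_
  have : diagProj l ∘ coding l = shadowLim l := funext diagProj_coding
  rw [this]
  exact continuous_shadowLim l

theorem diagProj_ctr {l : RatioSeq} {n : ℕ} (w : Word l n) :
    diagProj l (ctr w) = shadow l (glue w (zeroWord l)) n := by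
  rw [ctr, diagProj_coding]
  refine tendsto_nhds_unique (tendsto_shadow l _) (tendsto_const_nhds.congr' ?_)
  filter_upwards [eventually_ge_atTop n] with N hN
  induction N, hN using Nat.le_induction with
  | base => rfl
  | succ N hN ih =>
    rw [shadow_succ, ← ih, shadowStep, glue_ge _ _ hN, zeroWord, code_mkLetter]
    simp

theorem diagProj_crn {l : RatioSeq} {n : ℕ} (w : Word l n) (j : Fin 4) :
    diagProj l (crn w j) = diagProj l (ctr w) +
      if (wcode w).2 = 0 then scale l n * (latDir j).1 else 0 := by
  rw [diagProj_ctr, crn, diagProj_coding]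
  have hsh : shadow l (glue w (zeroWord l)) n = shadow l (glue w (endWord l j)) n :=
    shadow_congr fun k hk => by rw [glue_lt _ _ hk, glue_lt _ _ hk]
  rw [hsh]
  set ω := glue w (endWord l j) with hω
  have hw : ctrCode l ω n = wcode w := by rw [ctrCode_eq_wcode, pre_glue]
  have hcode : ∀ N, n ≤ N → code (ω N) = ((l.ratio N - 1) / 2) • latDir j := by
    intro N hN
    rw [hω, glue_ge _ _ hN, endWord, code_mkLetter]
  -- Along an end word on the diagonal the remaining distance to the corner is `scale l N`, so the
  -- steps up to level `N` add up to `scale l n - scale l N`.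
  have hl : Tendsto (fun N => shadow l ω n + if (wcode w).2 = 0 then
      (scale l n - scale l N) * (latDir j).1 else 0) atTop (𝓝 (shadow l ω n +
      if (wcode w).2 = 0 then (scale l n - 0) * (latDir j).1 else 0)) := by
    split_ifs
    · exact ((tendsto_const_nhds.sub (tendsto_scale l)).mul_const _).const_add _
    · exact tendsto_const_nhds
  rw [sub_zero] at hl
  refine tendsto_nhds_unique (tendsto_shadow l _) (hl.congr' ?_)
  by_cases hj : (latDir j).2 = 0
  · have hc : ∀ N, n ≤ N → ((ctrCode l ω N).2 = 0 ↔ (wcode w).2 = 0) := by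
      intro N hN
      induction N, hN using Nat.le_induction with
      | base => rw [hw]
      | succ N hN ih =>
        rw [ctrCode_succ_snd, hcode N hN, ← ih]
        have := (ratio_pos l N).ne'
        simp [hj, this]
    filter_upwards [eventually_ge_atTop n] with N hN
    induction N, hN using Nat.le_induction with
    | base => simp
    | succ N hN ih =>
      rw [shadow_succ, ← ih, shadowStep, hcode N hN]
      simp only [hc N hN]
      obtain ⟨h, hh⟩ := l.odd N
      have h1 : (l.ratio N - 1) / 2 = h := by omega
      have h2 : (l.ratio N : ℝ) = 2 * h + 1 := by rw [hh]; push_cast; ring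
      have h3 := ratio_mul_scale_succ l N
      rw [h2] at h3
      rw [h1]
      split_ifs
      · rw [Prod.smul_fst, nsmul_eq_mul]
        push_cast
        rw [← h3]; ring
      · simp
  · have hj1 : (latDir j).1 = 0 := by
      have : ∀ j, (latDir j).2 ≠ 0 → (latDir j).1 = 0 := by decide
      exact this j hj
    filter_upwards [eventually_ge_atTop n] with N hN
    rw [hj1]
    simp only [Int.cast_zero, mul_zero, ite_self, add_zero]
    induction N, hN using Nat.le_induction with
    | base => rfl
    | succ N hN ih =>
      rw [shadow_succ, ← ih, shadowStep, hcode N hN]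
      simp [hj1]

theorem scale_eq_inv (l : RatioSeq) (n : ℕ) :
    scale l n = ((∏ k ∈ Finset.range n, l.ratio k : ℕ) : ℝ)⁻¹ := by
  rw [scale, Finset.prod_inv_distrib, Nat.cast_prod]

theorem abs_ctrCode_fst_le (l : RatioSeq) (ω : InfWord l) (n : ℕ) :
    2 * |(ctrCode l ω n).1| + 1 ≤ (∏ k ∈ Finset.range n, l.ratio k : ℕ) := by
  induction n with
  | zero => simp [ctrCode]
  | succ n ih =>
    rw [ctrCode_succ_fst, Finset.prod_range_succ]
    have h1 := (code_bounds (ω n)).1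
    have h2 := abs_add_le ((l.ratio n : ℤ) * (ctrCode l ω n).1) (code (ω n)).1
    rw [abs_mul, Nat.abs_cast] at h2
    push_cast at ih ⊢
    have h3 := l.three_le n
    nlinarith

theorem card_diagonal_le (l : RatioSeq) (n : ℕ) :
    (Finset.univ.filter fun w : Word l n => (wcode w).2 = 0).card ≤
      ∏ k ∈ Finset.range n, l.ratio k := by
  set M := ∏ k ∈ Finset.range n, l.ratio k with hM
  have h1 : (Finset.univ.filter fun w : Word l n => (wcode w).2 = 0).card ≤
      (Finset.Icc (-(((M - 1) / 2 : ℕ) : ℤ)) (((M - 1) / 2 : ℕ) : ℤ)).card := by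
    refine Finset.card_le_card_of_injOn (fun w => (wcode w).1) ?_ ?_
    · intro w _
      have h2 := abs_ctrCode_fst_le l (glue w (zeroWord l)) n
      rw [← hM] at h2
      change 2 * |(wcode w).1| + 1 ≤ (M : ℤ) at h2
      have h3 : |(wcode w).1| ≤ (((M - 1) / 2 : ℕ) : ℤ) := by omega
      simpa using abs_le.1 h3
    · intro w hw w' hw' h
      simp only [Finset.coe_filter, Finset.mem_univ, true_and, mem_ofPred_eq] at hw hw'
      exact wcode_injective (Prod.ext h (hw.trans hw'.symm))
  refine h1.trans ?_
  have hM1 : 1 ≤ M := Finset.prod_pos fun k _ => ratio_pos l k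
  rw [Int.card_Icc]
  omega

/-- With `M` the product of the first `n` ratios, at most `M` cells meet nonconstant edges, and
increments are at most `1 / M`. The normalisation `M ^ (p - 1)` balances `M * M ^ (-p)`, and the
bound `4` counts the directions. -/
theorem energy_diagProj_lt_top (l : RatioSeq) {p : ℝ} (hp : 1 < p) :
    energy l p (diagProj l) < ∞ := by
  refine lt_of_le_of_lt (iSup_le fun n => ?_) (ENNReal.ofReal_lt_top (r := 4))
  set M := ∏ k ∈ Finset.range n, l.ratio k with hM
  have hM1 : (0 : ℝ) < M := by exact_mod_cast Finset.prod_pos fun k _ => ratio_pos l k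
  have h1 : ∀ (w : Word l n) j, edgeTerm p (diagProj l) w j ≤
      if (wcode w).2 = 0 then ENNReal.ofReal (scale l n ^ p) else 0 := by
    intro w j
    rw [edgeTerm, diagProj_crn]
    split_ifs
    · apply ENNReal.ofReal_le_ofReal
      refine Real.rpow_le_rpow (abs_nonneg _) ?_ (by linarith)
      rw [sub_add_cancel_left, abs_neg, abs_mul, abs_of_nonneg (scale_nonneg l n)]
      have : |((latDir j).1 : ℝ)| ≤ 1 := by
        have : |(latDir j).1| ≤ 1 := by revert j; decide
        exact_mod_cast this
      nlinarith [scale_nonneg l n]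
    · simp [Real.zero_rpow (by linarith : p ≠ 0)]
  have h2 : ∑ w : Word l n, ∑ j, edgeTerm p (diagProj l) w j ≤
      4 * (M * ENNReal.ofReal (scale l n ^ p)) := by
    calc _ ≤ ∑ w : Word l n, ∑ _j : Fin 4,
          (if (wcode w).2 = 0 then ENNReal.ofReal (scale l n ^ p) else 0) :=
          Finset.sum_le_sum fun w _ => Finset.sum_le_sum fun j _ => h1 w j
      _ = 4 * (((Finset.univ.filter fun w : Word l n => (wcode w).2 = 0).card : ℝ≥0∞) *
          ENNReal.ofReal (scale l n ^ p)) := by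
          simp only [Finset.sum_const, Finset.card_univ, Fintype.card_fin, nsmul_eq_mul]
          rw [← Finset.mul_sum, ← Finset.sum_filter, Finset.sum_const, nsmul_eq_mul]
          norm_num
      _ ≤ _ := by
          gcongr
          exact card_diagonal_le l n
  rw [energyAt, edgeSum_eq]
  refine (mul_le_mul_right (mul_le_mul_right h2 2) _).trans_eq ?_
  rw [← ENNReal.ofReal_natCast, ← ENNReal.ofReal_ofNat 2, ← ENNReal.ofReal_ofNat 4,
    ← ENNReal.ofReal_mul (by positivity), ← ENNReal.ofReal_mul (by positivity),
    ← ENNReal.ofReal_mul (by positivity), ← ENNReal.ofReal_mul (by positivity)]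
  congr 1
  rw [Real.finsetProd_rpow _ _ fun _ _ => by positivity, ← Nat.cast_prod, ← hM, scale_eq_inv, ← hM,
    Real.inv_rpow hM1.le, Real.rpow_sub_one hM1.ne']
  have h3 := (Real.rpow_pos_of_pos hM1 p).ne'
  field_simp

theorem diagProj_not_const (l : RatioSeq) : ¬ ∃ c : ℝ, diagProj l =ᵐ[mu l] fun _ => c := by
  rintro ⟨c, hc⟩
  have h := (Continuous.ae_eq_iff_eq (mu l) (continuous_diagProj l) continuous_const).1 hc
  let w : Word l 0 := fun k => k.elim0
  have h1 := diagProj_crn w 0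
  rw [h] at h1
  have h2 : (wcode w).2 = 0 := by simp [wcode, ctrCode]
  simp [h2, latDir, scale] at h1

/-! ### Balls and the scale functions -/

theorem rho_pos (l : RatioSeq) (n : ℕ) : 0 < rho l n := mul_pos two_pos (scale_pos l n)

theorem rho_anti (l : RatioSeq) : Antitone (rho l) := fun _ _ h =>
  mul_le_mul_of_nonneg_left (scale_anti l h) two_pos.le

theorem three_mul_rho_le (l : RatioSeq) (n : ℕ) : 3 * rho l (n + 1) ≤ rho l n := by
  have := three_mul_scale_le l n
  rw [rho, rho]; linarith

theorem rho_succ_lt (l : RatioSeq) (n : ℕ) : rho l (n + 1) < rho l n := by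
  have := three_mul_rho_le l n
  have := rho_pos l (n + 1)
  linarith

theorem rho_zero (l : RatioSeq) : rho l 0 = 2 := by simp [rho, scale]

theorem rho_le {l : RatioSeq} {L : ℕ} (hL : ∀ k, l.ratio k ≤ L) (n : ℕ) :
    rho l n ≤ L * rho l (n + 1) := by
  have h1 := ratio_mul_scale_succ l n
  have h2 : (l.ratio n : ℝ) ≤ L := by exact_mod_cast hL n
  have h3 := scale_pos l (n + 1)
  rw [rho, rho, ← h1]
  nlinarith

theorem tendsto_rho (l : RatioSeq) : Tendsto (rho l) atTop (𝓝 0) := by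
  have h := (tendsto_scale l).const_mul 2
  rw [mul_zero] at h
  exact h

theorem level_eq {l : RatioSeq} {n : ℕ} {r : ℝ} (h1 : rho l (n + 1) < r) (h2 : r ≤ rho l n) :
    level l r = n := by
  refine le_antisymm (Nat.sInf_le h1) (le_csInf ⟨n, h1⟩ fun m hm => ?_)
  by_contra hcon
  have h3 := rho_anti l (by omega : m + 1 ≤ n)
  exact absurd hm (not_lt.2 (h2.trans h3))

theorem exists_level {l : RatioSeq} {r : ℝ} (h1 : 0 < r) (h2 : r ≤ 2) :
    ∃ n, rho l (n + 1) < r ∧ r ≤ rho l n := by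
  classical
  have h3 : ∃ n, rho l (n + 1) < r :=
    ((tendsto_rho l).comp (tendsto_add_atTop_nat 1)).eventually_lt_const h1 |>.exists
  refine ⟨Nat.find h3, Nat.find_spec h3, ?_⟩
  rcases h : Nat.find h3 with _ | m
  · rw [rho_zero]; exact h2
  · have := Nat.find_min h3 (m := m) (by omega)
    exact not_lt.1 this

/-- `φ(ρ_n)`. -/
noncomputable def phiAt (l : RatioSeq) (p : ℝ) (n : ℕ) : ℝ :=
  rho l n ^ (p - 1) * (numWords l n : ℝ)⁻¹

theorem psi_rho (l : RatioSeq) (n : ℕ) : psi l (rho l n) = (numWords l n : ℝ)⁻¹ := by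
  rw [psi, level_eq (rho_succ_lt l n) le_rfl, numWords, Nat.cast_prod, ← Finset.prod_inv_distrib]
  refine Finset.prod_congr rfl fun k _ => ?_
  have := ratio_pos l k
  rw [Nat.cast_sub (by omega)]; push_cast; rfl

theorem phi_eq {l : RatioSeq} (p : ℝ) {n : ℕ} {r : ℝ} (h1 : rho l (n + 1) < r) (h2 : r ≤ rho l n) :
    phi l p r = phiAt l p n := by
  rw [phi, level_eq h1 h2, psi_rho, phiAt]

theorem phiAt_pos (l : RatioSeq) (p : ℝ) (n : ℕ) : 0 < phiAt l p n :=
  mul_pos (Real.rpow_pos_of_pos (rho_pos l n) _)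
    (inv_pos.2 (by exact_mod_cast numWords_pos l n))

theorem measure_ball_ge {l : RatioSeq} (x : vicsek l) {n : ℕ} {r : ℝ} (h : rho l n < r) :
    (numWords l n : ℝ≥0∞)⁻¹ ≤ mu l (Metric.ball x r) := by
  rw [mu_eq, Measure.map_apply (measurable_coding l) measurableSet_ball,
    ← measure_cyl (pre n (address x))]
  refine measure_mono fun ω hω => ?_
  have := dist_coding_le_of_pre (show pre n ω = pre n (address x) from hω)
  rw [coding_address] at this
  exact lt_of_le_of_lt this h

theorem card_near_le {l : RatioSeq} {n : ℕ} (c : ℤ × ℤ) :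
    (Finset.univ.filter fun b : Word l n =>
      |(wcode b - c).1| + |(wcode b - c).2| ≤ 1).card ≤ 9 := by
  have h1 : (Finset.univ.filter fun b : Word l n =>
      |(wcode b - c).1| + |(wcode b - c).2| ≤ 1).card ≤
      (Finset.Icc (c.1 - 1) (c.1 + 1) ×ˢ Finset.Icc (c.2 - 1) (c.2 + 1)).card := by
    refine Finset.card_le_card_of_injOn wcode ?_ (wcode_injective.injOn)
    intro b hb
    simp only [Finset.coe_filter, Finset.mem_univ, true_and, mem_ofPred_eq, Prod.fst_sub,
      Prod.snd_sub] at hb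
    have h2 := abs_nonneg ((wcode b).1 - c.1)
    have h3 := abs_nonneg ((wcode b).2 - c.2)
    have h4 := abs_le.1 (by omega : |(wcode b).1 - c.1| ≤ 1)
    have h5 := abs_le.1 (by omega : |(wcode b).2 - c.2| ≤ 1)
    simp only [Finset.coe_product, Set.mem_prod, Finset.coe_Icc, Set.mem_Icc]
    omega
  refine h1.trans ?_
  rw [Finset.card_product, Int.card_Icc, Int.card_Icc]
  have e1 : (c.1 + 1 + 1 - (c.1 - 1)).toNat = 3 := by omega
  have e2 : (c.2 + 1 + 1 - (c.2 - 1)).toNat = 3 := by omega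
  rw [e1, e2]

/-- The ball meets only cells of the next coarser level within one lattice step of a given cell.
There are at most `9` in a three by three box, and the change of level costs `2 * L`. -/
theorem measure_ball_le {l : RatioSeq} {L : ℕ} (hL : ∀ k, l.ratio k ≤ L) (x : vicsek l) {n : ℕ}
    {r : ℝ} (h : r ≤ rho l n) :
    mu l (Metric.ball x r) ≤ (18 * L : ℕ) * (numWords l n : ℝ≥0∞)⁻¹ := by
  rcases n with _ | n
  · refine prob_le_one.trans ?_
    have := hL 0
    have := l.three_le 0
    simp only [numWords, Finset.range_zero, Finset.prod_empty, Nat.cast_one, inv_one, mul_one]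
    exact_mod_cast (by omega : 1 ≤ 18 * L)
  have hr : ∀ ω, coding l ω ∈ Metric.ball x r →
      |(wcode (pre n ω) - wcode (pre n (address x))).1| +
        |(wcode (pre n ω) - wcode (pre n (address x))).2| ≤ 1 := by
    intro ω hω
    rw [← ctrCode_eq_wcode, ← ctrCode_eq_wcode]
    refine ctrCode_near ?_
    have h2 := three_mul_scale_le l n
    have h3 := scale_pos l (n + 1)
    rw [coding_address, dist_comm]
    rw [Metric.mem_ball] at hω
    rw [rho] at h
    linarith
  rw [mu_eq, Measure.map_apply (measurable_coding l) measurableSet_ball]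
  set S := Finset.univ.filter fun b : Word l n =>
      |(wcode b - wcode (pre n (address x))).1| + |(wcode b - wcode (pre n (address x))).2| ≤ 1
  calc wordMeasure l (coding l ⁻¹' Metric.ball x r) ≤ wordMeasure l (⋃ b ∈ S, cyl b) := by
        refine measure_mono fun ω hω => ?_
        exact mem_biUnion (x := pre n ω) (by simpa [S] using hr ω hω) rfl
    _ ≤ ∑ b ∈ S, wordMeasure l (cyl b) := measure_biUnion_finset_le _ _
    _ = S.card * (numWords l n : ℝ≥0∞)⁻¹ := by
        simp only [measure_cyl, Finset.sum_const, nsmul_eq_mul]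
    _ ≤ (9 : ℕ) * ((2 * L : ℕ) * (numWords l (n + 1) : ℝ≥0∞)⁻¹) := by
        refine mul_le_mul' (by exact_mod_cast card_near_le _) ?_
        rw [← div_eq_mul_inv, ENNReal.le_div_iff_mul_le (Or.inl (numWords_ne_zero _ _))
          (Or.inl (ENNReal.natCast_ne_top _)), mul_comm, ← div_eq_mul_inv]
        exact ENNReal.div_le_of_le_mul (numWords_succ_le hL n)
    _ = _ := by push_cast; ring

/-! ### Ball averages on shells of radii -/

/-- `φ(ρ_n)^{-t}`. -/
noncomputable def weight (l : RatioSeq) (p t : ℝ) (n : ℕ) : ℝ≥0∞ := ENNReal.ofReal (phiAt l p n ^ (-t))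

theorem Phi_eq {l : RatioSeq} (p βs β : ℝ) (u : vicsek l → ℝ) {n : ℕ} {r : ℝ}
    (h1 : rho l (n + 1) < r) (h2 : r ≤ rho l n) :
    Phi l p βs β u r = weight l p (β / βs) n * ∫⁻ x, (mu l (Metric.ball x r))⁻¹ *
      ∫⁻ y in Metric.ball x r, ENNReal.ofReal (|u x - u y| ^ p) ∂mu l ∂mu l := by
  have hp := phiAt_pos l p n
  have hw : weight l p (β / βs) n ≠ ∞ := ENNReal.ofReal_ne_top
  have e : ∀ a : ℝ, 0 ≤ a → ENNReal.ofReal (a / phiAt l p n ^ (β / βs)) =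
      weight l p (β / βs) n * ENNReal.ofReal a := by
    intro a ha
    rw [weight, ← ENNReal.ofReal_mul (by positivity), Real.rpow_neg hp.le, div_eq_inv_mul]
  simp only [Phi, phi_eq p h1 h2, setLAverage_eq]
  rw [← lintegral_const_mul' _ _ hw]
  refine lintegral_congr fun x => ?_
  simp only [e _ (Real.rpow_nonneg (abs_nonneg _) p)]
  rw [lintegral_const_mul' _ _ hw, ENNReal.div_eq_inv_mul, mul_left_comm]

/-- The Besov counterpart of `meanEnergy`. -/
noncomputable def meanInt (l : RatioSeq) (p : ℝ) (u : vicsek l → ℝ) (n : ℕ) : ℝ≥0∞ :=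
  numWords l n * doubleInt l p u (rho l n)

theorem Phi_le {l : RatioSeq} {L : ℕ} (hL : ∀ k, l.ratio k ≤ L) (p βs β : ℝ) (u : vicsek l → ℝ)
    {n : ℕ} {r : ℝ} (h1 : rho l (n + 1) < r) (h2 : r ≤ rho l n) :
    Phi l p βs β u r ≤ (2 * L : ℕ) * (weight l p (β / βs) n * meanInt l p u n) := by
  rw [Phi_eq p βs β u h1 h2, mul_left_comm]
  refine mul_le_mul_right ?_ _
  calc _ ≤ ∫⁻ x, (numWords l (n + 1) : ℝ≥0∞) *
        ∫⁻ y in Metric.ball x r, ENNReal.ofReal (|u x - u y| ^ p) ∂mu l ∂mu l := by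
        refine lintegral_mono fun x => mul_le_mul' ?_ le_rfl
        rw [ENNReal.inv_le_iff_inv_le]
        exact measure_ball_ge x h1
    _ = numWords l (n + 1) * doubleInt l p u r := by
        rw [lintegral_const_mul' _ _ (ENNReal.natCast_ne_top _)]; rfl
    _ ≤ _ := by
        rw [meanInt, ← mul_assoc]
        exact mul_le_mul' (numWords_succ_le hL n) (doubleInt_mono l p u h2)

theorem le_Phi {l : RatioSeq} {L : ℕ} (hL : ∀ k, l.ratio k ≤ L) (p βs β : ℝ) (u : vicsek l → ℝ)
    {n : ℕ} {r : ℝ} (h1 : rho l (n + 1) < r) (h2 : r ≤ rho l n) :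
    weight l p (β / βs) n * (numWords l n * doubleInt l p u r) ≤
      (18 * L : ℕ) * Phi l p βs β u r := by
  rw [Phi_eq p βs β u h1 h2, mul_left_comm ((18 * L : ℕ) : ℝ≥0∞)]
  refine mul_le_mul_right ?_ _
  rw [doubleInt, ← lintegral_const_mul' _ _ (ENNReal.natCast_ne_top _),
    ← lintegral_const_mul' _ _ (ENNReal.natCast_ne_top _)]
  refine lintegral_mono fun x => ?_
  rw [← mul_assoc]
  refine mul_le_mul' ?_ le_rfl
  have hpos : mu l (Metric.ball x r) ≠ 0 :=
    ((ENNReal.inv_pos.2 (ENNReal.natCast_ne_top _)).trans_le (measure_ball_ge x h1)).ne'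
  rw [← div_eq_mul_inv, ENNReal.le_div_iff_mul_le (Or.inl hpos) (Or.inl (measure_ne_top _ _))]
  refine (mul_le_mul_right (measure_ball_le hL x h2) _).trans ?_
  rw [mul_left_comm, ENNReal.mul_inv_cancel (numWords_ne_zero l n) (ENNReal.natCast_ne_top _),
    mul_one]

theorem Phi_congr {l : RatioSeq} (p βs β : ℝ) {u v : vicsek l → ℝ} (h : u =ᵐ[mu l] v) :
    Phi l p βs β u = Phi l p βs β v := by
  funext r
  refine lintegral_congr_ae ?_
  filter_upwards [h] with x hx
  refine laverage_congr (ae_restrict_of_ae ?_)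
  filter_upwards [h] with y hy
  rw [hx, hy]

/-- Opposite corners realise the diameter. As it equals `rho l 0`, the shells `(ρ_{n+1}, ρ_n]`
exhaust the admissible radii. -/
theorem diam_vicsek (l : RatioSeq) : Metric.diam (vicsek l) = 2 := by
  have hc : IsCompact (vicsek l) := isCompact_iff_compactSpace.2 inferInstance
  refine le_antisymm (Metric.diam_le_of_forall_dist_le (by norm_num) fun x hx y hy => ?_) ?_
  · have key : ∀ z : vicsek l, ‖(z : ℂ)‖ ≤ 1 := by
      intro z
      obtain ⟨ω, rfl⟩ := coding_surjective l z
      obtain ⟨e, he, h⟩ := coding_eq l ω 0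
      have : (coding l ω : ℂ) = e := by rw [h]; simp [scale, ctrCode, emb]
      rw [this]
      exact (norm_le_diamond e).trans he
    rw [dist_eq_norm]
    have h1 := key ⟨x, hx⟩
    have h2 := key ⟨y, hy⟩
    calc ‖x - y‖ ≤ ‖x‖ + ‖y‖ := norm_sub_le _ _
      _ ≤ 2 := by simp only at h1 h2; linarith
  · let w : Word l 0 := fun k => k.elim0
    have h := Metric.dist_le_diam_of_mem hc.isBounded (crn w 0).2 (crn w 2).2
    have e : corner 2 = -corner 0 := corner_add_two 0
    rw [coe_crn, coe_crn, e, dist_eq_norm] at h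
    have e2 : ((scale l 0 : ℂ) * (2 * emb (wcode w) + corner 0) -
        scale l 0 * (2 * emb (wcode w) + -corner 0)) = 2 * corner 0 := by
      simp [scale]; ring
    rw [e2, norm_mul, norm_corner] at h
    simpa using h

theorem radii_eq (l : RatioSeq) : radii l = ⋃ n, Ioc (rho l (n + 1)) (rho l n) := by
  rw [radii, diam_vicsek]
  ext r
  simp only [mem_Ioc, mem_iUnion]
  constructor
  · rintro ⟨h1, h2⟩
    exact exists_level h1 h2
  · rintro ⟨n, h1, h2⟩
    exact ⟨(rho_pos l _).trans h1, h2.trans (by rw [← rho_zero l]; exact rho_anti l (Nat.zero_le n))⟩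

theorem mem_radii_iff {l : RatioSeq} {r : ℝ} :
    r ∈ radii l ↔ ∃ n, rho l (n + 1) < r ∧ r ≤ rho l n := by
  rw [radii_eq]; simp

theorem lintegral_radii (l : RatioSeq) (G : ℝ → ℝ≥0∞) :
    ∫⁻ r in radii l, G r = ∑' n, ∫⁻ r in Ioc (rho l (n + 1)) (rho l n), G r := by
  rw [radii_eq, lintegral_iUnion (fun n => measurableSet_Ioc)]
  intro n m hnm
  rw [Function.onFun, Set.disjoint_left]
  rintro r ⟨h1, h2⟩ ⟨h3, h4⟩
  exact hnm ((level_eq h1 h2).symm.trans (level_eq h3 h4))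

/-! ### Weighted comparison of sequences -/

theorem le_pow_mul_add {a : ℕ → ℝ≥0∞} {ϑ : ℝ≥0∞} (ha : ∀ n, a n ≤ ϑ * a (n + 1)) (n k : ℕ) :
    a n ≤ ϑ ^ k * a (n + k) := by
  induction k with
  | zero => simp
  | succ k ih =>
    refine ih.trans ?_
    rw [pow_succ, mul_assoc]
    exact mul_le_mul_right (ha (n + k)) _

/-- Growth of the weights gives `a n ≤ ϑ ^ k * a (n + k)`, so the series of `p`-th roots acquires
geometric coefficients; a geometric sum bounds the supremum and Hardy's inequality the sum. The
constant depends only on `p`, `ϑ` and `C`, which later yields uniformity in `β`. -/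
theorem exists_weighted_le {p : ℝ} (hp : 1 < p) {ϑ : ℝ≥0∞} (hϑ : ϑ < 1) (C : ℝ≥0) :
    ∃ K : ℝ≥0, ∀ a x y : ℕ → ℝ≥0∞, (∀ n, a n ≤ ϑ * a (n + 1)) →
      (∀ n, x n ^ (1 / p) ≤ C * ∑' k, y (n + k) ^ (1 / p)) →
      (⨆ n, a n * x n) ≤ K * (⨆ n, a n * y n) ∧
        (∑' n, a n * x n) ≤ K * ∑' n, a n * y n := by
  have hp0 : 0 < p := by linarith
  have hp1 : 0 < 1 / p := by positivity
  set θ := ϑ ^ (1 / p) with hθ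
  have hθ1 : θ < 1 := ENNReal.rpow_lt_one hϑ hp1
  have hS : (1 - θ)⁻¹ ≠ ∞ := by simpa using (tsub_pos_of_lt hθ1).ne'
  have hK : (C : ℝ≥0∞) ^ p * ((1 - θ)⁻¹) ^ p ≠ ∞ :=
    ENNReal.mul_ne_top (ENNReal.rpow_ne_top_of_nonneg hp0.le ENNReal.coe_ne_top)
      (ENNReal.rpow_ne_top_of_nonneg hp0.le hS)
  refine ⟨((C : ℝ≥0∞) ^ p * ((1 - θ)⁻¹) ^ p).toNNReal, fun a x y ha h => ?_⟩
  rw [ENNReal.coe_toNNReal hK]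
  have key : ∀ n, a n * x n ≤ (C : ℝ≥0∞) ^ p *
      (∑' k, θ ^ k * (a (n + k) * y (n + k)) ^ (1 / p)) ^ p := by
    intro n
    have h1 : (a n * x n) ^ (1 / p) ≤ C * ∑' k, θ ^ k * (a (n + k) * y (n + k)) ^ (1 / p) := by
      rw [ENNReal.mul_rpow_of_nonneg _ _ hp1.le]
      refine (mul_le_mul_right (h n) _).trans ?_
      rw [mul_left_comm, ← ENNReal.tsum_mul_left]
      refine mul_le_mul_right (ENNReal.tsum_le_tsum fun k => ?_) _
      rw [ENNReal.mul_rpow_of_nonneg _ _ hp1.le, ← mul_assoc]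
      refine mul_le_mul_left ?_ _
      refine (ENNReal.rpow_le_rpow (le_pow_mul_add ha n k) hp1.le).trans_eq ?_
      rw [ENNReal.mul_rpow_of_nonneg _ _ hp1.le, hθ, ← ENNReal.rpow_natCast, ← ENNReal.rpow_natCast,
        ← ENNReal.rpow_mul, ← ENNReal.rpow_mul, mul_comm (k : ℝ)]
    have h2 := ENNReal.rpow_le_rpow h1 hp0.le
    rwa [← ENNReal.rpow_mul, one_div_mul_cancel hp0.ne', ENNReal.rpow_one,
      ENNReal.mul_rpow_of_nonneg _ _ hp0.le] at h2
  constructor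
  · refine iSup_le fun n => (key n).trans ?_
    rw [mul_assoc]
    refine mul_le_mul_right ?_ _
    set b := ⨆ n, a n * y n with hb
    calc _ ≤ (∑' k : ℕ, θ ^ k * b ^ (1 / p)) ^ p := by
          refine ENNReal.rpow_le_rpow (ENNReal.tsum_le_tsum fun k => ?_) hp0.le
          refine mul_le_mul_right (ENNReal.rpow_le_rpow ?_ hp1.le) _
          exact le_iSup (fun n => a n * y n) (n + k)
      _ = _ := by
          rw [ENNReal.tsum_mul_right, ENNReal.tsum_geometric, ENNReal.mul_rpow_of_nonneg _ _ hp0.le,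
            ← ENNReal.rpow_mul, one_div_mul_cancel hp0.ne', ENNReal.rpow_one]
  · refine (ENNReal.tsum_le_tsum key).trans ?_
    rw [ENNReal.tsum_mul_left, mul_assoc]
    refine mul_le_mul_right ?_ _
    refine (tsum_rpow_geometric_le hp hθ1 fun n => (a n * y n) ^ (1 / p)).trans_eq ?_
    congr 1
    refine tsum_congr fun n => ?_
    rw [← ENNReal.rpow_mul, one_div_mul_cancel hp0.ne', ENNReal.rpow_one]

/-! ### Growth of the weights -/

theorem two_ratio_sub_one (l : RatioSeq) (n : ℕ) :
    ((2 * l.ratio n - 1 : ℕ) : ℝ) = 2 * l.ratio n - 1 := by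
  have := ratio_pos l n
  rw [Nat.cast_sub (by omega)]; push_cast; rfl

theorem three_le_ratio (l : RatioSeq) (n : ℕ) : (3 : ℝ) ≤ l.ratio n := by
  exact_mod_cast l.three_le n

/-- The quotient `φ(ρ_n) / φ(ρ_{n+1})`. -/
noncomputable def growth (l : RatioSeq) (p : ℝ) (n : ℕ) : ℝ :=
  (l.ratio n : ℝ) ^ (p - 1) * (2 * l.ratio n - 1)

theorem growth_pos (l : RatioSeq) (p : ℝ) (n : ℕ) : 0 < growth l p n := by
  have := three_le_ratio l n
  exact mul_pos (Real.rpow_pos_of_pos (by linarith) _) (by linarith)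

theorem three_rpow_le_growth (l : RatioSeq) {p : ℝ} (hp : 1 < p) (n : ℕ) :
    (3 : ℝ) ^ (p - 1) ≤ growth l p n := by
  have := three_le_ratio l n
  have h1 : (3 : ℝ) ^ (p - 1) ≤ (l.ratio n : ℝ) ^ (p - 1) :=
    Real.rpow_le_rpow (by norm_num) this (by linarith)
  have h2 : 0 < (l.ratio n : ℝ) ^ (p - 1) := Real.rpow_pos_of_pos (by linarith) _
  rw [growth]
  nlinarith

theorem one_le_growth (l : RatioSeq) {p : ℝ} (hp : 1 < p) (n : ℕ) : 1 ≤ growth l p n :=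
  (Real.one_le_rpow (by norm_num) (by linarith)).trans (three_rpow_le_growth l hp n)

theorem growth_le {l : RatioSeq} {L : ℕ} (hL : ∀ k, l.ratio k ≤ L) {p : ℝ} (hp : 1 < p) (n : ℕ) :
    growth l p n ≤ (L : ℝ) ^ (p - 1) * (2 * L) := by
  have h0 := three_le_ratio l n
  have h1 : (l.ratio n : ℝ) ≤ L := by exact_mod_cast hL n
  exact mul_le_mul (Real.rpow_le_rpow (by linarith) h1 (by linarith)) (by linarith) (by linarith)
    (by positivity)

theorem phiAt_succ (l : RatioSeq) (p : ℝ) (n : ℕ) :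
    phiAt l p n = growth l p n * phiAt l p (n + 1) := by
  have h0 := three_le_ratio l n
  have h1 : rho l n = l.ratio n * rho l (n + 1) := by
    rw [rho, rho, ← ratio_mul_scale_succ l n]; ring
  rw [phiAt, phiAt, growth, numWords_succ, Nat.cast_mul, two_ratio_sub_one, h1,
    Real.mul_rpow (by linarith) (rho_pos l _).le]
  have h2 : (2 * (l.ratio n : ℝ) - 1) ≠ 0 := by linarith
  field_simp

theorem weight_ne_top (l : RatioSeq) (p t : ℝ) (n : ℕ) : weight l p t n ≠ ∞ := ENNReal.ofReal_ne_top

theorem weight_ne_zero (l : RatioSeq) (p t : ℝ) (n : ℕ) : weight l p t n ≠ 0 :=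
  (ENNReal.ofReal_pos.2 (Real.rpow_pos_of_pos (phiAt_pos l p n) _)).ne'

theorem weight_succ (l : RatioSeq) (p t : ℝ) (n : ℕ) :
    weight l p t (n + 1) = ENNReal.ofReal (growth l p n ^ t) * weight l p t n := by
  have h1 := growth_pos l p n
  have h2 := phiAt_pos l p (n + 1)
  rw [weight, weight, ← ENNReal.ofReal_mul (Real.rpow_nonneg h1.le _), phiAt_succ l p n,
    Real.mul_rpow h1.le h2.le, ← mul_assoc, ← Real.rpow_add h1, add_neg_cancel, Real.rpow_zero,
    one_mul]

/-- The quotient `φ(ρ_n) / φ(ρ_{n+1})` is at least `3 ^ (p - 1)`; the lower bound `t₀` makes the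
ratio independent of `t`. -/
theorem weight_le_succ (l : RatioSeq) {p : ℝ} (hp : 1 < p) {t₀ t : ℝ} (h0 : 0 ≤ t₀) (ht : t₀ ≤ t)
    (n : ℕ) :
    weight l p t n ≤ ENNReal.ofReal ((3 : ℝ) ^ (-((p - 1) * t₀))) * weight l p t (n + 1) := by
  rw [weight_succ, ← mul_assoc, ← ENNReal.ofReal_mul (by positivity)]
  refine le_mul_of_one_le_left' ?_
  rw [ENNReal.one_le_ofReal, Real.rpow_neg (by norm_num), ← div_eq_inv_mul,
    one_le_div (by positivity), Real.rpow_mul (by norm_num)]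
  calc _ ≤ growth l p n ^ t₀ :=
        Real.rpow_le_rpow (by positivity) (three_rpow_le_growth l hp n) h0
    _ ≤ _ := Real.rpow_le_rpow_of_exponent_le (one_le_growth l hp n) ht

theorem weight_succ_le {l : RatioSeq} {L : ℕ} (hL : ∀ k, l.ratio k ≤ L) {p : ℝ} (hp : 1 < p)
    {t t₁ : ℝ} (h0 : 0 ≤ t) (ht : t ≤ t₁) (n : ℕ) :
    weight l p t (n + 1) ≤
      ENNReal.ofReal (((L : ℝ) ^ (p - 1) * (2 * L)) ^ t₁) * weight l p t n := by
  rw [weight_succ]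
  refine mul_le_mul_left (ENNReal.ofReal_le_ofReal ?_) _
  have h1 := one_le_growth l hp n
  calc growth l p n ^ t ≤ ((L : ℝ) ^ (p - 1) * (2 * L)) ^ t :=
        Real.rpow_le_rpow (by linarith) (growth_le hL hp n) h0
    _ ≤ _ := Real.rpow_le_rpow_of_exponent_le (h1.trans (growth_le hL hp n)) ht

/-- The origin of the threshold: division by the number of words costs a factor `2 l - 1` per level,
and the weight outgrows it once `(p + 1) * t₀ > 2`. The condition `t₀ ≤ 1` allows the use of `2 l -
1 ≤ l ^ 2` with the exponent `1 - t₀`. -/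
theorem weight_mul_inv_numWords_le (l : RatioSeq) {p : ℝ} (hp : 1 < p) {t₀ t : ℝ}
    (h0 : 2 / (p + 1) ≤ t₀) (h1 : t₀ ≤ 1) (ht : t₀ ≤ t) (n : ℕ) :
    weight l p t n * (numWords l n : ℝ≥0∞)⁻¹ ≤
      ENNReal.ofReal ((3 : ℝ) ^ (-((p + 1) * t₀ - 2))) *
        (weight l p t (n + 1) * (numWords l (n + 1) : ℝ≥0∞)⁻¹) := by
  set b : ℝ := 2 * l.ratio n - 1 with hb
  set a : ℝ := ((l.ratio n : ℕ) : ℝ) with ha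
  have ha3 : 3 ≤ a := three_le_ratio l n
  have hb1 : 1 ≤ b := by linarith
  have hba : b ≤ a ^ (2 : ℝ) := by
    rw [Real.rpow_two]; nlinarith
  have h0' : 2 ≤ (p + 1) * t₀ := by
    rw [div_le_iff₀ (by linarith)] at h0; linarith
  have hreal : b ≤ (3 : ℝ) ^ (-((p + 1) * t₀ - 2)) * growth l p n ^ t := by
    -- One part of the cost is absorbed by the growth factor itself, the other is turned into a
    -- power of `l`: the exponents combine as `2 * (1 - t₀) = (p - 1) * t₀ - ((p + 1) * t₀ - 2)`.
    calc b = b ^ (1 - t₀) * b ^ t₀ := by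
          rw [← Real.rpow_add (by linarith)]; simp
      _ ≤ (a ^ (2 : ℝ)) ^ (1 - t₀) * b ^ t₀ := by
          gcongr
      _ = a ^ (-((p + 1) * t₀ - 2)) * (a ^ (p - 1) * b) ^ t₀ := by
          rw [Real.mul_rpow (by positivity) (by linarith), ← mul_assoc, ← Real.rpow_mul (by linarith),
            ← Real.rpow_mul (by linarith), ← Real.rpow_add (by linarith)]
          congr 2; ring
      _ ≤ (3 : ℝ) ^ (-((p + 1) * t₀ - 2)) * (a ^ (p - 1) * b) ^ t₀ := by
          refine mul_le_mul_of_nonneg_right ?_ (by positivity)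
          exact Real.rpow_le_rpow_of_nonpos (by norm_num) ha3 (by linarith)
      _ ≤ _ := by
          refine mul_le_mul_of_nonneg_left ?_ (by positivity)
          exact Real.rpow_le_rpow_of_exponent_le (one_le_growth l hp n) ht
  have hN : (numWords l n : ℝ≥0∞)⁻¹ = ENNReal.ofReal b * (numWords l (n + 1) : ℝ≥0∞)⁻¹ := by
    have hbn : ENNReal.ofReal b = ((2 * l.ratio n - 1 : ℕ) : ℝ≥0∞) := by
      rw [hb, ha, ← two_ratio_sub_one, ENNReal.ofReal_natCast]
    have hb0 : ((2 * l.ratio n - 1 : ℕ) : ℝ≥0∞) ≠ 0 := by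
      rw [← hbn]; exact (ENNReal.ofReal_pos.2 (by linarith)).ne'
    rw [numWords_succ, Nat.cast_mul, hbn,
      ENNReal.mul_inv (Or.inr (ENNReal.natCast_ne_top _)) (Or.inl (ENNReal.natCast_ne_top _)),
      mul_left_comm, ENNReal.mul_inv_cancel hb0 (ENNReal.natCast_ne_top _), mul_one]
  rw [hN, weight_succ]
  calc _ = ENNReal.ofReal b * (weight l p t n * (numWords l (n + 1) : ℝ≥0∞)⁻¹) := by ring
    _ ≤ ENNReal.ofReal ((3 : ℝ) ^ (-((p + 1) * t₀ - 2)) * growth l p n ^ t) *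
        (weight l p t n * (numWords l (n + 1) : ℝ≥0∞)⁻¹) :=
        mul_le_mul_left (ENNReal.ofReal_le_ofReal hreal) _
    _ = _ := by rw [ENNReal.ofReal_mul (by positivity)]; ring

theorem ofReal_three_rpow_neg_lt_one {s : ℝ} (hs : 0 < s) : ENNReal.ofReal ((3 : ℝ) ^ (-s)) < 1 := by
  rw [ENNReal.ofReal_lt_one]
  exact Real.rpow_lt_one_of_one_lt_of_neg (by norm_num) (by linarith)

/-! ### Discrete energies against averaged increments -/

theorem exists_meanInt_le {l : RatioSeq} {L : ℕ} (hL : ∀ k, l.ratio k ≤ L) {p : ℝ} (hp : 1 < p)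
    {t₀ : ℝ} (h0 : 0 < t₀) :
    ∃ K : ℝ≥0, ∀ t, t₀ ≤ t → ∀ u : vicsek l → ℝ, Continuous u →
      (⨆ n, weight l p t n * meanInt l p u n) ≤ K * (⨆ n, weight l p t n * meanEnergy l p u n) ∧
      (∑' n, weight l p t n * meanInt l p u n) ≤ K * ∑' n, weight l p t n * meanEnergy l p u n := by
  obtain ⟨C, hC⟩ := doubleInt_rpow_le hL hp.le
  obtain ⟨K, hK⟩ := exists_weighted_le hp
    (ofReal_three_rpow_neg_lt_one (mul_pos (by linarith : 0 < p - 1) h0)) C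
  exact ⟨K, fun t ht u hu => hK _ _ _ (fun n => weight_le_succ l hp h0.le ht n) (hC u hu)⟩

theorem weight_mul_meanEnergy_le_succ {l : RatioSeq} {L : ℕ} (hL : ∀ k, l.ratio k ≤ L) {p : ℝ}
    (hp : 1 < p) {t : ℝ} (h0 : 0 ≤ t) (u : vicsek l → ℝ) (n : ℕ) :
    weight l p t n * meanEnergy l p u n ≤ (2 * L : ℕ) * ENNReal.ofReal ((L : ℝ) ^ (p - 1)) *
      (weight l p t (n + 1) * meanEnergy l p u (n + 1)) := by
  have h1 : weight l p t n ≤ weight l p t (n + 1) := by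
    simpa using weight_le_succ l hp le_rfl h0 n
  calc _ ≤ weight l p t (n + 1) * _ := mul_le_mul' h1 (meanEnergy_le_succ hL hp.le u n)
    _ = _ := by ring

/-- The right side starts at level `1`, since radii in the shell below `rho l n` control the double
integral only at radius `rho l (n + 1)`. Telescoping loses another level, so it applies to the
discrete energies from level `2` on. -/
theorem exists_meanEnergy_le {l : RatioSeq} {L : ℕ} (hL : ∀ k, l.ratio k ≤ L) {p : ℝ} (hp : 1 < p)
    {t₀ : ℝ} (t₁ : ℝ) (h0 : 2 / (p + 1) < t₀) (h1 : t₀ ≤ 1) :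
    ∃ K : ℝ≥0, ∀ t, t₀ ≤ t → t ≤ t₁ → ∀ u : vicsek l → ℝ, Continuous u →
      (⨆ n, weight l p t n * meanEnergy l p u n) ≤
        K * (⨆ n, weight l p t (n + 1) * meanInt l p u (n + 1)) ∧
      (∑' n, weight l p t n * meanEnergy l p u n) ≤
        K * ∑' n, weight l p t (n + 1) * meanInt l p u (n + 1) := by
  have hp0 : 0 < p + 1 := by linarith
  have ht0 : 0 < t₀ := lt_trans (by positivity) h0
  have h0' : 0 < (p + 1) * t₀ - 2 := by
    rw [div_lt_iff₀ hp0] at h0; linarith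
  obtain ⟨C, hC⟩ := edgeSum_rpow_le hL hp
  obtain ⟨K, hK⟩ := exists_weighted_le hp (ofReal_three_rpow_neg_lt_one h0') C
  obtain ⟨D, hD⟩ : ∃ D : ℝ≥0, D = (2 * L : ℕ) * Real.toNNReal ((L : ℝ) ^ (p - 1)) := ⟨_, rfl⟩
  set Q : ℝ≥0 := Real.toNNReal (((L : ℝ) ^ (p - 1) * (2 * L)) ^ t₁) with hQ
  -- The three summands pay for levels `0`, `1` and the rest; the first two levels are bounded by
  -- level `2` through subdivision.
  refine ⟨(D * (D * 1) + D * 1 + 1) * (Q * K), fun t ht ht' u hu => ?_⟩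
  set X := fun n => weight l p t n * meanEnergy l p u n with hX
  have hX1 : ∀ n, X n ≤ D * X (n + 1) := fun n => by
    rw [hD, ENNReal.coe_mul]
    exact weight_mul_meanEnergy_le_succ hL hp (ht0.le.trans ht) u n
  have hZ : ∀ n, X (n + 2) ≤ Q * ((weight l p t (n + 1) * (numWords l (n + 1) : ℝ≥0∞)⁻¹) *
      edgeSum l p (n + 2) u) := by
    intro n
    have e1 := weight_succ_le hL hp (ht0.le.trans ht) ht' (n + 1)
    have e2 : (numWords l (n + 1 + 1) : ℝ≥0∞)⁻¹ ≤ (numWords l (n + 1) : ℝ≥0∞)⁻¹ := by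
      rw [ENNReal.inv_le_inv, numWords_succ l (n + 1)]
      have := l.three_le (n + 1)
      exact_mod_cast Nat.le_mul_of_pos_right _ (by omega)
    calc X (n + 2) ≤ _ * (_ * _) := mul_le_mul' e1 (mul_le_mul_left e2 _)
      _ = _ := by rw [hQ]; simp only [ENNReal.ofReal]; ring
  obtain ⟨hs, ht⟩ := hK (fun n => weight l p t (n + 1) * (numWords l (n + 1) : ℝ≥0∞)⁻¹)
    (fun n => edgeSum l p (n + 2) u) (fun n => cellEnergy l p u (n + 1))
    (fun n => weight_mul_inv_numWords_le l hp h0.le h1 ht (n + 1))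
    (fun n => by
      refine (hC u hu (n + 1)).trans_eq ?_
      simp only [add_right_comm])
  have hY : ∀ n, weight l p t (n + 1) * (numWords l (n + 1) : ℝ≥0∞)⁻¹ * cellEnergy l p u (n + 1) =
      weight l p t (n + 1) * meanInt l p u (n + 1) := by
    intro n
    rw [cellEnergy, meanInt, mul_assoc, sq, ← mul_assoc (_⁻¹), ← mul_assoc (_⁻¹),
      ENNReal.inv_mul_cancel (numWords_ne_zero l _) (ENNReal.natCast_ne_top _), one_mul]
  simp only [hY] at hs ht
  have hs' : (⨆ n, X (n + 2)) ≤
      ((Q * K : ℝ≥0) : ℝ≥0∞) * ⨆ n, weight l p t (n + 1) * meanInt l p u (n + 1) := by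
    rw [ENNReal.coe_mul, mul_assoc]
    refine le_trans (iSup_mono hZ) ?_
    rw [← ENNReal.mul_iSup]
    exact mul_le_mul_right hs _
  have ht' : (∑' n, X (n + 2)) ≤
      ((Q * K : ℝ≥0) : ℝ≥0∞) * ∑' n, weight l p t (n + 1) * meanInt l p u (n + 1) := by
    rw [ENNReal.coe_mul, mul_assoc]
    refine le_trans (ENNReal.tsum_le_tsum hZ) ?_
    rw [ENNReal.tsum_mul_left]
    exact mul_le_mul_right ht _
  have hfin : ∀ b : ℝ≥0∞, X 2 ≤ b → X 0 ≤ D * (D * b) ∧ X 1 ≤ D * b := fun b hb =>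
    ⟨(hX1 0).trans (mul_le_mul_right ((hX1 1).trans (mul_le_mul_right hb _)) _),
      (hX1 1).trans (mul_le_mul_right hb _)⟩
  have hc : ((D * (D * 1) + D * 1 + 1 : ℝ≥0) : ℝ≥0∞) * ((Q * K : ℝ≥0) : ℝ≥0∞) =
      (((D * (D * 1) + D * 1 + 1) * (Q * K) : ℝ≥0) : ℝ≥0∞) := by push_cast; rfl
  rw [← hc, mul_assoc, mul_assoc]
  constructor
  · refine le_trans ?_ (mul_le_mul_right hs' _)
    set b := ⨆ n, X (n + 2)
    obtain ⟨e0, e1⟩ := hfin b (le_iSup (fun n => X (n + 2)) 0)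
    have hexp : ((D * (D * 1) + D * 1 + 1 : ℝ≥0) : ℝ≥0∞) * b = D * (D * b) + D * b + b := by
      push_cast; ring
    rw [hexp]
    refine iSup_le fun n => ?_
    rcases n with _ | _ | n
    · exact e0.trans (le_self_add.trans le_self_add)
    · exact e1.trans (le_add_self.trans le_self_add)
    · exact (le_iSup (fun n => X (n + 2)) n).trans le_add_self
  · refine le_trans ?_ (mul_le_mul_right ht' _)
    set b := ∑' n, X (n + 2)
    obtain ⟨e0, e1⟩ := hfin b (ENNReal.le_tsum (f := fun n => X (n + 2)) 0)
    have hexp : ((D * (D * 1) + D * 1 + 1 : ℝ≥0) : ℝ≥0∞) * b = D * (D * b) + D * b + b := by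
      push_cast; ring
    have hsum : (∑' n, X n) = X 0 + X 1 + b := by
      rw [tsum_eq_zero_add' ENNReal.summable, tsum_eq_zero_add' ENNReal.summable, ← add_assoc]
    rw [hexp]
    refine hsum.trans_le ?_
    gcongr

/-! ### Comparison of the Besov seminorms with the discrete energies -/

theorem besovNormInf_rpow (l : RatioSeq) {p : ℝ} (hp : 0 < p) (βs β : ℝ) (u : vicsek l → ℝ) :
    besovNormInf l p βs β u ^ p = ⨆ r ∈ radii l, Phi l p βs β u r := by
  rw [besovNormInf, ← ENNReal.orderIsoRpow_apply p hp]
  simp only [OrderIso.map_iSup, ENNReal.orderIsoRpow_apply]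
  simp only [← ENNReal.rpow_mul, one_div_mul_cancel hp.ne', ENNReal.rpow_one]

theorem besovNorm_rpow (l : RatioSeq) {p : ℝ} (hp : 0 < p) (βs β : ℝ) (u : vicsek l → ℝ) :
    besovNorm l p p βs β u ^ p = ∫⁻ r in radii l, Phi l p βs β u r / ENNReal.ofReal r := by
  rw [besovNorm, ← ENNReal.rpow_mul, one_div_mul_cancel hp.ne', ENNReal.rpow_one, div_self hp.ne']
  simp only [ENNReal.rpow_one]

theorem iSup_Phi_le {l : RatioSeq} {L : ℕ} (hL : ∀ k, l.ratio k ≤ L) (p βs β : ℝ)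
    (u : vicsek l → ℝ) :
    (⨆ r ∈ radii l, Phi l p βs β u r) ≤
      (2 * L : ℕ) * ⨆ n, weight l p (β / βs) n * meanInt l p u n := by
  refine iSup₂_le fun r hr => ?_
  obtain ⟨n, h1, h2⟩ := mem_radii_iff.1 hr
  refine (Phi_le hL p βs β u h1 h2).trans (mul_le_mul_right ?_ _)
  exact le_iSup (fun n => weight l p (β / βs) n * meanInt l p u n) n

theorem weight_mul_meanInt_succ_le {l : RatioSeq} {L : ℕ} (hL : ∀ k, l.ratio k ≤ L) {p : ℝ}
    (hp : 1 < p) {βs β t₁ : ℝ} (h0 : 0 ≤ β / βs) (ht : β / βs ≤ t₁) (u : vicsek l → ℝ) {n : ℕ}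
    {r : ℝ} (h1 : rho l (n + 1) < r) (h2 : r ≤ rho l n) :
    weight l p (β / βs) (n + 1) * meanInt l p u (n + 1) ≤
      (ENNReal.ofReal (((L : ℝ) ^ (p - 1) * (2 * L)) ^ t₁) * (2 * L : ℕ) * (18 * L : ℕ)) *
        Phi l p βs β u r := by
  calc _ ≤ (ENNReal.ofReal (((L : ℝ) ^ (p - 1) * (2 * L)) ^ t₁) * weight l p (β / βs) n) *
        (((2 * L : ℕ) * numWords l n) * doubleInt l p u r) :=
        mul_le_mul' (weight_succ_le hL hp h0 ht n)
          (mul_le_mul' (numWords_succ_le hL n) (doubleInt_mono l p u h1.le))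
    _ = ENNReal.ofReal (((L : ℝ) ^ (p - 1) * (2 * L)) ^ t₁) * (2 * L : ℕ) *
        (weight l p (β / βs) n * (numWords l n * doubleInt l p u r)) := by ring
    _ ≤ _ := by
        rw [mul_assoc _ ((18 * L : ℕ) : ℝ≥0∞)]
        exact mul_le_mul_right (le_Phi hL p βs β u h1 h2) _

theorem volume_shell (l : RatioSeq) (n : ℕ) :
    volume (Ioc (rho l (n + 1)) (rho l n)) = ENNReal.ofReal (rho l n - rho l (n + 1)) :=
  Real.volume_Ioc

theorem lintegral_Phi_le {l : RatioSeq} {L : ℕ} (hL : ∀ k, l.ratio k ≤ L) (p βs β : ℝ)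
    (u : vicsek l → ℝ) :
    (∫⁻ r in radii l, Phi l p βs β u r / ENNReal.ofReal r) ≤
      ((2 * L : ℕ) * L) * ∑' n, weight l p (β / βs) n * meanInt l p u n := by
  rw [lintegral_radii, ← ENNReal.tsum_mul_left]
  refine ENNReal.tsum_le_tsum fun n => ?_
  have hr := rho_pos l (n + 1)
  calc _ ≤ ∫⁻ _ in Ioc (rho l (n + 1)) (rho l n),
        (2 * L : ℕ) * (weight l p (β / βs) n * meanInt l p u n) / ENNReal.ofReal (rho l (n + 1)) := by
        refine setLIntegral_mono' measurableSet_Ioc fun r hr => ?_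
        exact ENNReal.div_le_div (Phi_le hL p βs β u hr.1 hr.2) (ENNReal.ofReal_le_ofReal hr.1.le)
    _ = (2 * L : ℕ) * (weight l p (β / βs) n * meanInt l p u n) *
        (ENNReal.ofReal (rho l n - rho l (n + 1)) / ENNReal.ofReal (rho l (n + 1))) := by
        rw [setLIntegral_const, volume_shell]
        simp only [div_eq_mul_inv]; ring
    _ ≤ (2 * L : ℕ) * (weight l p (β / βs) n * meanInt l p u n) * L := by
        refine mul_le_mul_right ?_ _
        refine ENNReal.div_le_of_le_mul ?_
        rw [← ENNReal.ofReal_natCast, ← ENNReal.ofReal_mul (by positivity)]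
        exact ENNReal.ofReal_le_ofReal (by linarith [rho_le hL n])
    _ = _ := by ring

theorem tsum_meanInt_succ_le {l : RatioSeq} {L : ℕ} (hL : ∀ k, l.ratio k ≤ L) {p : ℝ} (hp : 1 < p)
    {βs β t₁ : ℝ} (h0 : 0 ≤ β / βs) (ht : β / βs ≤ t₁) (u : vicsek l → ℝ) :
    (∑' n, weight l p (β / βs) (n + 1) * meanInt l p u (n + 1)) ≤
      (2 * (ENNReal.ofReal (((L : ℝ) ^ (p - 1) * (2 * L)) ^ t₁) * (2 * L : ℕ) * (18 * L : ℕ))) *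
        ∫⁻ r in radii l, Phi l p βs β u r / ENNReal.ofReal r := by
  rw [lintegral_radii, ← ENNReal.tsum_mul_left]
  refine ENNReal.tsum_le_tsum fun n => ?_
  set K := ENNReal.ofReal (((L : ℝ) ^ (p - 1) * (2 * L)) ^ t₁) * (2 * L : ℕ) * (18 * L : ℕ) with hK
  have hKt : K ≠ ∞ := ENNReal.mul_ne_top
    (ENNReal.mul_ne_top ENNReal.ofReal_ne_top (ENNReal.natCast_ne_top _)) (ENNReal.natCast_ne_top _)
  set Y := weight l p (β / βs) (n + 1) * meanInt l p u (n + 1) with hY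
  have hr := rho_pos l n
  have h3 := three_mul_rho_le l n
  -- As `3 * rho l (n + 1) ≤ rho l n`, each shell has length at least half its outer radius.
  calc Y = 2 * (Y * (1 / 2)) := by
        rw [mul_left_comm, one_div, ENNReal.mul_inv_cancel (by norm_num) (by norm_num), mul_one]
    _ ≤ 2 * (Y / ENNReal.ofReal (rho l n) * ENNReal.ofReal (rho l n - rho l (n + 1))) := by
        refine mul_le_mul_right ?_ _
        rw [div_eq_mul_inv Y, mul_assoc Y]
        refine mul_le_mul_right ?_ _
        rw [← ENNReal.ofReal_inv_of_pos hr, ← ENNReal.ofReal_mul (by positivity)]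
        have e : (1 / 2 : ℝ≥0∞) = ENNReal.ofReal (1 / 2) := by
          rw [ENNReal.ofReal_div_of_pos two_pos]; simp
        rw [e]
        refine ENNReal.ofReal_le_ofReal ?_
        rw [← div_eq_inv_mul, le_div_iff₀ hr]
        linarith
    _ = 2 * ∫⁻ _ in Ioc (rho l (n + 1)) (rho l n), Y / ENNReal.ofReal (rho l n) := by
        rw [setLIntegral_const, volume_shell]
    _ ≤ 2 * ∫⁻ r in Ioc (rho l (n + 1)) (rho l n), K * (Phi l p βs β u r / ENNReal.ofReal r) := by
        refine mul_le_mul_right (setLIntegral_mono' measurableSet_Ioc fun r hr => ?_) _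
        rw [← mul_div_assoc]
        exact ENNReal.div_le_div (weight_mul_meanInt_succ_le hL hp h0 ht u hr.1 hr.2)
          (ENNReal.ofReal_le_ofReal hr.2)
    _ = _ := by rw [lintegral_const_mul' _ _ hKt, ← mul_assoc]

theorem besovEnergyAt_eq (l : RatioSeq) (p βs β : ℝ) (n : ℕ) (u : vicsek l → ℝ) :
    besovEnergyAt l p βs β n u = 2⁻¹ * (weight l p (β / βs) n * meanEnergy l p u n) := by
  have hN : (0 : ℝ) < numWords l n := by exact_mod_cast numWords_pos l n
  have hf := Real.rpow_pos_of_pos (phiAt_pos l p n) (-(β / βs))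
  rw [besovEnergyAt, psi_rho, phi_eq p (rho_succ_lt l n) le_rfl, meanEnergy, weight,
    ENNReal.ofReal_mul (by positivity), ENNReal.ofReal_mul (by positivity),
    ENNReal.ofReal_inv_of_pos hN, ENNReal.ofReal_natCast, one_div,
    ENNReal.ofReal_inv_of_pos two_pos, ENNReal.ofReal_ofNat]
  ring

theorem energyInf_eq (l : RatioSeq) (p βs β : ℝ) (u : vicsek l → ℝ) :
    energyInf l p βs β u = 2⁻¹ * ⨆ n, weight l p (β / βs) n * meanEnergy l p u n := by
  simp only [energyInf, besovEnergyAt_eq, ENNReal.mul_iSup]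

theorem energySum_eq (l : RatioSeq) (p βs β : ℝ) (u : vicsek l → ℝ) :
    energySum l p βs β u = 2⁻¹ * ∑' n, weight l p (β / βs) n * meanEnergy l p u n := by
  simp only [energySum, besovEnergyAt_eq, ENNReal.tsum_mul_left]

/-- The seminorms and the discrete energies are comparable, uniformly in `β / β*`. -/
theorem exists_besov_comparison {l : RatioSeq} {L : ℕ} (hL : ∀ k, l.ratio k ≤ L) {p : ℝ}
    (hp : 1 < p) {t₀ : ℝ} (t₁ : ℝ) (h0 : 2 / (p + 1) < t₀) (h1 : t₀ ≤ 1) :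
    ∃ C : ℝ≥0, 1 ≤ C ∧ ∀ βs β, t₀ ≤ β / βs → β / βs ≤ t₁ → ∀ u : vicsek l → ℝ, Continuous u →
      besovNormInf l p βs β u ^ p ≤ C * energyInf l p βs β u ∧
      energyInf l p βs β u ≤ C * besovNormInf l p βs β u ^ p ∧
      besovNorm l p p βs β u ^ p ≤ C * energySum l p βs β u ∧
      energySum l p βs β u ≤ C * besovNorm l p p βs β u ^ p := by
  have hp0 : 0 < p := by linarith
  have ht0 : 0 < t₀ := lt_trans (by positivity) h0
  obtain ⟨K₁, hK₁⟩ := exists_meanInt_le hL hp ht0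
  obtain ⟨K₂, hK₂⟩ := exists_meanEnergy_le hL hp t₁ h0 h1
  obtain ⟨Q, hQ⟩ : ∃ Q : ℝ≥0, (Q : ℝ≥0∞) =
      ENNReal.ofReal (((L : ℝ) ^ (p - 1) * (2 * L)) ^ t₁) * (2 * L : ℕ) * (18 * L : ℕ) := by
    refine ⟨Real.toNNReal (((L : ℝ) ^ (p - 1) * (2 * L)) ^ t₁) * (2 * L : ℕ) * (18 * L : ℕ), ?_⟩
    push_cast; rfl
  -- The factor `L + 1` serves the supremum and the integral at once, and the last `2` undoes the
  -- factor one half in the discrete energies.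
  set A : ℝ≥0 := (2 * L : ℕ) * (L + 1) * K₁ * 2 with hA
  set B : ℝ≥0 := 2 * K₂ * Q with hB
  refine ⟨A + B + 1, le_add_self, fun βs β ht ht' u hu => ?_⟩
  obtain ⟨a1, a2⟩ := hK₁ _ ht u hu
  obtain ⟨b1, b2⟩ := hK₂ _ ht ht' u hu
  have hAC : (A : ℝ≥0∞) ≤ ((A + B + 1 : ℝ≥0) : ℝ≥0∞) := by
    exact_mod_cast le_self_add.trans le_self_add
  have hBC : (B : ℝ≥0∞) ≤ ((A + B + 1 : ℝ≥0) : ℝ≥0∞) := by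
    exact_mod_cast le_add_self.trans le_self_add
  have two : ∀ x : ℝ≥0∞, x = 2 * (2⁻¹ * x) := fun x => by
    rw [← mul_assoc, ENNReal.mul_inv_cancel (by norm_num) (by norm_num), one_mul]
  have half : ∀ x : ℝ≥0∞, 2⁻¹ * x ≤ x := fun x => by
    refine mul_le_of_le_one_left' ?_
    rw [ENNReal.inv_le_one]; norm_num
  have hLA : ((2 * L : ℕ) : ℝ≥0∞) ≤ (2 * L : ℕ) * (L + 1) := le_mul_of_one_le_right' le_add_self
  have hLA2 : ((2 * L : ℕ) * L : ℝ≥0∞) ≤ (2 * L : ℕ) * (L + 1) := mul_le_mul_right le_self_add _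
  rw [besovNormInf_rpow l hp0, besovNorm_rpow l hp0, energyInf_eq, energySum_eq]
  refine ⟨?_, ?_, ?_, ?_⟩
  · refine (iSup_Phi_le hL p βs β u).trans (le_trans ?_ (mul_le_mul_left hAC _))
    calc _ ≤ ((2 * L : ℕ) * (L + 1) : ℝ≥0∞) *
          (K₁ * ⨆ n, weight l p (β / βs) n * meanEnergy l p u n) := mul_le_mul' hLA a1
      _ = _ := by
        conv_lhs => rw [two (⨆ n, weight l p (β / βs) n * meanEnergy l p u n)]
        rw [hA]
        push_cast; ring
  · refine (half _).trans (b1.trans (le_trans ?_ (mul_le_mul_left hBC _)))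
    have : (⨆ n, weight l p (β / βs) (n + 1) * meanInt l p u (n + 1)) ≤
        Q * ⨆ r ∈ radii l, Phi l p βs β u r := by
      refine iSup_le fun n => ?_
      rw [hQ]
      refine (weight_mul_meanInt_succ_le hL hp (ht0.le.trans ht) ht' u (rho_succ_lt l n) le_rfl).trans
        (mul_le_mul_right ?_ _)
      exact le_iSup₂ (f := fun r _ => Phi l p βs β u r) (rho l n)
        (mem_radii_iff.2 ⟨n, rho_succ_lt l n, le_rfl⟩)
    refine (mul_le_mul_right this _).trans ?_
    rw [← mul_assoc]
    refine mul_le_mul_left ?_ _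
    rw [hB, mul_assoc]
    push_cast
    exact le_mul_of_one_le_left' (by norm_num)
  · refine (lintegral_Phi_le hL p βs β u).trans (le_trans ?_ (mul_le_mul_left hAC _))
    calc _ ≤ ((2 * L : ℕ) * (L + 1) : ℝ≥0∞) *
          (K₁ * ∑' n, weight l p (β / βs) n * meanEnergy l p u n) := mul_le_mul' hLA2 a2
      _ = _ := by
        conv_lhs => rw [two (∑' n, weight l p (β / βs) n * meanEnergy l p u n)]
        rw [hA]
        push_cast; ring
  · refine (half _).trans (b2.trans (le_trans ?_ (mul_le_mul_left hBC _)))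
    refine (mul_le_mul_right (tsum_meanInt_succ_le hL hp (ht0.le.trans ht) ht' u) _).trans_eq ?_
    rw [← hQ, hB]; push_cast; ring

/-! ### Embedding of the Besov spaces -/

theorem memLp_of_continuous {l : RatioSeq} {u : vicsek l → ℝ} (hu : Continuous u) (q : ℝ≥0∞) :
    MemLp u q (mu l) :=
  hu.memLp_of_hasCompactSupport (HasCompactSupport.of_compactSpace u)

/-- The integral over radii controls only levels from `1` on; level `0` is finite for every function
in `L^p`. -/
theorem doubleInt_ne_top {l : RatioSeq} {p : ℝ} (hp : 1 ≤ p) {u : vicsek l → ℝ}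
    (hu : MemLp u (ENNReal.ofReal p) (mu l)) (r : ℝ) : doubleInt l p u r ≠ ∞ := by
  have hp0 : 0 < p := by linarith
  have hI : ∫⁻ x, ENNReal.ofReal (|u x - 0| ^ p) ∂mu l < ∞ := by
    have h := lintegral_rpow_enorm_lt_top_of_eLpNorm_lt_top (by simpa using hp0)
      ENNReal.ofReal_ne_top hu.2
    simpa only [ofReal_abs_rpow hp0.le, sub_zero, ENNReal.toReal_ofReal hp0.le] using h
  set I := ∫⁻ x, ENNReal.ofReal (|u x - 0| ^ p) ∂mu l with hIdef
  refine ne_top_of_le_ne_top (b := ENNReal.ofReal ((2 : ℝ) ^ (p - 1)) * (I + I))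
    (ENNReal.mul_ne_top ENNReal.ofReal_ne_top (ENNReal.add_ne_top.2 ⟨hI.ne, hI.ne⟩)) ?_
  have h1 : ∀ x, ∫⁻ y in Metric.ball x r, ENNReal.ofReal (|u x - u y| ^ p) ∂mu l ≤
      ENNReal.ofReal ((2 : ℝ) ^ (p - 1)) * (ENNReal.ofReal (|u x - 0| ^ p) + I) := by
    intro x
    calc _ ≤ ∫⁻ y, ENNReal.ofReal (|u x - u y| ^ p) ∂mu l := setLIntegral_le_lintegral _ _
      _ ≤ ∫⁻ y, ENNReal.ofReal ((2 : ℝ) ^ (p - 1)) *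
          (ENNReal.ofReal (|u x - 0| ^ p) + ENNReal.ofReal (|u y - 0| ^ p)) ∂mu l := by
          refine lintegral_mono fun y => ?_
          have := ofReal_rpow_sub_le hp (u x) 0 (u y)
          rwa [abs_sub_comm 0 (u y)] at this
      _ = _ := by
          rw [lintegral_const_mul' _ _ ENNReal.ofReal_ne_top, lintegral_add_left measurable_const,
            lintegral_const, measure_univ, mul_one]
  calc doubleInt l p u r ≤ _ := lintegral_mono h1
    _ = _ := by
        rw [lintegral_const_mul' _ _ ENNReal.ofReal_ne_top, lintegral_add_right _ measurable_const,
          lintegral_const, measure_univ, mul_one]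

theorem besov_subset_besovInf {l : RatioSeq} {L : ℕ} (hL : ∀ k, l.ratio k ≤ L) {p : ℝ} (hp : 1 < p)
    {βs β : ℝ} (h0 : 0 ≤ β / βs) : besov l p p βs β ⊆ besovInf l p βs β := by
  rintro u ⟨hu, hn⟩
  have hp0 : 0 < p := by linarith
  refine ⟨hu, ?_⟩
  have h1 := ENNReal.rpow_lt_top_of_nonneg hp0.le hn.ne
  rw [besovNorm_rpow l hp0] at h1
  have h2 := (tsum_meanInt_succ_le hL hp h0 le_rfl u).trans_lt (ENNReal.mul_lt_top
    (ENNReal.mul_lt_top (by norm_num) (ENNReal.mul_lt_top (ENNReal.mul_lt_top ENNReal.ofReal_lt_top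
      (ENNReal.natCast_lt_top _)) (ENNReal.natCast_lt_top _))) h1)
  have h3 : weight l p (β / βs) 0 * meanInt l p u 0 ≠ ∞ :=
    ENNReal.mul_ne_top (weight_ne_top l p _ 0)
      (ENNReal.mul_ne_top (ENNReal.natCast_ne_top _) (doubleInt_ne_top hp.le hu _))
  have h4 : besovNormInf l p βs β u ^ p < ∞ := by
    rw [besovNormInf_rpow l hp0]
    refine (iSup_Phi_le hL p βs β u).trans_lt (ENNReal.mul_lt_top (ENNReal.natCast_lt_top _) ?_)
    refine lt_of_le_of_lt (iSup_le fun n => ?_) (ENNReal.add_lt_top.2 ⟨h3.lt_top, h2⟩)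
    rcases n with _ | n
    · exact le_self_add
    · exact (ENNReal.le_tsum (f := fun n => weight l p (β / βs) (n + 1) * meanInt l p u (n + 1))
        n).trans le_add_self
  exact (ENNReal.rpow_lt_top_iff_of_pos hp0).1 h4

/-- A finite seminorm bounds the weighted `cellEnergy`, and beyond the threshold the weights grow
geometrically, so the `p`-th roots are summable. -/
theorem exists_continuous_of_mem_besovInf {l : RatioSeq} {L : ℕ} (hL : ∀ k, l.ratio k ≤ L) {p : ℝ}
    (hp : 1 < p) {βs β : ℝ} (ht : 2 / (p + 1) < β / βs) {u : vicsek l → ℝ}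
    (hu : u ∈ besovInf l p βs β) : ∃ v : C(vicsek l, ℝ), u =ᵐ[mu l] v := by
  have hp0 : 0 < p := by linarith
  have hp1 : 0 < 1 / p := by positivity
  obtain ⟨hu1, hu2⟩ := hu
  have hae := hu1.1.ae_eq_mk
  set v := hu1.1.mk u with hv
  have hvm : Measurable v := hu1.1.stronglyMeasurable_mk.measurable
  have hvi : Integrable v (mu l) :=
    ((memLp_congr_ae hae).1 hu1).integrable (by simpa using hp.le)
  suffices h : ∑' m, cellEnergy l p v m ^ (1 / p) ≠ ∞ by
    obtain ⟨w, hw⟩ := exists_continuous_of_tsum_ne_top hL hp hvm hvi h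
    exact ⟨w, hae.trans hw⟩
  have hM := ENNReal.rpow_lt_top_of_nonneg hp0.le hu2.ne
  rw [besovNormInf_rpow l hp0, Phi_congr p βs β hae] at hM
  have hY : ∀ n, weight l p (β / βs) n * (numWords l n : ℝ≥0∞)⁻¹ * cellEnergy l p v n ≤
      (18 * L : ℕ) * ⨆ r ∈ radii l, Phi l p βs β v r := by
    intro n
    have e : weight l p (β / βs) n * (numWords l n : ℝ≥0∞)⁻¹ * cellEnergy l p v n =
        weight l p (β / βs) n * (numWords l n * doubleInt l p v (rho l n)) := by
      rw [cellEnergy, mul_assoc, sq, ← mul_assoc (_⁻¹), ← mul_assoc (_⁻¹),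
        ENNReal.inv_mul_cancel (numWords_ne_zero l _) (ENNReal.natCast_ne_top _), one_mul]
    rw [e]
    refine (le_Phi hL p βs β v (rho_succ_lt l n) le_rfl).trans (mul_le_mul_right ?_ _)
    exact le_iSup₂ (f := fun r _ => Phi l p βs β v r) (rho l n)
      (mem_radii_iff.2 ⟨n, rho_succ_lt l n, le_rfl⟩)
  -- The growth estimate needs an exponent at most `1`; larger `β` is covered by truncation.
  have ht0 : 2 / (p + 1) < min (β / βs) 1 :=
    lt_min ht ((div_lt_one (by linarith)).2 (by linarith))
  have ht1 : 0 < (p + 1) * min (β / βs) 1 - 2 := by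
    rw [div_lt_iff₀ (by linarith)] at ht0; linarith
  obtain ⟨K, hK⟩ := exists_weighted_le hp (ofReal_three_rpow_neg_lt_one ht1) 1
  -- The weighted comparison applied with the tail sums themselves on the left and `C = 1`; its term
  -- `n = 0` is the required summability.
  have h := (hK _ (fun n => (∑' k, cellEnergy l p v (n + k) ^ (1 / p)) ^ p) (cellEnergy l p v)
    (fun n => weight_mul_inv_numWords_le l hp ht0.le (min_le_right _ _) (min_le_left _ _) n)
    (fun n => by
      rw [← ENNReal.rpow_mul, mul_one_div_cancel hp0.ne', ENNReal.rpow_one, ENNReal.coe_one,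
        one_mul])).1
  have h1 := (le_iSup (fun n => weight l p (β / βs) n * (numWords l n : ℝ≥0∞)⁻¹ *
    (∑' k, cellEnergy l p v (n + k) ^ (1 / p)) ^ p) 0).trans
    (h.trans (mul_le_mul_right (iSup_le hY) _))
  have h2 := h1.trans_lt (ENNReal.mul_lt_top ENNReal.coe_lt_top
    (ENNReal.mul_lt_top (ENNReal.natCast_lt_top _) hM))
  simp only [zero_add] at h2
  intro htop
  rw [htop, ENNReal.top_rpow_of_pos hp0, ENNReal.mul_top] at h2
  · exact lt_irrefl _ h2
  · exact mul_ne_zero (weight_ne_zero l p _ 0) (ENNReal.inv_ne_zero.2 (ENNReal.natCast_ne_top _))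

theorem besovNormInf_congr {l : RatioSeq} (p βs β : ℝ) {u v : vicsek l → ℝ} (h : u =ᵐ[mu l] v) :
    besovNormInf l p βs β u = besovNormInf l p βs β v := by
  rw [besovNormInf, besovNormInf, Phi_congr p βs β h]

theorem besovNorm_congr {l : RatioSeq} (p q βs β : ℝ) {u v : vicsek l → ℝ} (h : u =ᵐ[mu l] v) :
    besovNorm l p q βs β u = besovNorm l p q βs β v := by
  rw [besovNorm, besovNorm, Phi_congr p βs β h]

/-! ### Discrete energies as weighted `p`-energies -/

theorem prod_ratio_rpow (l : RatioSeq) (p : ℝ) (n : ℕ) :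
    ∏ k ∈ Finset.range n, (l.ratio k : ℝ) ^ (p - 1) =
      2 ^ (p - 1) * ((phiAt l p n)⁻¹ * (numWords l n : ℝ)⁻¹) := by
  have hN : (numWords l n : ℝ) ≠ 0 := by exact_mod_cast (numWords_pos l n).ne'
  have hs := Real.rpow_pos_of_pos (scale_pos l n) (p - 1)
  have h2 : (0 : ℝ) < 2 ^ (p - 1) := Real.rpow_pos_of_pos two_pos _
  have h1 : (∏ k ∈ Finset.range n, (l.ratio k : ℝ) ^ (p - 1)) = (scale l n ^ (p - 1))⁻¹ := by
    rw [Real.finsetProd_rpow _ _ fun k _ => Nat.cast_nonneg _, scale, Finset.prod_inv_distrib,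
      Real.inv_rpow (Finset.prod_nonneg fun k _ => Nat.cast_nonneg _), inv_inv]
  rw [h1, phiAt, rho, Real.mul_rpow two_pos.le (scale_pos l n).le]
  field_simp

/-- The normalising product of the `p`-energy is `2 ^ (p - 1) / (φ(ρ_n) * numWords l n)`. The
dependence on `β` is thereby isolated in a power of `φ(ρ_n)`. -/
theorem besovEnergyAt_eq_energyAt (l : RatioSeq) (p βs β : ℝ) (n : ℕ) (u : vicsek l → ℝ) :
    besovEnergyAt l p βs β n u = ENNReal.ofReal (phiAt l p n ^ (1 - β / βs)) *
      (ENNReal.ofReal (((2 : ℝ) ^ (p - 1))⁻¹) * energyAt l p n u) := by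
  have h2 : (0 : ℝ) < 2 ^ (p - 1) := Real.rpow_pos_of_pos two_pos _
  have hphi := phiAt_pos l p n
  have hf := Real.rpow_nonneg hphi.le (1 - β / βs)
  rw [besovEnergyAt, energyAt, psi_rho, phi_eq p (rho_succ_lt l n) le_rfl, prod_ratio_rpow,
    ← mul_assoc, ← mul_assoc, ← ENNReal.ofReal_mul hf, ← ENNReal.ofReal_mul (by positivity)]
  congr 2
  rw [Real.rpow_sub hphi, Real.rpow_one, Real.rpow_neg hphi.le]
  field_simp

theorem energyInf_self (l : RatioSeq) (p : ℝ) {βs : ℝ} (h : βs ≠ 0) (u : vicsek l → ℝ) :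
    energyInf l p βs βs u = ENNReal.ofReal (((2 : ℝ) ^ (p - 1))⁻¹) * energy l p u := by
  simp only [energyInf, energy, besovEnergyAt_eq_energyAt, div_self h, sub_self, Real.rpow_zero,
    ENNReal.ofReal_one, one_mul, ENNReal.mul_iSup]

/-- The Besov seminorm at the critical exponent is comparable with the `p`-energy. -/
theorem exists_besovNormInf_comparison {l : RatioSeq} {L : ℕ} (hL : ∀ k, l.ratio k ≤ L) {p : ℝ}
    (hp : 1 < p) :
    ∃ C : ℝ≥0, 1 ≤ C ∧ ∀ βs, βs ≠ 0 → ∀ u : vicsek l → ℝ, Continuous u →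
      besovNormInf l p βs βs u ^ p ≤ C * energy l p u ∧
      energy l p u ≤ C * besovNormInf l p βs βs u ^ p := by
  obtain ⟨C, hC1, hC⟩ := exists_besov_comparison hL hp (t₀ := 1) 1
    ((div_lt_one (by linarith)).2 (by linarith)) le_rfl
  have h2 : (1 : ℝ) ≤ 2 ^ (p - 1) := Real.one_le_rpow (by norm_num) (by linarith)
  set A : ℝ≥0 := Real.toNNReal ((2 : ℝ) ^ (p - 1)) with hA
  have hA1 : 1 ≤ A := Real.one_le_toNNReal.2 h2
  have hA0 : A ≠ 0 := (zero_lt_one.trans_le hA1).ne'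
  refine ⟨A * C, one_le_mul hA1 hC1, fun βs hβ u hu => ?_⟩
  obtain ⟨h3, h4, -⟩ := hC βs βs (by rw [div_self hβ]) (by rw [div_self hβ]) u hu
  have hE : energyInf l p βs βs u = (A : ℝ≥0∞)⁻¹ * energy l p u := by
    rw [energyInf_self l p hβ, ENNReal.ofReal_inv_of_pos (by positivity)]; rfl
  rw [hE] at h3 h4
  constructor
  · refine h3.trans ?_
    rw [ENNReal.coe_mul, mul_comm (A : ℝ≥0∞), mul_assoc]
    refine mul_le_mul_right (mul_le_mul_left ?_ _) _
    exact (ENNReal.inv_le_one.2 (by exact_mod_cast hA1)).trans (by exact_mod_cast hA1)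
  · rw [ENNReal.inv_mul_le_iff (by exact_mod_cast hA0) ENNReal.coe_ne_top] at h4
    rwa [ENNReal.coe_mul, mul_assoc]

theorem mem_besovInf_self_iff {l : RatioSeq} {L : ℕ} (hL : ∀ k, l.ratio k ≤ L) {p : ℝ} (hp : 1 < p)
    {βs : ℝ} (hβ : βs ≠ 0) (u : vicsek l → ℝ) :
    u ∈ besovInf l p βs βs ↔ ∃ v ∈ energyDomain l p, u =ᵐ[mu l] v := by
  have hp0 : 0 < p := by linarith
  obtain ⟨C, -, hC⟩ := exists_besovNormInf_comparison hL hp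
  constructor
  · intro hu
    obtain ⟨v, hv⟩ := exists_continuous_of_mem_besovInf hL hp (by
      rw [div_self hβ]; exact (div_lt_one (by linarith)).2 (by linarith)) hu
    refine ⟨v, (hC βs hβ v v.continuous).2.trans_lt (ENNReal.mul_lt_top ENNReal.coe_lt_top ?_), hv⟩
    rw [← besovNormInf_congr p βs βs hv]
    exact ENNReal.rpow_lt_top_of_nonneg hp0.le hu.2.ne
  · rintro ⟨v, hv, huv⟩
    refine ⟨(memLp_congr_ae huv).2 (memLp_of_continuous v.continuous _), ?_⟩
    rw [besovNormInf_congr p βs βs huv, ← ENNReal.rpow_lt_top_iff_of_pos hp0]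
    exact (hC βs hβ v v.continuous).1.trans_lt (ENNReal.mul_lt_top ENNReal.coe_lt_top hv)

/-! ### The critical exponent -/

theorem phiAt_zero (l : RatioSeq) (p : ℝ) : phiAt l p 0 = 2 ^ (p - 1) := by
  simp [phiAt, rho_zero, numWords]

theorem phiAt_le (l : RatioSeq) {p : ℝ} (hp : 1 < p) (n : ℕ) :
    phiAt l p n ≤ 2 ^ (p - 1) * ((3 : ℝ) ^ (-(p - 1))) ^ n := by
  induction n with
  | zero => rw [phiAt_zero, pow_zero, mul_one]
  | succ n ih =>
    have h1 := three_rpow_le_growth l hp n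
    have h2 := phiAt_pos l p (n + 1)
    have h3 : (0 : ℝ) < 3 ^ (p - 1) := by positivity
    rw [pow_succ, ← mul_assoc, Real.rpow_neg (by norm_num) (p - 1), ← div_eq_mul_inv, le_div_iff₀ h3,
      ← Real.rpow_neg (by norm_num)]
    rw [phiAt_succ] at ih
    nlinarith

theorem three_rpow_neg_lt_one {p : ℝ} (hp : 1 < p) : (3 : ℝ) ^ (-(p - 1)) < 1 :=
  Real.rpow_lt_one_of_one_lt_of_neg (by norm_num) (by linarith)

theorem tendsto_phiAt (l : RatioSeq) {p : ℝ} (hp : 1 < p) :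
    Tendsto (phiAt l p) atTop (𝓝[>] 0) := by
  rw [tendsto_nhdsWithin_iff]
  refine ⟨squeeze_zero (fun n => (phiAt_pos l p n).le) (phiAt_le l hp) ?_,
    Eventually.of_forall fun n => phiAt_pos l p n⟩
  have := (tendsto_pow_atTop_nhds_zero_of_lt_one (Real.rpow_nonneg (by norm_num : (0 : ℝ) ≤ 3) _)
    (three_rpow_neg_lt_one hp)).const_mul ((2 : ℝ) ^ (p - 1))
  rwa [mul_zero] at this

/-- The telescoping series from the centre of the whole set vanishes, so `u` equals its value there.
-/
theorem ae_const_of_edgeSum_eq_zero {l : RatioSeq} {L : ℕ} (hL : ∀ k, l.ratio k ≤ L) {p : ℝ}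
    (hp : 1 ≤ p) {u : vicsek l → ℝ} (hu : Continuous u) (h : ∀ n, edgeSum l p n u = 0) :
    ∃ c : ℝ, u =ᵐ[mu l] fun _ => c := by
  have hp0 : 0 < p := by linarith
  have hp1 : 0 < 1 / p := by positivity
  have h1 := centerInt_rpow_le hL hp hu 0
  simp only [meanEnergy, h, mul_zero, ENNReal.zero_rpow_of_pos hp1, tsum_zero] at h1
  have h2 : centerInt l p u 0 = 0 := by
    rcases ENNReal.rpow_eq_zero_iff.1 (le_antisymm h1 bot_le) with h | h
    · exact h.1
    · exact absurd hp1 (not_lt.2 h.2.le)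
  let w : Word l 0 := fun k => k.elim0
  refine ⟨u (ctr w), ?_⟩
  have h3 : ∫⁻ x, ENNReal.ofReal (|u (ctr w) - u x| ^ p) ∂mu l = 0 := by
    rw [mu_eq, lintegral_map (by fun_prop) (measurable_coding l), ← h2, centerInt]
    refine lintegral_congr fun ω => ?_
    rw [Subsingleton.elim (pre 0 ω) w]
  rw [lintegral_eq_zero_iff (by fun_prop)] at h3
  filter_upwards [h3] with x hx
  have h4 : |u (ctr w) - u x| ^ p ≤ 0 := ENNReal.ofReal_eq_zero.1 hx
  have h5 : |u (ctr w) - u x| = 0 := by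
    by_contra hne
    have := Real.rpow_pos_of_pos (lt_of_le_of_ne (abs_nonneg (u (ctr w) - u x)) (Ne.symm hne)) p
    linarith
  exact (sub_eq_zero.1 (abs_eq_zero.1 h5)).symm

/-- A nonzero energy at one level persists at all finer levels, while its factor `φ(ρ_n) ^ (1 - β /
βs)` tends to infinity; so all edge sums vanish. -/
theorem ae_const_of_mem_besovInf {l : RatioSeq} {L : ℕ} (hL : ∀ k, l.ratio k ≤ L) {p : ℝ}
    (hp : 1 < p) {βs β : ℝ} (hβ : 1 < β / βs) {u : vicsek l → ℝ} (hu : u ∈ besovInf l p βs β) :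
    ∃ c : ℝ, u =ᵐ[mu l] fun _ => c := by
  have hp0 : 0 < p := by linarith
  have hε : 2 / (p + 1) < 1 := (div_lt_one (by linarith)).2 (by linarith)
  obtain ⟨v, hv⟩ := exists_continuous_of_mem_besovInf hL hp (hε.trans hβ) hu
  obtain ⟨C, -, hC⟩ := exists_besov_comparison hL hp (t₀ := 1) (β / βs) hε le_rfl
  have hM : energyInf l p βs β v < ∞ := by
    refine (hC βs β hβ.le le_rfl v v.continuous).2.1.trans_lt
      (ENNReal.mul_lt_top ENNReal.coe_lt_top ?_)
    rw [← besovNormInf_congr p βs β hv]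
    exact ENNReal.rpow_lt_top_of_nonneg hp0.le hu.2.ne
  set A := ENNReal.ofReal (((2 : ℝ) ^ (p - 1))⁻¹) with hA
  have hA0 : A ≠ 0 := (ENNReal.ofReal_pos.2 (by positivity)).ne'
  have hz : ∀ N, energyAt l p N v = 0 := by
    intro N
    by_contra hne
    have h1 : Tendsto (fun n => ENNReal.ofReal (phiAt l p n ^ (1 - β / βs)) *
        (A * energyAt l p N v)) atTop (𝓝 (∞ * (A * energyAt l p N v))) := by
      refine ENNReal.Tendsto.mul_const ?_ (Or.inl ENNReal.top_ne_zero)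
      rw [ENNReal.tendsto_ofReal_nhds_top]
      exact (tendsto_rpow_neg_nhdsGT_zero (by linarith)).comp (tendsto_phiAt l hp)
    rw [ENNReal.top_mul (mul_ne_zero hA0 hne)] at h1
    have h2 : ∞ ≤ energyInf l p βs β v := by
      refine le_of_tendsto h1 ?_
      filter_upwards [eventually_ge_atTop N] with n hn
      calc _ ≤ besovEnergyAt l p βs β n v := by
            rw [besovEnergyAt_eq_energyAt]
            exact mul_le_mul_right (mul_le_mul_right (energyAt_mono hp.le _ hn) _) _
        _ ≤ _ := le_iSup (fun n => besovEnergyAt l p βs β n v) n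
    exact (not_lt.2 h2) hM
  obtain ⟨c, hc⟩ := ae_const_of_edgeSum_eq_zero hL hp.le v.continuous fun n => by
    have h1 := hz n
    rw [energyAt, mul_eq_zero] at h1
    refine h1.resolve_left (ENNReal.ofReal_pos.2 ?_).ne'
    exact mul_pos (by norm_num) (Finset.prod_pos fun k _ =>
      Real.rpow_pos_of_pos (by have := three_le_ratio l k; linarith) _)
  exact ⟨c, hv.trans hc⟩

/-! ### Weak monotonicity -/

theorem ofReal_prod_ratio_mul_cellEnergy (l : RatioSeq) (p : ℝ) (u : vicsek l → ℝ) (n : ℕ) :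
    ENNReal.ofReal (∏ k ∈ Finset.range n, (l.ratio k : ℝ) ^ (p - 1)) * cellEnergy l p u n =
      ENNReal.ofReal ((2 : ℝ) ^ (p - 1)) * (weight l p 1 n * meanInt l p u n) := by
  have hN : (0 : ℝ) < numWords l n := by exact_mod_cast numWords_pos l n
  have h2 : (0 : ℝ) ≤ 2 ^ (p - 1) := by positivity
  rw [prod_ratio_rpow, ENNReal.ofReal_mul h2,
    ENNReal.ofReal_mul (inv_nonneg.2 (phiAt_pos l p n).le), ENNReal.ofReal_inv_of_pos hN,
    ENNReal.ofReal_natCast, cellEnergy, meanInt, weight, Real.rpow_neg_one, mul_assoc, mul_assoc, sq,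
    mul_assoc (numWords l n : ℝ≥0∞), ← mul_assoc (_⁻¹) (numWords l n : ℝ≥0∞),
    ENNReal.inv_mul_cancel (numWords_ne_zero l _) (ENNReal.natCast_ne_top _), one_mul]

/-- Small radii at which `Phi` stays below a number above its lower limit give infinitely many
levels with bounded double integrals, and `energyAt_le_of_frequently` applies. -/
theorem exists_energy_le_liminf {l : RatioSeq} {L : ℕ} (hL : ∀ k, l.ratio k ≤ L) {p : ℝ}
    (hp : 1 < p) :
    ∃ C : ℝ≥0, ∀ βs, βs ≠ 0 → ∀ u : vicsek l → ℝ, Continuous u →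
      energy l p u ≤ C * liminf (Phi l p βs βs u) (𝓝[>] 0) := by
  obtain ⟨Q, hQ⟩ : ∃ Q : ℝ≥0, (Q : ℝ≥0∞) =
      ENNReal.ofReal (((L : ℝ) ^ (p - 1) * (2 * L)) ^ (1 : ℝ)) * (2 * L : ℕ) * (18 * L : ℕ) := by
    refine ⟨Real.toNNReal (((L : ℝ) ^ (p - 1) * (2 * L)) ^ (1 : ℝ)) * (2 * L : ℕ) * (18 * L : ℕ), ?_⟩
    push_cast; rfl
  obtain ⟨A, hA⟩ : ∃ A : ℝ≥0, (A : ℝ≥0∞) = ENNReal.ofReal (L ^ (p - 1)) * (2 * L : ℕ) ^ 2 * 4 := by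
    refine ⟨Real.toNNReal (L ^ (p - 1)) * (2 * L : ℕ) ^ 2 * 4, ?_⟩
    push_cast; rfl
  obtain ⟨B, hB⟩ : ∃ B : ℝ≥0, (B : ℝ≥0∞) = ENNReal.ofReal ((2 : ℝ) ^ (p - 1)) := ⟨_, rfl⟩
  -- The summand `1` only keeps the constant away from zero, so that it can be moved to the other
  -- side.
  set C : ℝ≥0 := A * (B * Q) + 1 with hC
  have hC0 : (C : ℝ≥0∞) ≠ 0 := by
    have : C ≠ 0 := (add_pos_of_nonneg_of_pos bot_le one_pos).ne'
    exact_mod_cast this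
  refine ⟨C, fun βs hβ u hu => ?_⟩
  rw [← ENNReal.inv_mul_le_iff hC0 ENNReal.coe_ne_top]
  refine le_of_forall_gt_imp_ge_of_dense fun b hb => ?_
  rw [ENNReal.inv_mul_le_iff hC0 ENNReal.coe_ne_top]
  have hfreq := frequently_lt_of_liminf_lt (h := hb)
  refine iSup_le fun n => ?_
  have key : ∃ᶠ m in atTop, ENNReal.ofReal (∏ k ∈ Finset.range m, (l.ratio k : ℝ) ^ (p - 1)) *
      cellEnergy l p u m ≤ B * (Q * b) := by
    rw [frequently_atTop]
    intro N
    have hsmall : ∀ᶠ r in 𝓝[>] (0 : ℝ), 0 < r ∧ r < rho l N :=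
      (eventually_mem_nhdsWithin).and (nhdsWithin_le_nhds (gt_mem_nhds (rho_pos l N)))
    obtain ⟨r, hr, hr0, hrN⟩ := (hfreq.and_eventually hsmall).exists
    obtain ⟨m, h1, h2⟩ := exists_level (l := l) hr0
      (hrN.le.trans (by rw [← rho_zero l]; exact rho_anti l (Nat.zero_le N)))
    refine ⟨m + 1, ?_, ?_⟩
    · by_contra hcon
      exact absurd (h1.trans hrN) (not_lt.2 (rho_anti l (by omega)))
    · have e : βs / βs = 1 := div_self hβ
      have h3 := weight_mul_meanInt_succ_le hL hp (βs := βs) (β := βs) (t₁ := 1) (by rw [e]; norm_num)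
        (by rw [e]) u h1 h2
      rw [e, ← hQ] at h3
      rw [ofReal_prod_ratio_mul_cellEnergy, ← hB]
      exact mul_le_mul_right (h3.trans (mul_le_mul_right hr.le _)) _
  refine (energyAt_le_of_frequently hL hp hu key n).trans ?_
  rw [← hA, hC]
  calc (A : ℝ≥0∞) * (B * (Q * b)) = (A * (B * Q)) * b := by ring
    _ ≤ _ := by
      push_cast
      exact mul_le_mul_left le_self_add _

/-! ### Convergence of the energies as `β ↑ β*` -/

theorem energySum_eq_tsum (l : RatioSeq) (p βs β : ℝ) (u : vicsek l → ℝ) :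
    energySum l p βs β u = ENNReal.ofReal (((2 : ℝ) ^ (p - 1))⁻¹) *
      ∑' n, ENNReal.ofReal (phiAt l p n ^ (1 - β / βs)) * energyAt l p n u := by
  rw [energySum, ← ENNReal.tsum_mul_left]
  refine tsum_congr fun n => ?_
  rw [besovEnergyAt_eq_energyAt, mul_left_comm]

/-- Each energy is at most the supremum and `φ(ρ_n)` decays geometrically, so the sum is at most a
geometric series, of order `1 / (1 - κ ^ s)` with `s = 1 - β / βs`. -/
theorem exists_mul_energySum_le (l : RatioSeq) {p : ℝ} (hp : 1 < p) {βs : ℝ} (hβs : 0 < βs) :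
    ∃ K : ℝ≥0, ∀ β, 0 ≤ β → β < βs → ∀ u : vicsek l → ℝ,
      ENNReal.ofReal (βs - β) * energySum l p βs β u ≤ K * energy l p u := by
  set κ : ℝ := (3 : ℝ) ^ (-(p - 1)) with hκ
  have hκ0 : 0 < κ := by positivity
  have hκ1 : κ < 1 := three_rpow_neg_lt_one hp
  set A : ℝ := 2 ^ (p - 1) with hA
  have hA1 : 1 ≤ A := Real.one_le_rpow (by norm_num) (by linarith)
  refine ⟨Real.toNNReal (βs / (1 - κ)), fun β h0 h1 u => ?_⟩
  set s := 1 - β / βs with hs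
  have hs0 : 0 < s := by rw [hs, sub_pos, div_lt_one hβs]; exact h1
  have hs1 : s ≤ 1 := by rw [hs]; have := div_nonneg h0 hβs.le; linarith
  have hβ : βs - β = βs * s := by rw [hs]; field_simp
  -- Bernoulli's inequality bounds `1 - κ ^ s` from below linearly in `s`, matching the factor `βs -
  -- β = βs * s`.
  have hκs : κ ^ s ≤ 1 - s * (1 - κ) := by
    have := rpow_one_add_le_one_add_mul_self (s := κ - 1) (by linarith) hs0.le hs1
    rw [add_sub_cancel] at this
    linarith
  have hκs1 : 0 < 1 - κ ^ s := by nlinarith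
  have hκs0 : 0 ≤ κ ^ s := by positivity
  have hphi : ∀ n, phiAt l p n ^ s ≤ A * (κ ^ s) ^ n := by
    intro n
    calc phiAt l p n ^ s ≤ (A * κ ^ n) ^ s :=
          Real.rpow_le_rpow (phiAt_pos l p n).le (phiAt_le l hp n) hs0.le
      _ = A ^ s * (κ ^ s) ^ n := by
          rw [Real.mul_rpow (by linarith) (by positivity), ← Real.rpow_natCast, ← Real.rpow_natCast,
            ← Real.rpow_mul hκ0.le, ← Real.rpow_mul hκ0.le, mul_comm s]
      _ ≤ _ := by
          refine mul_le_mul_of_nonneg_right ?_ (by positivity)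
          simpa using Real.rpow_le_rpow_of_exponent_le hA1 hs1
  have hsum : ∑' n, ENNReal.ofReal (phiAt l p n ^ s) * energyAt l p n u ≤
      ENNReal.ofReal (A * (1 - κ ^ s)⁻¹) * energy l p u := by
    calc _ ≤ ∑' n, ENNReal.ofReal A * ENNReal.ofReal (κ ^ s) ^ n * energy l p u := by
          refine ENNReal.tsum_le_tsum fun n => mul_le_mul' ?_ (le_iSup (fun n => energyAt l p n u) n)
          rw [← ENNReal.ofReal_pow hκs0, ← ENNReal.ofReal_mul (by linarith)]
          exact ENNReal.ofReal_le_ofReal (hphi n)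
      _ = _ := by
          rw [ENNReal.tsum_mul_right, ENNReal.tsum_mul_left, ENNReal.tsum_geometric,
            ENNReal.ofReal_mul (by linarith), ENNReal.ofReal_inv_of_pos hκs1,
            ENNReal.ofReal_sub _ hκs0, ENNReal.ofReal_one]
  rw [energySum_eq_tsum, hβ]
  calc _ ≤ ENNReal.ofReal (βs * s) * (ENNReal.ofReal A⁻¹ *
        (ENNReal.ofReal (A * (1 - κ ^ s)⁻¹) * energy l p u)) :=
        mul_le_mul_right (mul_le_mul_right hsum _) _
    _ = ENNReal.ofReal (βs * s * (A⁻¹ * (A * (1 - κ ^ s)⁻¹))) * energy l p u := by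
        rw [← mul_assoc, ← mul_assoc, ← ENNReal.ofReal_mul (by positivity),
          ← ENNReal.ofReal_mul (by positivity), mul_assoc (βs * s)]
    _ ≤ ENNReal.ofReal (βs / (1 - κ)) * energy l p u := by
        refine mul_le_mul_left (ENNReal.ofReal_le_ofReal ?_) _
        rw [inv_mul_cancel_left₀ (by linarith), ← div_eq_mul_inv,
          div_le_div_iff₀ hκs1 (by linarith)]
        nlinarith
    _ = _ := rfl

theorem le_phiAt {l : RatioSeq} {L : ℕ} (hL : ∀ k, l.ratio k ≤ L) {p : ℝ} (hp : 1 < p) (n : ℕ) :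
    (((L : ℝ) ^ (p - 1) * (2 * L))⁻¹) ^ n ≤ phiAt l p n := by
  induction n with
  | zero =>
    rw [phiAt_zero, pow_zero]
    exact Real.one_le_rpow (by norm_num) (by linarith)
  | succ n ih =>
    have h1 := growth_le hL hp n
    have h2 := growth_pos l p n
    have h3 := phiAt_pos l p (n + 1)
    rw [pow_succ, ← div_eq_mul_inv, div_le_iff₀ (h2.trans_le h1)]
    refine ih.trans ?_
    rw [phiAt_succ, mul_comm]
    exact mul_le_mul_of_nonneg_left h1 h3.le

/-- By monotonicity all terms from level `N` on carry at least the energy of level `N`, and bounded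
ratios prevent `φ(ρ_n)` from decaying faster than geometrically. How close `β` must be to `βs`
depends on `N`, but the constant does not. -/
theorem exists_energyAt_le_mul_energySum {l : RatioSeq} {L : ℕ} (hL : ∀ k, l.ratio k ≤ L) {p : ℝ}
    (hp : 1 < p) {βs : ℝ} (hβs : 0 < βs) :
    ∃ K : ℝ≥0, ∀ (u : vicsek l → ℝ) (N : ℕ), ∀ᶠ β in 𝓝[<] βs,
      energyAt l p N u ≤ K * (ENNReal.ofReal (βs - β) * energySum l p βs β u) := by
  set G : ℝ := (L : ℝ) ^ (p - 1) * (2 * L) with hG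
  have hG1 : 1 < G := by
    have h3 : (3 : ℝ) ≤ L := (three_le_ratio l 0).trans (by exact_mod_cast hL 0)
    have := Real.one_le_rpow (by linarith : (1 : ℝ) ≤ L) (by linarith : 0 ≤ p - 1)
    nlinarith
  have hG0 : 0 < G := by linarith
  have hlog : 0 < Real.log G := Real.log_pos hG1
  set A : ℝ := 2 ^ (p - 1) with hA
  have hA0 : 0 < A := by positivity
  refine ⟨Real.toNNReal (2 * A * Real.log G / βs), fun u N => ?_⟩
  -- The price `q ^ N` of discarding the first `N` terms tends to `1`; it is eventually above one
  -- half, whence the `2` in the constant.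
  have hlim : Tendsto (fun β => ((G⁻¹) ^ (1 - β / βs)) ^ N) (𝓝[<] βs) (𝓝 1) := by
    have hc : Continuous fun β => ((G⁻¹) ^ (1 - β / βs)) ^ N := by
      refine (Continuous.rpow continuous_const (by fun_prop) fun x => Or.inl ?_).pow N
      exact (inv_pos.2 hG0).ne'
    have := hc.tendsto βs
    rw [div_self hβs.ne', sub_self, Real.rpow_zero, one_pow] at this
    exact this.mono_left nhdsWithin_le_nhds
  filter_upwards [hlim.eventually_const_lt (by norm_num : (1 / 2 : ℝ) < 1), eventually_mem_nhdsWithin]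
    with β hβ1 hβ2
  have hβ2 : β < βs := hβ2
  set s := 1 - β / βs with hs
  have hs0 : 0 < s := by rw [hs, sub_pos, div_lt_one hβs]; exact hβ2
  have hβ : βs - β = βs * s := by rw [hs]; field_simp
  set q : ℝ := (G⁻¹) ^ s with hq
  have hq0 : 0 < q := Real.rpow_pos_of_pos (inv_pos.2 hG0) _
  have hq1 : q < 1 := Real.rpow_lt_one (inv_pos.2 hG0).le (inv_lt_one_of_one_lt₀ hG1) hs0
  -- Convexity of the exponential: `1 - q` is at most linear in `s`, so the geometric sum is at
  -- least of order `1 / s`.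
  have hq2 : 1 - q ≤ s * Real.log G := by
    have := Real.add_one_le_exp (Real.log (G⁻¹) * s)
    rw [← Real.rpow_def_of_pos (inv_pos.2 hG0), Real.log_inv] at this
    linarith
  have hphi : ∀ n, q ^ n ≤ phiAt l p n ^ s := by
    intro n
    calc q ^ n = ((G⁻¹) ^ n) ^ s := by
          rw [hq, ← Real.rpow_natCast, ← Real.rpow_natCast, ← Real.rpow_mul (inv_pos.2 hG0).le,
            ← Real.rpow_mul (inv_pos.2 hG0).le, mul_comm s]
      _ ≤ _ := Real.rpow_le_rpow (by positivity) (le_phiAt hL hp n) hs0.le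
  have hsum : ENNReal.ofReal (q ^ N * (1 - q)⁻¹) * energyAt l p N u ≤
      ∑' n, ENNReal.ofReal (phiAt l p n ^ s) * energyAt l p n u := by
    calc _ = ∑' k, ENNReal.ofReal (q ^ N) * ENNReal.ofReal q ^ k * energyAt l p N u := by
          rw [ENNReal.tsum_mul_right, ENNReal.tsum_mul_left, ENNReal.tsum_geometric,
            ENNReal.ofReal_mul (by positivity), ENNReal.ofReal_inv_of_pos (by linarith),
            ENNReal.ofReal_sub _ hq0.le, ENNReal.ofReal_one]
      _ ≤ ∑' k, ENNReal.ofReal (phiAt l p (N + k) ^ s) * energyAt l p (N + k) u := by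
          refine ENNReal.tsum_le_tsum fun k =>
            mul_le_mul' ?_ (energyAt_mono hp.le u (Nat.le_add_right N k))
          rw [← ENNReal.ofReal_pow hq0.le, ← ENNReal.ofReal_mul (by positivity), ← pow_add]
          exact ENNReal.ofReal_le_ofReal (hphi _)
      _ ≤ _ := ENNReal.tsum_comp_le_tsum_of_injective (add_right_injective N)
          (fun n => ENNReal.ofReal (phiAt l p n ^ s) * energyAt l p n u)
  have h1q : 0 < 1 - q := by linarith
  rw [energySum_eq_tsum, hβ]
  calc energyAt l p N u = ENNReal.ofReal 1 * energyAt l p N u := by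
        rw [ENNReal.ofReal_one, one_mul]
    _ ≤ ENNReal.ofReal (2 * A * Real.log G / βs * (βs * s * (A⁻¹ * (q ^ N * (1 - q)⁻¹)))) *
        energyAt l p N u := by
        refine mul_le_mul_left (ENNReal.ofReal_le_ofReal ?_) _
        have e : 2 * A * Real.log G / βs * (βs * s * (A⁻¹ * (q ^ N * (1 - q)⁻¹))) =
            (2 * q ^ N) * (s * Real.log G / (1 - q)) := by
          field_simp
        rw [e]
        exact one_le_mul_of_one_le_of_one_le (by linarith) ((one_le_div h1q).2 hq2)
    _ = ENNReal.ofReal (2 * A * Real.log G / βs) * (ENNReal.ofReal (βs * s) *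
        (ENNReal.ofReal A⁻¹ * (ENNReal.ofReal (q ^ N * (1 - q)⁻¹) * energyAt l p N u))) := by
        rw [ENNReal.ofReal_mul (by positivity), ENNReal.ofReal_mul (by positivity),
          ENNReal.ofReal_mul (p := A⁻¹) (by positivity)]
        ring
    _ ≤ _ := mul_le_mul_right (mul_le_mul_right (mul_le_mul_right hsum _) _) _

/-- The lower bound by `e N` holds near the limit only for each `N` separately, so the supremum over
`N` is taken after the lower limit. -/
theorem liminf_limsup_bounds {f : Filter ℝ} [f.NeBot] {F : ℝ → ℝ≥0∞} {e : ℕ → ℝ≥0∞} {E : ℝ≥0∞}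
    {K C : ℝ≥0} (hK : 1 ≤ K) (hC : K * K ≤ C) (h1 : ∀ᶠ β in f, F β ≤ K * E)
    (h2 : ∀ N, ∀ᶠ β in f, e N ≤ K * F β) (h3 : E ≤ K * ⨆ N, e N) :
    (C : ℝ≥0∞)⁻¹ * E ≤ liminf F f ∧ liminf F f ≤ limsup F f ∧ limsup F f ≤ C * E := by
  have hK0 : (K : ℝ≥0∞) ≠ 0 := by exact_mod_cast (zero_lt_one.trans_le hK).ne'
  have hKC : K ≤ C := (le_mul_of_one_le_left' hK).trans hC
  have hC0 : (C : ℝ≥0∞) ≠ 0 := by exact_mod_cast ((zero_lt_one.trans_le hK).trans_le hKC).ne'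
  refine ⟨?_, liminf_le_limsup, limsup_le_of_le (h := ?_)⟩
  · rw [ENNReal.inv_mul_le_iff hC0 ENNReal.coe_ne_top]
    have h4 : (⨆ N, e N) ≤ K * liminf F f := by
      refine iSup_le fun N => ?_
      rw [← ENNReal.inv_mul_le_iff hK0 ENNReal.coe_ne_top]
      refine le_liminf_of_le (h := ?_)
      filter_upwards [h2 N] with β hβ
      rwa [ENNReal.inv_mul_le_iff hK0 ENNReal.coe_ne_top]
    calc E ≤ K * (K * liminf F f) := h3.trans (mul_le_mul_right h4 _)
      _ = ((K * K : ℝ≥0) : ℝ≥0∞) * liminf F f := by push_cast; ring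
      _ ≤ _ := mul_le_mul_left (by exact_mod_cast hC) _
  · filter_upwards [h1] with β hβ
    exact hβ.trans (mul_le_mul_left (by exact_mod_cast hKC) _)

end Vicsek
-- Assembly of the theorem
theorem theorem1p3 (l : RatioSeq) (hl : BddAbove (Set.range l.ratio)) (p : ℝ) (hp : 1 < p) :
    ∃ ε : ℝ, 0 < ε ∧ ε < 1 ∧ ∀ βs : ℝ, 0 < βs →
      -- comparison of seminorms and embedding into the continuous functions
      (∀ β : ℝ, ε * βs < β →
        besov l p p βs β ⊆ besovInf l p βs β ∧
        (∀ u ∈ besovInf l p βs β, ∃ v : C(vicsek l, ℝ), u =ᵐ[mu l] v) ∧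
        ∃ C : ℝ≥0, 1 ≤ C ∧ ∀ u : C(vicsek l, ℝ),
          ((C : ℝ≥0∞)⁻¹ * besovNormInf l p βs β u ^ p ≤ energyInf l p βs β u ∧
            energyInf l p βs β u ≤ C * besovNormInf l p βs β u ^ p) ∧
          ((C : ℝ≥0∞)⁻¹ * besovNorm l p p βs β u ^ p ≤ energySum l p βs β u ∧
            energySum l p βs β u ≤ C * besovNorm l p p βs β u ^ p)) ∧
      -- the case `β = β*`: the domain of the `p`-energy is `B_{p,∞}^{β*}`
      (∀ u : vicsek l → ℝ, u ∈ besovInf l p βs βs ↔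
        ∃ v ∈ energyDomain l p, u =ᵐ[mu l] v) ∧
      (∃ C : ℝ≥0, 1 ≤ C ∧ ∀ u ∈ energyDomain l p,
        (C : ℝ≥0∞)⁻¹ * besovNormInf l p βs βs u ^ p ≤ energy l p u ∧
          energy l p u ≤ C * besovNormInf l p βs βs u ^ p) ∧
      -- `β*` is the critical Besov exponent
      IsGreatest {β : ℝ | 0 ≤ β ∧ ∃ u ∈ besovInf l p βs β,
        ¬ ∃ c : ℝ, u =ᵐ[mu l] fun _ => c} βs ∧
      -- weak monotonicity
      (∃ C : ℝ≥0, ∀ u ∈ besovInf l p βs βs,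
        (⨆ r ∈ radii l, Phi l p βs βs u r) ≤ C * liminf (Phi l p βs βs u) (𝓝[>] 0)) ∧
      -- Bourgain–Brezis–Mironescu convergence
      (∃ C : ℝ≥0, 1 < C ∧
        (∀ u ∈ energyDomain l p,
          (C : ℝ≥0∞)⁻¹ * energy l p u ≤
            liminf (fun β => ENNReal.ofReal (βs - β) * energySum l p βs β u) (𝓝[<] βs) ∧
          liminf (fun β => ENNReal.ofReal (βs - β) * energySum l p βs β u) (𝓝[<] βs) ≤
            limsup (fun β => ENNReal.ofReal (βs - β) * energySum l p βs β u) (𝓝[<] βs) ∧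
          limsup (fun β => ENNReal.ofReal (βs - β) * energySum l p βs β u) (𝓝[<] βs) ≤
            C * energy l p u) ∧
        (∀ u ∈ besovInf l p βs βs,
          (C : ℝ≥0∞)⁻¹ * besovNormInf l p βs βs u ^ p ≤
            liminf (fun β => ENNReal.ofReal (βs - β) * besovNorm l p p βs β u ^ p) (𝓝[<] βs) ∧
          liminf (fun β => ENNReal.ofReal (βs - β) * besovNorm l p p βs β u ^ p) (𝓝[<] βs) ≤
            limsup (fun β => ENNReal.ofReal (βs - β) * besovNorm l p p βs β u ^ p) (𝓝[<] βs) ∧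
          limsup (fun β => ENNReal.ofReal (βs - β) * besovNorm l p p βs β u ^ p) (𝓝[<] βs) ≤
            C * besovNormInf l p βs βs u ^ p)) := by
  obtain ⟨L, hL'⟩ := hl
  have hL : ∀ k, l.ratio k ≤ L := fun k => hL' (mem_range_self k)
  have hp0 : 0 < p := by linarith
  have hε0 : 0 < 2 / (p + 1) := by positivity
  have hε1 : 2 / (p + 1) < 1 := (div_lt_one (by linarith)).2 (by linarith)
  have inv_le : ∀ {C : ℝ≥0} {x y : ℝ≥0∞}, 1 ≤ C → x ≤ C * y → (C : ℝ≥0∞)⁻¹ * x ≤ y :=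
    fun hC h => (ENNReal.inv_mul_le_iff (by exact_mod_cast (zero_lt_one.trans_le hC).ne')
      ENNReal.coe_ne_top).2 h
  obtain ⟨C₁, hC₁, hcrit⟩ := exists_besovNormInf_comparison hL hp
  refine ⟨2 / (p + 1), hε0, hε1, fun βs hβs => ?_⟩
  have hself : βs / βs = 1 := div_self hβs.ne'
  have hcrit := hcrit βs hβs.ne'
  refine ⟨fun β hβ => ?_, mem_besovInf_self_iff hL hp hβs.ne', ⟨C₁, hC₁, fun u _ => ?_⟩, ⟨?_, ?_⟩,
    ?_, ?_⟩
  · have ht : 2 / (p + 1) < β / βs := (lt_div_iff₀ hβs).2 hβ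
    refine ⟨besov_subset_besovInf hL hp (hε0.trans ht).le,
      fun u hu => exists_continuous_of_mem_besovInf hL hp ht hu, ?_⟩
    -- The lower exponent is capped at `1`, as the growth estimate requires; the upper one is `β /
    -- βs` itself.
    obtain ⟨C, hC1, hC⟩ := exists_besov_comparison hL hp (t₀ := min (β / βs) 1) (β / βs)
      (lt_min ht hε1) (min_le_right _ _)
    refine ⟨C, hC1, fun u => ?_⟩
    obtain ⟨h1, h2, h3, h4⟩ := hC βs β (min_le_left _ _) le_rfl u u.continuous
    exact ⟨⟨inv_le hC1 h1, h2⟩, inv_le hC1 h3, h4⟩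
  · obtain ⟨h1, h2⟩ := hcrit u u.continuous
    exact ⟨inv_le hC₁ h1, h2⟩
  · exact ⟨hβs.le, diagProj l, (mem_besovInf_self_iff hL hp hβs.ne' _).2
      ⟨⟨diagProj l, continuous_diagProj l⟩, energy_diagProj_lt_top l hp, ae_eq_rfl⟩,
      diagProj_not_const l⟩
  · rintro β ⟨-, u, hu, hne⟩
    by_contra hcon
    exact hne (ae_const_of_mem_besovInf hL hp ((one_lt_div hβs).2 (not_le.1 hcon)) hu)
  · obtain ⟨C, hC⟩ := exists_energy_le_liminf hL hp
    refine ⟨C₁ * C, fun u hu => ?_⟩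
    obtain ⟨v, -, huv⟩ := (mem_besovInf_self_iff hL hp hβs.ne' u).1 hu
    rw [Phi_congr p βs βs huv, ← besovNormInf_rpow l hp0, ENNReal.coe_mul, mul_assoc]
    exact (hcrit v v.continuous).1.trans (mul_le_mul_right (hC βs hβs.ne' v v.continuous) _)
  · obtain ⟨K₁, hK₁⟩ := exists_mul_energySum_le l hp hβs
    obtain ⟨K₂, hK₂⟩ := exists_energyAt_le_mul_energySum hL hp hβs
    -- A fixed `t₀` below `1` and above the threshold gives one comparison constant for all `β < βs`
    -- close to `βs`, so the seminorm statement follows from the one for discrete energies.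
    obtain ⟨t₀, ht₀, ht₁⟩ := exists_between hε1
    obtain ⟨C₂, hC₂, hcomp⟩ := exists_besov_comparison hL hp 1 ht₀ ht₁.le
    set A : ℝ≥0 := max (max 1 K₁) K₂ with hA
    have hA1 : 1 ≤ A := (le_max_left _ _).trans (le_max_left _ _)
    have hAK₁ : (K₁ : ℝ≥0∞) ≤ A := by exact_mod_cast (le_max_right _ _).trans (le_max_left _ _)
    have hAK₂ : (K₂ : ℝ≥0∞) ≤ A := by exact_mod_cast le_max_right _ _
    set K : ℝ≥0 := C₁ * (C₂ * A) with hK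
    have hAK : A ≤ K := (le_mul_of_one_le_left' hC₂).trans (le_mul_of_one_le_left' hC₁)
    have hK1 : 1 ≤ K := hA1.trans hAK
    have hCK : C₁ ≤ K := le_mul_of_one_le_right' (one_le_mul hC₂ hA1)
    have hCAK : C₂ * A ≤ K := le_mul_of_one_le_left' hC₁
    have hAK' : (A : ℝ≥0∞) ≤ K := by exact_mod_cast hAK
    have hrange : ∀ᶠ β in 𝓝[<] βs, β < βs ∧ t₀ * βs < β :=
      eventually_mem_nhdsWithin.and (nhdsWithin_le_nhds (lt_mem_nhds (by nlinarith)))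
    have hupper : ∀ u : vicsek l → ℝ, ∀ᶠ β in 𝓝[<] βs,
        ENNReal.ofReal (βs - β) * energySum l p βs β u ≤ A * energy l p u := by
      intro u
      filter_upwards [hrange] with β hβ
      have h0 : 0 ≤ β := ((mul_pos (hε0.trans ht₀) hβs).trans hβ.2).le
      exact (hK₁ β h0 hβ.1 u).trans (mul_le_mul_left hAK₁ _)
    have hlower : ∀ (u : vicsek l → ℝ) (N : ℕ), ∀ᶠ β in 𝓝[<] βs, energyAt l p N u ≤
        A * (ENNReal.ofReal (βs - β) * energySum l p βs β u) := by
      intro u N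
      filter_upwards [hK₂ u N] with β hβ
      exact hβ.trans (mul_le_mul_left hAK₂ _)
    -- The summand `1` makes the constant strictly larger than `1`.
    refine ⟨K * K + 1, lt_add_of_pos_left _ (by positivity), fun u _ => ?_, fun u hu => ?_⟩
    · refine liminf_limsup_bounds (e := fun N => energyAt l p N u) hK1 le_self_add ?_ ?_ ?_
      · filter_upwards [hupper u] with β hβ
        exact hβ.trans (mul_le_mul_left hAK' _)
      · intro N
        filter_upwards [hlower u N] with β hβ
        exact hβ.trans (mul_le_mul_left hAK' _)
      · exact le_mul_of_one_le_left' (by exact_mod_cast hK1)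
    · obtain ⟨v, -, huv⟩ := (mem_besovInf_self_iff hL hp hβs.ne' u).1 hu
      simp only [besovNormInf_congr p βs βs huv, besovNorm_congr p p βs _ huv]
      obtain ⟨h1, h2⟩ := hcrit v v.continuous
      have hnear : ∀ᶠ β in 𝓝[<] βs,
          besovNorm l p p βs β v ^ p ≤ C₂ * energySum l p βs β v ∧
          energySum l p βs β v ≤ C₂ * besovNorm l p p βs β v ^ p := by
        filter_upwards [hrange] with β hβ
        exact (hcomp βs β ((le_div_iff₀ hβs).2 hβ.2.le) ((div_le_one hβs).2 hβ.1.le) v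
          v.continuous).2.2
      refine liminf_limsup_bounds (e := fun N => energyAt l p N v) hK1 le_self_add ?_ ?_ ?_
      · filter_upwards [hupper v, hnear] with β hβ hβ'
        calc _ ≤ ENNReal.ofReal (βs - β) * (C₂ * energySum l p βs β v) := mul_le_mul_right hβ'.1 _
          _ = C₂ * (ENNReal.ofReal (βs - β) * energySum l p βs β v) := by ring
          _ ≤ C₂ * (A * (C₁ * besovNormInf l p βs βs v ^ p)) :=
            mul_le_mul_right (hβ.trans (mul_le_mul_right h2 _)) _
          _ = _ := by rw [hK]; push_cast; ring
      · intro N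
        filter_upwards [hlower v N, hnear] with β hβ hβ'
        calc _ ≤ A * (ENNReal.ofReal (βs - β) * (C₂ * besovNorm l p p βs β v ^ p)) :=
            hβ.trans (mul_le_mul_right (mul_le_mul_right hβ'.2 _) _)
          _ = ((C₂ * A : ℝ≥0) : ℝ≥0∞) * (ENNReal.ofReal (βs - β) * besovNorm l p p βs β v ^ p) := by
            push_cast; ring
          _ ≤ _ := mul_le_mul_left (by exact_mod_cast hCAK) _
      · exact h1.trans (mul_le_mul_left (by exact_mod_cast hCK) _)
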